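/- Let $\alpha,\beta>0$ be real with $\beta/\alpha\notin\mathbb{Z}$, and let $\mathbb{T}=\mathbb{R}/2\pi\mathbb{Z}$. Write $\langle x\rangle=(1+|x|^2)^{1/2}$ and $\tilde u(k,\tau)=\iint_{\mathbb{R}\times\mathbb{T}}e^{-ikx-i\tau t}u(t,x)\,dx\,dt$ for $k\in\mathbb{Z}$, $\tau\in\mathbb{R}$. For $s\in\mathbb{R}$, and with $m_S(k,\tau)=\tau-\alpha k^2$, $m_W(k,\tau)=|\tau|-\beta|k|$, put for $A\in\{S,W\}$ $$\|u\|_{Y^s_A}=\big\|\langle k\rangle^s\langle m_A\rangle^{1/2}\tilde u\big\|_{\ell^2_kL^2_\tau}+\big\|\langle k\rangle^s\tilde u\big\|_{\ell^2_kL^1_\tau},\qquad \|u\|_{Z^s_A}=\big\|\langle k\rangle^s\langle m_A\rangle^{-1/2}\tilde u\big\|_{\ell^2_kL^2_\tau}+\big\|\langle k\rangle^s\langle m_A\rangle^{-1}\tilde u\big\|_{\ell^2_kL^1_\tau},$$ and let $Y^s_A$, $Z^s_A$ be the corresponding spaces of space-time distributions $u$ on $\mathbb{R}\times\mathbb{T}$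 whose Fourier transform $\tilde u$ is a function and whose norm is finite. For $T>0$ let $\|g\|_{Z^s_A([0,T]\times\mathbb{T})}$ be the infimum of $\|F\|_{Z^s_A}$ over all $F\in Z^s_A$ that coincide with $g$ on $(0,T)\times\mathbb{T}$. For $N=2^j$, $j=0,1,2,\dots$, let $P_N$ be the projection onto the spatial frequencies $k\in\mathbb{Z}$ with $N\le|k|<2N$. Then there is $\gamma_0>0$ such that for every $0<\gamma<\gamma_0$ there is a constant $C>0$ (depending only on $\alpha,\beta,\gamma$) such that, for all $0<T<1$ and all dyadic numbers $N_0,N_1,N_2\in\{1,2,4,\dots\}$, $$\big\|P_{N_0}\big(P_{N_1}u\,P_{N_2}v\big)\big\|_{Z^0_S([0,T]\times\mathbb{T})}\le C\,T^\gamma\,\|u\|_{Y^0_S}\,\|v\|_{Y^{-1/2}_W}\qquad\text{for all }u\in Y^0_S,\ v\in Y^{-1/2}_W,$$ $$\big\|P_{N_0}\,\partial_x\big(P_{N_1}u\,\overline{P_{N_2}v}\big)\big\|_{Z^{-1/2}_W([0,T]\times\mathbb{T})}\le C\,T^\gamma\,\|u\|_{Y^0_S}\,\|v\|_{Y^0_S}\qquad\text{for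 all }u,v\in Y^0_S.$$ -/

import Mathlib

open MeasureTheory
open scoped SchwartzMap ENNReal

namespace Zakharov

noncomputable section

/-- A space-time distribution on `ℝ × 𝕋`, `𝕋 = ℝ / 2πℤ`, given by its sequence of spatial Fourier
coefficients: `u k ∈ 𝓢'(ℝ)` is the time distribution `û_k`, where for a function
`û_k(t) = ∫_𝕋 e^{-ikx} u(t, x) dx`.  Finiteness of any of the norms below forces polynomial growth
of the coefficients in `k`, so that the spaces of elements of finite norm are spaces of tempered
distributions on `ℝ × 𝕋`. -/
abbrev STDist : Type := ℤ → 𝓢'(ℝ, ℂ)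

/-- `f` is the space-time Fourier transform `ũ(k, τ) = ∫∫ e^{-ikx} e^{-iτt} u(t, x) dx dt`
(and this transform is a function): by Fourier inversion in time,
`û_k(t) = (1 / 2π) ∫ e^{iτt} f(k, τ) dτ` in the sense of tempered distributions.
Such an `f` is unique up to null sets in `τ`. -/
def IsSTFourier (u : STDist) (f : ℤ → ℝ → ℂ) : Prop :=
  ∀ (k : ℤ) (φ : 𝓢(ℝ, ℂ)),
    Integrable (fun τ : ℝ => f k τ * ∫ t : ℝ, Complex.exp (Complex.I * τ * t) * φ t) ∧
    u k φ = (1 / (2 * Real.pi) : ℂ) *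
      ∫ τ : ℝ, f k τ * ∫ t : ℝ, Complex.exp (Complex.I * τ * t) * φ t

/-- The space-time Fourier transform of `u` is a function. -/
def HasSTFourier (u : STDist) : Prop := ∃ f, IsSTFourier u f

open Classical in
/-- The space-time Fourier transform `ũ(k, τ)`, when it is a function. -/
def stFourier (u : STDist) : ℤ → ℝ → ℂ :=
  if h : HasSTFourier u then h.choose else 0

/-- The bracket `⟨x⟩ = (1 + |x|²)^{1/2}`. -/
def bracket (x : ℝ) : ℝ := Real.sqrt (1 + |x| ^ 2)

/-- The norm `‖w(k, τ) f(k, τ)‖` in `ℓ²_k L²_τ`. -/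
def l2L2 (w : ℤ → ℝ → ℝ) (f : ℤ → ℝ → ℂ) : ℝ≥0∞ :=
  (∑' k : ℤ, ∫⁻ τ : ℝ, (ENNReal.ofReal (w k τ) * ‖f k τ‖ₑ) ^ 2) ^ (1 / 2 : ℝ)

/-- The norm `‖w(k, τ) f(k, τ)‖` in `ℓ²_k L¹_τ`. -/
def l2L1 (w : ℤ → ℝ → ℝ) (f : ℤ → ℝ → ℂ) : ℝ≥0∞ :=
  (∑' k : ℤ, (∫⁻ τ : ℝ, ENNReal.ofReal (w k τ) * ‖f k τ‖ₑ) ^ 2) ^ (1 / 2 : ℝ)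

/-- The Schrödinger modulation `τ - α k²`. -/
def modS (α : ℝ) (k : ℤ) (τ : ℝ) : ℝ := τ - α * (k : ℝ) ^ 2

/-- The wave modulation `|τ| - β |k|`. -/
def modW (β : ℝ) (k : ℤ) (τ : ℝ) : ℝ := |τ| - β * |(k : ℝ)|

open Classical in
/-- The Bourgain norm with modulation function `m`:
`‖⟨k⟩^s ⟨m(k, τ)⟩^b ũ(k, τ)‖` in `ℓ²_k L²_τ` (`∞` if `ũ` is not a function). -/
def normX (m : ℤ → ℝ → ℝ) (s b : ℝ) (u : STDist) : ℝ≥0∞ :=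
  if HasSTFourier u then
    l2L2 (fun k τ => bracket k ^ s * bracket (m k τ) ^ b) (stFourier u)
  else ⊤

open Classical in
/-- `‖u‖_{X^{s,1/2}} + ‖⟨k⟩^s ũ‖_{ℓ²_k L¹_τ}`. -/
def normY (m : ℤ → ℝ → ℝ) (s : ℝ) (u : STDist) : ℝ≥0∞ :=
  normX m s (1 / 2) u +
    if HasSTFourier u then l2L1 (fun k _ => bracket k ^ s) (stFourier u) else ⊤

open Classical in
/-- `‖u‖_{X^{s,-1/2}} + ‖⟨k⟩^s ⟨m(k, τ)⟩^{-1} ũ‖_{ℓ²_k L¹_τ}`. -/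
def normZ (m : ℤ → ℝ → ℝ) (s : ℝ) (u : STDist) : ℝ≥0∞ :=
  normX m s (-1 / 2) u +
    if HasSTFourier u then l2L1 (fun k τ => bracket k ^ s / bracket (m k τ)) (stFourier u) else ⊤

/-- The norm of `Y^s_S`. -/
def normYS (α s : ℝ) (u : STDist) : ℝ≥0∞ := normY (modS α) s u

/-- The norm of `Z^s_S`. -/
def normZS (α s : ℝ) (u : STDist) : ℝ≥0∞ := normZ (modS α) s u

/-- The norm of `Y^s_W`. -/
def normYW (β s : ℝ) (u : STDist) : ℝ≥0∞ := normY (modW β) s u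

/-- The norm of `Z^s_W`. -/
def normZW (β s : ℝ) (u : STDist) : ℝ≥0∞ := normZ (modW β) s u

/-- The `k`-th spatial Fourier coefficient at time `t` of a function `g(t, x)`, `2π`-periodic
in `x`: `∫_𝕋 e^{-ikx} g(t, x) dx`. -/
def spaceCoeff (g : ℝ → ℝ → ℂ) (k : ℤ) (t : ℝ) : ℂ :=
  ∫ x in (0 : ℝ)..(2 * Real.pi), Complex.exp (-(Complex.I * k * x)) * g t x

/-- `F` coincides with the function `g` on `[0, T] × 𝕋`, as a distribution on its interior. -/
def AgreesOn (T : ℝ) (F : STDist) (g : ℝ → ℝ → ℂ) : Prop :=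
  ∀ (k : ℤ) (φ : 𝓢(ℝ, ℂ)), tsupport φ ⊆ Set.Ioo 0 T →
    F k φ = ∫ t : ℝ, spaceCoeff g k t * φ t

/-- The restriction norm of `Z^s_S([0, T] × 𝕋)`: the infimum of the norms of the extensions. -/
def normZSOn (α s T : ℝ) (g : ℝ → ℝ → ℂ) : ℝ≥0∞ :=
  ⨅ (F : STDist) (_ : AgreesOn T F g), normZS α s F

/-- The restriction norm of `Z^s_W([0, T] × 𝕋)`: the infimum of the norms of the extensions. -/
def normZWOn (β s T : ℝ) (g : ℝ → ℝ → ℂ) : ℝ≥0∞ :=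
  ⨅ (F : STDist) (_ : AgreesOn T F g), normZW β s F

/-- The frequencies `k ∈ ℤ` with `N ≤ |k| < 2N`. -/
def shell (N : ℕ) : Finset ℤ :=
  (Finset.Ioo (-(2 * N : ℤ)) (2 * N)).filter fun k => (N : ℤ) ≤ |k|

/-- The Littlewood-Paley projection of a function of `(t, x)`, `2π`-periodic in `x`. -/
def projFun (N : ℕ) (g : ℝ → ℝ → ℂ) (t x : ℝ) : ℂ :=
  (1 / (2 * Real.pi) : ℂ) * ∑ k ∈ shell N, Complex.exp (Complex.I * k * x) * spaceCoeff g k t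

/-- The Littlewood-Paley projection `P_N u` of a distribution `u` for which every `ũ(k, ·)` is
integrable (this holds if a `Y` norm is finite), as a function of `(t, x)`: here
`û_k(t) = (1 / 2π) ∫ e^{iτt} ũ(k, τ) dτ`. -/
def proj (N : ℕ) (u : STDist) (t x : ℝ) : ℂ :=
  (1 / (2 * Real.pi) : ℂ) * ∑ k ∈ shell N, Complex.exp (Complex.I * k * x) *
    ((1 / (2 * Real.pi) : ℂ) * ∫ τ : ℝ, Complex.exp (Complex.I * τ * t) * stFourier u k τ)

/-- The spatial derivative of a function of `(t, x)`. -/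
def dx (g : ℝ → ℝ → ℂ) (t x : ℝ) : ℂ := deriv (fun y : ℝ => g t y) x

end

end Zakharov

namespace Zakharov

/-! ### The bracket -/

/-! Let `y` and `y + z` be the two Schrödinger variables and `z` the wave variable, with spatial
frequencies `l`, `l + q`, `q`. By duality both estimates concern one trilinear form, the integral of
`⟨q⟩^{1/2} a(y + z) b(y) c(z)`. The half derivative comes from the negative regularity of `v` in the
first estimate and from `|k| ⟨k⟩^{-1/2} ≤ ⟨k⟩^{1/2}` in the second. The mode `q = 0` never
contributes: it is removed by `P_{N₂}` in the first and by `∂_x` in the second.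

The half derivative is recovered from the resonance function. The three modulations combine to `α q
(2 l + q ∓ β/α)`, and since `β/α` is not an integer the last factor is at least a constant times `⟨2
l + q⟩`. Hence the largest modulation `M` satisfies `M ≳ ⟨q⟩ ⟨2 l + q⟩` (`nonresonance`), so that
`⟨q⟩^{1/2} ≲ ⟨2 l + q⟩^{-1/2} M^{1/2}`. In each of the three regimes (`trilinear_output`,
`trilinear_input`, `trilinear_wave`) the function carrying `M` absorbs `M^{1/2}`. Cauchy-Schwarz
then leaves a kernel integral over the other two variables; it is bounded thanks to the surplus `⟨2
l + q⟩^{-1}`, and costs only the power 3/8 of the other two modulations.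

For the `ℓ²L¹` part of the output norm the dual function is `⟨m⟩^{-1} a(k)`. It just fails,
logarithmically, to have a finite norm with modulation weight 1/2, so an output of maximal
modulation needs its own argument. There `M ≳ ⟨q⟩ ⟨2 l + q⟩` is used with the power 9/16 instead of
1/2, which makes both the frequency sum and the `τ` integral converge (`trilinear_output_int`,
`trilinear_wave_int`).

The power of `T` comes from the slack between 3/8 and 1/2. The inputs are multiplied by a cutoff in
time at scale `T`. This is bounded with respect to the `Y` norm uniformly in `T`, and gains
`T^{1/8}` when the modulation weight is lowered from 1/2 to 3/8 (`localization`). Every regime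
contains an input measured with the weaker weight, so the whole estimate gains `T^{1/8}`. The dyadic
localization is used only to exclude the zero wave frequency and to make the products finite sums.
-/

lemma one_le_bracket (x : ℝ) : 1 ≤ bracket x := by
  unfold bracket
  exact Real.one_le_sqrt.mpr (by nlinarith [sq_nonneg |x|])

lemma bracket_pos (x : ℝ) : 0 < bracket x := lt_of_lt_of_le one_pos (one_le_bracket x)

lemma bracket_sq (x : ℝ) : bracket x ^ 2 = 1 + x ^ 2 := by
  unfold bracket
  rw [Real.sq_sqrt (by positivity), sq_abs]

lemma bracket_neg (x : ℝ) : bracket (-x) = bracket x := by simp [bracket]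

lemma abs_le_bracket (x : ℝ) : |x| ≤ bracket x := by
  have := bracket_sq x
  nlinarith [sq_abs x, abs_nonneg x, bracket_pos x]

lemma bracket_le_one_add_abs (x : ℝ) : bracket x ≤ 1 + |x| := by
  have := bracket_sq x
  nlinarith [sq_abs x, abs_nonneg x, bracket_pos x]

lemma bracket_mono {x y : ℝ} (h : |x| ≤ |y|) : bracket x ≤ bracket y := by
  unfold bracket
  gcongr

lemma bracket_le_add_abs (x y : ℝ) : bracket (x + y) ≤ bracket x + |y| := by
  have h1 := bracket_sq x
  have h2 := bracket_sq (x + y)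
  have h3 := abs_le_bracket x
  have h4 : x * y ≤ |x| * |y| := by rw [← abs_mul]; exact le_abs_self _
  have h5 : |x| * |y| ≤ bracket x * |y| := by gcongr
  nlinarith [sq_abs y, abs_nonneg y, bracket_pos x, bracket_pos (x + y)]

lemma continuous_bracket : Continuous bracket := by
  unfold bracket
  fun_prop

/-- The bracket as an extended nonnegative real. -/
noncomputable def br (x : ℝ) : ℝ≥0∞ := ENNReal.ofReal (bracket x)

lemma one_le_br (x : ℝ) : 1 ≤ br x := by
  unfold br
  rw [← ENNReal.ofReal_one]
  exact ENNReal.ofReal_le_ofReal (one_le_bracket x)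

lemma br_ne_top (x : ℝ) : br x ≠ ⊤ := ENNReal.ofReal_ne_top

lemma br_ne_zero (x : ℝ) : br x ≠ 0 := (lt_of_lt_of_le one_pos (one_le_br x)).ne'

lemma br_neg (x : ℝ) : br (-x) = br x := by rw [br, bracket_neg, br]

lemma br_sub_comm (x y : ℝ) : br (x - y) = br (y - x) := by rw [← br_neg, neg_sub]

lemma br_mono {x y : ℝ} (h : |x| ≤ |y|) : br x ≤ br y := ENNReal.ofReal_le_ofReal (bracket_mono h)

@[fun_prop]
lemma measurable_br : Measurable br := (continuous_bracket.measurable).ennreal_ofReal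

lemma br_rpow (x a : ℝ) : br x ^ a = ENNReal.ofReal (bracket x ^ a) :=
  ENNReal.ofReal_rpow_of_pos (bracket_pos x)

lemma br_le_add_abs (x y : ℝ) : br (x + y) ≤ br x + ENNReal.ofReal |y| := by
  unfold br
  rw [← ENNReal.ofReal_add (bracket_pos x).le (abs_nonneg y)]
  exact ENNReal.ofReal_le_ofReal (bracket_le_add_abs x y)

lemma br_add_le (x y : ℝ) : br (x + y) ≤ br x + br y :=
  (br_le_add_abs x y).trans (by gcongr; exact ENNReal.ofReal_le_ofReal (abs_le_bracket y))

lemma rpow_le_rpow_of_nonpos {x y : ℝ≥0∞} (h : x ≤ y) {a : ℝ} (ha : a ≤ 0) : y ^ a ≤ x ^ a := by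
  have := ENNReal.rpow_le_rpow h (neg_nonneg.mpr ha)
  rw [ENNReal.rpow_neg, ENNReal.rpow_neg] at this
  exact ENNReal.inv_le_inv.mp this

lemma rpow_le_one_of_nonpos {x : ℝ≥0∞} (h : 1 ≤ x) {a : ℝ} (ha : a ≤ 0) : x ^ a ≤ 1 := by
  simpa using rpow_le_rpow_of_nonpos h ha

/-- Since the exponents are nonpositive, replacing the larger base by the smaller one only increases
the product. This turns products of brackets with different centres into sums of one-centre
brackets. -/
lemma rpow_mul_rpow_le_add {s t : ℝ≥0∞} (hs : s ≠ 0) (hs' : s ≠ ⊤) (ht : t ≠ 0) (ht' : t ≠ ⊤)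
    {a b : ℝ} (ha : a ≤ 0) (hb : b ≤ 0) : s ^ a * t ^ b ≤ s ^ (a + b) + t ^ (a + b) := by
  rcases le_total s t with h | h
  · calc s ^ a * t ^ b ≤ s ^ a * s ^ b := mul_le_mul_right (rpow_le_rpow_of_nonpos h hb) _
      _ = s ^ (a + b) := (ENNReal.rpow_add _ _ hs hs').symm
      _ ≤ _ := le_self_add
  · calc s ^ a * t ^ b ≤ t ^ a * t ^ b := mul_le_mul_left (rpow_le_rpow_of_nonpos h ha) _
      _ = t ^ (a + b) := (ENNReal.rpow_add _ _ ht ht').symm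
      _ ≤ _ := le_add_self

lemma br_rpow_mul_le (x y : ℝ) {a b : ℝ} (ha : a ≤ 0) (hb : b ≤ 0) :
    br x ^ a * br y ^ b ≤ br x ^ (a + b) + br y ^ (a + b) :=
  rpow_mul_rpow_le_add (br_ne_zero x) (br_ne_top x) (br_ne_zero y) (br_ne_top y) ha hb

lemma mul_le_rpow_of_mul_le {x y D : ℝ≥0∞} (hD : D ≠ 0) (hD' : D ≠ ⊤) (h : D * x ≤ y) {a : ℝ}
    (ha : a ≤ 0) : y ^ a ≤ D ^ a * x ^ a := by
  refine (rpow_le_rpow_of_nonpos h ha).trans_eq ?_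
  rcases eq_or_lt_of_le ha with rfl | ha
  · simp
  · rcases eq_or_ne x 0 with rfl | hx
    · rw [mul_zero, ENNReal.zero_rpow_of_neg ha, ENNReal.mul_top]
      simp [ENNReal.rpow_eq_zero_iff, hD, hD']
    · exact ENNReal.mul_rpow_of_ne_zero hD hx a

/-! ### One-dimensional sums and integrals of brackets -/

lemma lintegral_br_rpow {r : ℝ} (hr : 1 < r) :
    ∃ C : ℝ≥0∞, C ≠ ⊤ ∧ ∀ c : ℝ, ∫⁻ x : ℝ, br (x - c) ^ (-r) ≤ C := by
  refine ⟨∫⁻ x : ℝ, br x ^ (-r), ?_, fun c => (lintegral_sub_right_eq_self _ c).le⟩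
  have h := (integrable_one_add_norm (E := ℝ) (μ := volume) (r := r) (by simpa using hr))
  have h2 := h.const_mul ((1 / 2 : ℝ) ^ (-r))
  refine ne_top_of_le_ne_top h2.2.ne (lintegral_mono fun x => ?_)
  rw [br_rpow, ← ofReal_norm, Real.norm_of_nonneg (by positivity)]
  simp only []
  rw [← Real.mul_rpow (by positivity) (by positivity)]
  refine ENNReal.ofReal_le_ofReal (Real.rpow_le_rpow_of_nonpos (by positivity) ?_ (by linarith))
  have := one_le_bracket x
  have := abs_le_bracket x
  rw [Real.norm_eq_abs]
  linarith

/-- The sum is invariant only under integer shifts, so `c` is replaced by `⌊c⌋`; the error of at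
most 1 changes the bracket by a factor of at most 3. -/
lemma tsum_br_rpow {r : ℝ} (hr : 1 < r) :
    ∃ C : ℝ≥0∞, C ≠ ⊤ ∧ ∀ c : ℝ, ∑' n : ℤ, br (n - c) ^ (-r) ≤ C := by
  have h0 : ∑' n : ℤ, br n ^ (-r) ≠ ⊤ := by
    have h1 : ∑' n : ℤ, ENNReal.ofReal (|(n : ℝ)| ^ (-r)) ≠ ⊤ :=
      (Real.summable_abs_int_rpow hr).tsum_ofReal_ne_top
    have h2 : ∀ n : ℤ, br n ^ (-r) ≤ ENNReal.ofReal (|(n : ℝ)| ^ (-r)) + if n = 0 then 1 else 0 := by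
      intro n
      split_ifs with hn
      · exact (rpow_le_one_of_nonpos (one_le_br _) (by linarith)).trans le_add_self
      · rw [add_zero, br_rpow]
        refine ENNReal.ofReal_le_ofReal
          (Real.rpow_le_rpow_of_nonpos (by positivity) (abs_le_bracket _) (by linarith))
    refine ne_top_of_le_ne_top ?_ (ENNReal.tsum_le_tsum h2)
    rw [ENNReal.tsum_add]
    simp [h1]
  refine ⟨3⁻¹ ^ (-r) * ∑' n : ℤ, br n ^ (-r), ENNReal.mul_ne_top ?_ h0, fun c => ?_⟩
  · simp [ENNReal.rpow_eq_top_iff]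
  · have h3 : ∀ n : ℤ, br (n - c) ^ (-r) ≤ 3⁻¹ ^ (-r) * br ((n - ⌊c⌋ : ℤ) : ℝ) ^ (-r) := by
      intro n
      refine mul_le_rpow_of_mul_le (by simp) (by simp) ?_ (by linarith)
      rw [ENNReal.inv_mul_le_iff (by simp) (by simp)]
      have h4 : br ((n - ⌊c⌋ : ℤ) : ℝ) ≤ br (n - c) + ENNReal.ofReal |c - ⌊c⌋| := by
        convert br_le_add_abs (n - c) (c - ⌊c⌋) using 2
        push_cast
        ring
      have h5 : ENNReal.ofReal |c - ⌊c⌋| ≤ 2 * br (n - c) := by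
        have : |c - ⌊c⌋| ≤ 1 := by
          rw [abs_le]
          constructor <;> linarith [Int.floor_le c, Int.lt_floor_add_one c]
        calc ENNReal.ofReal |c - ⌊c⌋| ≤ ENNReal.ofReal 1 := ENNReal.ofReal_le_ofReal this
          _ = 1 := ENNReal.ofReal_one
          _ ≤ br (n - c) := one_le_br _
          _ ≤ 2 * br (n - c) := le_mul_of_one_le_left (zero_le) (by norm_num)
      calc _ ≤ _ := h4
        _ ≤ br (n - c) + 2 * br (n - c) := by gcongr
        _ = _ := by ring
    calc _ ≤ ∑' n : ℤ, 3⁻¹ ^ (-r) * br ((n - ⌊c⌋ : ℤ) : ℝ) ^ (-r) := ENNReal.tsum_le_tsum h3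
      _ = 3⁻¹ ^ (-r) * ∑' n : ℤ, br ((n - ⌊c⌋ : ℤ) : ℝ) ^ (-r) := ENNReal.tsum_mul_left
      _ = _ := by
        congr 1
        exact (Equiv.subRight ⌊c⌋).tsum_eq (fun n : ℤ => br (n : ℝ) ^ (-r))

lemma bracket_scale {a d x y : ℝ} (hd : 0 < d) (hd1 : d ≤ 1) (ha : d ≤ |a|)
    (h : |a| * |y| ≤ |x|) : d * bracket y ≤ bracket x := by
  have h1 := bracket_sq x
  have h2 := bracket_sq y
  have h3 : d * |y| ≤ |x| := le_trans (by gcongr) h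
  have h4 : (d * |y|) ^ 2 ≤ |x| ^ 2 := by gcongr
  have h5 : d ^ 2 ≤ 1 := by nlinarith
  rw [mul_pow, sq_abs, sq_abs] at h4
  have : (d * bracket y) ^ 2 ≤ bracket x ^ 2 := by rw [mul_pow, h1, h2]; nlinarith
  exact le_of_sq_le_sq this (bracket_pos x).le

/-- A slope bounded below costs a constant, and the centre `-c / a` is harmless because
`tsum_br_rpow` is uniform in it. Uniformity in large slopes is needed later, where the slope is
proportional to the wave frequency. -/
lemma tsum_br_linear_rpow {r : ℝ} (hr : 1 < r) {d : ℝ} (hd : 0 < d) :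
    ∃ C : ℝ≥0∞, C ≠ ⊤ ∧ ∀ a c : ℝ, d ≤ |a| → ∑' n : ℤ, br (a * n + c) ^ (-r) ≤ C := by
  obtain ⟨C, hC, h⟩ := tsum_br_rpow hr
  have hd' : 0 < min d 1 := by positivity
  refine ⟨ENNReal.ofReal (min d 1) ^ (-r) * C, ENNReal.mul_ne_top ?_ hC, fun a c ha => ?_⟩
  · simp [ENNReal.rpow_eq_top_iff, hd]
  have ha0 : a ≠ 0 := by rintro rfl; simp at ha; linarith
  calc ∑' n : ℤ, br (a * n + c) ^ (-r)
      ≤ ∑' n : ℤ, ENNReal.ofReal (min d 1) ^ (-r) * br (n - (-c / a)) ^ (-r) := by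
        refine ENNReal.tsum_le_tsum fun n => mul_le_rpow_of_mul_le (by simpa using hd) (by simp) ?_
          (by linarith)
        unfold br
        rw [← ENNReal.ofReal_mul hd'.le]
        refine ENNReal.ofReal_le_ofReal (bracket_scale hd' (min_le_right _ _)
          ((min_le_left _ _).trans ha) ?_)
        rw [← abs_mul]
        apply le_of_eq
        congr 1
        field_simp
        ring
    _ = ENNReal.ofReal (min d 1) ^ (-r) * ∑' n : ℤ, br (n - (-c / a)) ^ (-r) :=
        ENNReal.tsum_mul_left
    _ ≤ _ := by gcongr; exact h _

/-- Complete the square. With real roots, the distance to the farther root is at least the distance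
to the nearer one; without them the vertex serves as a double root. -/
lemma exists_roots_abs_quadratic (a b c : ℝ) (ha : a ≠ 0) :
    ∃ x₁ x₂ : ℝ, ∀ x : ℝ, |a| * (x - x₁) ^ 2 ≤ |a * x ^ 2 + b * x + c| ∨
      |a| * (x - x₂) ^ 2 ≤ |a * x ^ 2 + b * x + c| := by
  set y := -b / (2 * a)
  set e := (b ^ 2 - 4 * a * c) / (4 * a ^ 2)
  have key : ∀ x, a * x ^ 2 + b * x + c = a * ((x - y) ^ 2 - e) := by
    intro x
    simp only [y, e]
    field_simp
    ring
  rcases le_or_gt e 0 with he | he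
  · refine ⟨y, y, fun x => Or.inl ?_⟩
    rw [key, abs_mul]
    gcongr
    rw [abs_of_nonneg (by nlinarith [sq_nonneg (x - y)])]
    linarith
  · refine ⟨y - √e, y + √e, fun x => ?_⟩
    rw [key, abs_mul]
    have hs : √e ^ 2 = e := Real.sq_sqrt he.le
    have hs0 : 0 < √e := Real.sqrt_pos.mpr he
    rcases le_total (x - y) 0 with hx | hx
    · left
      gcongr
      have : (x - y) ^ 2 - e = (x - (y - √e)) * (x - (y + √e)) := by linear_combination hs
      rw [this, abs_mul, ← sq_abs, sq]
      gcongr 1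
      rw [abs_of_nonpos (a := x - (y + √e)) (by linarith), abs_le]
      constructor <;> linarith
    · right
      gcongr
      have : (x - y) ^ 2 - e = (x - (y - √e)) * (x - (y + √e)) := by linear_combination hs
      rw [this, abs_mul, ← sq_abs, sq]
      gcongr 1
      rw [abs_of_nonneg (a := x - (y - √e)) (by linarith), abs_le]
      constructor <;> linarith

/-- A quadratic grows like the squared distance to its nearer root, so the power `-3/4` becomes a
summable `-3/2` around one of two centres, uniformly in the lower-order coefficients. -/
lemma tsum_br_quadratic_rpow {α : ℝ} (hα : 0 < α) :
    ∃ C : ℝ≥0∞, C ≠ ⊤ ∧ ∀ a b c : ℝ, |a| = α →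
      ∑' n : ℤ, br (a * n ^ 2 + b * n + c) ^ (-(3 / 4) : ℝ) ≤ C := by
  obtain ⟨C, hC, h⟩ := tsum_br_rpow (r := 3 / 2) (by norm_num)
  -- From `⟨v⟩ ≥ (1 + |v|) / 2` and `|v| ≥ α s²` follows `⟨v⟩ ≥ d (1 + s²)`.
  set d := min α 1 / 2
  have hd : 0 < d := by positivity
  refine ⟨ENNReal.ofReal d ^ (-(3 / 4) : ℝ) * (C + C), ENNReal.mul_ne_top ?_ (by simp [hC]),
    fun a b c ha => ?_⟩
  · simp [ENNReal.rpow_eq_top_iff, hd]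
  obtain ⟨x₁, x₂, hx⟩ := exists_roots_abs_quadratic a b c (by rintro rfl; simp at ha; linarith)
  have key : ∀ s v : ℝ, α * s ^ 2 ≤ |v| →
      br v ^ (-(3 / 4) : ℝ) ≤ ENNReal.ofReal d ^ (-(3 / 4) : ℝ) * br s ^ (-(3 / 2) : ℝ) := by
    intro s v hv
    have : br s ^ (-(3 / 2) : ℝ) = (br s ^ 2) ^ (-(3 / 4) : ℝ) := by
      rw [← ENNReal.rpow_natCast, ← ENNReal.rpow_mul]
      norm_num
    rw [this]
    refine mul_le_rpow_of_mul_le (by simpa using hd) (by simp) ?_ (by norm_num)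
    unfold br
    rw [← ENNReal.ofReal_pow (bracket_pos s).le, ← ENNReal.ofReal_mul hd.le, bracket_sq]
    refine ENNReal.ofReal_le_ofReal ?_
    have h1 := one_le_bracket v
    have h2 := abs_le_bracket v
    have h3 : d ≤ 1 / 2 := by simp only [d]; linarith [min_le_right α 1]
    have h4 : d ≤ α / 2 := by simp only [d]; linarith [min_le_left α 1]
    nlinarith [sq_nonneg s]
  calc _ ≤ ∑' n : ℤ, ENNReal.ofReal d ^ (-(3 / 4) : ℝ) *
        (br (n - x₁) ^ (-(3 / 2) : ℝ) + br (n - x₂) ^ (-(3 / 2) : ℝ)) := by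
        refine ENNReal.tsum_le_tsum fun n => ?_
        rw [ha] at hx
        rcases hx n with h' | h'
        · exact (key _ _ h').trans (by gcongr; exact le_self_add)
        · exact (key _ _ h').trans (by gcongr; exact le_add_self)
    _ = ENNReal.ofReal d ^ (-(3 / 4) : ℝ) *
        (∑' n : ℤ, br (n - x₁) ^ (-(3 / 2) : ℝ) + ∑' n : ℤ, br (n - x₂) ^ (-(3 / 2) : ℝ)) := by
        rw [ENNReal.tsum_mul_left, ENNReal.tsum_add]
    _ ≤ _ := by gcongr <;> exact h _

lemma lintegral_br_mul_br_rpow {r s : ℝ} (hr : 0 ≤ r) (hs : 0 ≤ s) (hrs : 1 < r + s) :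
    ∃ C : ℝ≥0∞, C ≠ ⊤ ∧ ∀ a b : ℝ, ∫⁻ x : ℝ, br (x - a) ^ (-r) * br (x - b) ^ (-s) ≤ C := by
  obtain ⟨C, hC, h⟩ := lintegral_br_rpow hrs
  refine ⟨C + C, by simp [hC], fun a b => ?_⟩
  calc _ ≤ ∫⁻ x : ℝ, br (x - a) ^ (-(r + s)) + br (x - b) ^ (-(r + s)) := by
        refine lintegral_mono fun x => ?_
        have := br_rpow_mul_le (x - a) (x - b) (neg_nonpos.mpr hr) (neg_nonpos.mpr hs)
        rwa [← neg_add] at this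
    _ = (∫⁻ x : ℝ, br (x - a) ^ (-(r + s))) + ∫⁻ x : ℝ, br (x - b) ^ (-(r + s)) :=
        lintegral_add_left (by fun_prop) _
    _ ≤ _ := add_le_add (h a) (h b)

/-- By the triangle inequality `⟨a - b⟩^{1/4}` is shared between the two factors; the exponents
left, 1/2 and 3/4, still add up to more than 1. The decay `-1/4` is not optimal but suffices. -/
lemma lintegral_br_conv :
    ∃ C : ℝ≥0∞, C ≠ ⊤ ∧ ∀ a b : ℝ,
      ∫⁻ x : ℝ, br (x - a) ^ (-(3 / 4) : ℝ) * br (x - b) ^ (-(3 / 4) : ℝ) ≤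
        C * br (a - b) ^ (-(1 / 4) : ℝ) := by
  obtain ⟨C, hC, h⟩ := lintegral_br_mul_br_rpow (r := 1 / 2) (s := 3 / 4) (by norm_num)
    (by norm_num) (by norm_num)
  refine ⟨C + C, by simp [hC], fun a b => ?_⟩
  have key : br (a - b) ^ (1 / 4 : ℝ) *
      ∫⁻ x : ℝ, br (x - a) ^ (-(3 / 4) : ℝ) * br (x - b) ^ (-(3 / 4) : ℝ) ≤ C + C := by
    rw [← lintegral_const_mul _ (by fun_prop)]
    calc _ ≤ ∫⁻ x : ℝ, br (x - a) ^ (-(1 / 2) : ℝ) * br (x - b) ^ (-(3 / 4) : ℝ) +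
          br (x - b) ^ (-(1 / 2) : ℝ) * br (x - a) ^ (-(3 / 4) : ℝ) := by
          refine lintegral_mono fun x => ?_
          have h1 : br (a - b) ^ (1 / 4 : ℝ) ≤ br (x - a) ^ (1 / 4 : ℝ) + br (x - b) ^ (1 / 4 : ℝ) := by
            refine le_trans ?_ (ENNReal.rpow_add_le_add_rpow _ _ (by norm_num) (by norm_num))
            refine ENNReal.rpow_le_rpow ?_ (by norm_num)
            rw [br_sub_comm x a]
            convert br_add_le (a - x) (x - b) using 2
            ring
          have e : ∀ y : ℝ, br y ^ (-(1 / 2) : ℝ) = br y ^ (1 / 4 : ℝ) * br y ^ (-(3 / 4) : ℝ) := by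
            intro y
            rw [← ENNReal.rpow_add _ _ (br_ne_zero y) (br_ne_top y)]
            norm_num
          calc _ ≤ (br (x - a) ^ (1 / 4 : ℝ) + br (x - b) ^ (1 / 4 : ℝ)) *
                (br (x - a) ^ (-(3 / 4) : ℝ) * br (x - b) ^ (-(3 / 4) : ℝ)) := by gcongr
            _ = _ := by rw [e, e]; ring
      _ = _ := lintegral_add_left (by fun_prop) _
      _ ≤ _ := add_le_add (h a b) (h b a)
  rw [ENNReal.rpow_neg, ← div_eq_mul_inv, ENNReal.le_div_iff_mul_le, mul_comm]
  · exact key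
  · left; simp [ENNReal.rpow_eq_zero_iff, br_ne_zero]
  · left; simp [ENNReal.rpow_eq_top_iff, br_ne_zero, br_ne_top]

/-! ### Space-time frequencies and their weights -/

/-- Counting measure times Lebesgue measure on `ℤ × ℝ`. -/
noncomputable abbrev stVol : Measure (ℤ × ℝ) := (Measure.count : Measure ℤ).prod volume

lemma lintegral_stVol {f : ℤ × ℝ → ℝ≥0∞} (hf : Measurable f) :
    ∫⁻ x, f x ∂stVol = ∑' k : ℤ, ∫⁻ τ : ℝ, f (k, τ) := by
  rw [lintegral_prod _ hf.aemeasurable, lintegral_count]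

/-- The Schrödinger weight `⟨τ - α k²⟩`. -/
noncomputable def wS (α : ℝ) (x : ℤ × ℝ) : ℝ≥0∞ := br (modS α x.1 x.2)

/-- The wave weight `⟨|τ| - β |k|⟩`. -/
noncomputable def wW (β : ℝ) (x : ℤ × ℝ) : ℝ≥0∞ := br (modW β x.1 x.2)

/-- The weight `⟨k + l⟩` for Schrödinger frequencies `k = y + z`, `l = y`. -/
noncomputable def wP (y z : ℤ × ℝ) : ℝ≥0∞ := br (2 * y.1 + z.1)

@[fun_prop]
lemma measurable_intCast : Measurable (fun k : ℤ => (k : ℝ)) := measurable_from_top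

@[fun_prop]
lemma measurable_wS (α : ℝ) : Measurable (wS α) := by
  unfold wS modS
  fun_prop

@[fun_prop]
lemma measurable_wW (β : ℝ) : Measurable (wW β) := by
  unfold wW modW
  have : Measurable (fun x : ℝ => |x|) := measurable_norm
  fun_prop

@[fun_prop]
lemma measurable_wP {X : Type*} [MeasurableSpace X] {f g : X → ℤ × ℝ} (hf : Measurable f)
    (hg : Measurable g) : Measurable fun x => wP (f x) (g x) := by
  unfold wP
  fun_prop

lemma wS_ne_zero (α : ℝ) (x : ℤ × ℝ) : wS α x ≠ 0 := br_ne_zero _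
lemma wS_ne_top (α : ℝ) (x : ℤ × ℝ) : wS α x ≠ ⊤ := br_ne_top _
lemma one_le_wS (α : ℝ) (x : ℤ × ℝ) : 1 ≤ wS α x := one_le_br _
lemma wW_ne_zero (β : ℝ) (x : ℤ × ℝ) : wW β x ≠ 0 := br_ne_zero _
lemma wW_ne_top (β : ℝ) (x : ℤ × ℝ) : wW β x ≠ ⊤ := br_ne_top _
lemma one_le_wW (β : ℝ) (x : ℤ × ℝ) : 1 ≤ wW β x := one_le_br _

/-! ### Kernel bounds -/

/-- The wave cone is the union of two lines through the origin; up to sign, the wave modulation is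
the modulation with respect to one of them. -/
lemma abs_sub_abs_eq_or (β σ q : ℝ) :
    |(|σ| - β * |q|)| = |σ - β * q| ∨ |(|σ| - β * |q|)| = |σ + β * q| := by
  rcases abs_cases σ with ⟨h1, _⟩ | ⟨h1, _⟩ <;> rcases abs_cases q with ⟨h2, _⟩ | ⟨h2, _⟩ <;>
    rw [h1, h2]
  · left; rfl
  · right; congr 1; ring
  · right; rw [← abs_neg]; congr 1; ring
  · left; rw [← abs_neg]; congr 1; ring

lemma br_wave_rpow_le (β σ q : ℝ) {a : ℝ} :
    br (|σ| - β * |q|) ^ a ≤ br (σ - β * q) ^ a + br (σ - -(β * q)) ^ a := by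
  rcases abs_sub_abs_eq_or β σ q with h | h
  · rw [le_antisymm (br_mono h.le) (br_mono h.ge)]
    exact le_self_add
  · rw [le_antisymm (br_mono h.le) (br_mono h.ge), sub_neg_eq_add]
    exact le_add_self

lemma lintegral_br_wave_conv (β : ℝ) :
    ∃ C : ℝ≥0∞, C ≠ ⊤ ∧ ∀ a q : ℝ,
      ∫⁻ σ : ℝ, br (σ - a) ^ (-(3 / 4) : ℝ) * br (|σ| - β * |q|) ^ (-(3 / 4) : ℝ) ≤
        C * (br (a - β * q) ^ (-(1 / 4) : ℝ) + br (a + β * q) ^ (-(1 / 4) : ℝ)) := by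
  obtain ⟨C, hC, h⟩ := lintegral_br_conv
  refine ⟨C, hC, fun a q => ?_⟩
  calc _ ≤ ∫⁻ σ : ℝ, br (σ - a) ^ (-(3 / 4) : ℝ) * br (σ - β * q) ^ (-(3 / 4) : ℝ) +
        br (σ - a) ^ (-(3 / 4) : ℝ) * br (σ - -(β * q)) ^ (-(3 / 4) : ℝ) := by
        refine lintegral_mono fun σ => ?_
        rw [← mul_add]
        gcongr
        exact br_wave_rpow_le β σ q
    _ = _ := lintegral_add_left (by fun_prop) _
    _ ≤ _ := add_le_add (h _ _) (h _ _)
    _ = _ := by rw [mul_add, sub_neg_eq_add]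

/-- The exponents `-3/2` and `-3/4` are those for which a linear and a quadratic argument,
respectively, give convergent sums. -/
lemma br_inv_mul_le (u v : ℝ) :
    br u ^ (-1 : ℝ) * br v ^ (-(1 / 4) : ℝ) ≤ br u ^ (-(3 / 2) : ℝ) + br v ^ (-(3 / 4) : ℝ) := by
  have h := rpow_mul_rpow_le_add (br_ne_zero u) (br_ne_top u)
    (t := br v ^ (1 / 2 : ℝ)) (by simp [ENNReal.rpow_eq_zero_iff, br_ne_zero])
    (by simp [ENNReal.rpow_eq_top_iff, br_ne_zero, br_ne_top])
    (a := -1) (b := -(1 / 2)) (by norm_num) (by norm_num)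
  rw [← ENNReal.rpow_mul, ← ENNReal.rpow_mul] at h
  norm_num at h ⊢
  exact h

/-- Integrating in `σ` leaves the bracket of a quadratic in `q` with leading coefficient `a`,
shifted by `± β q`, to the power `-1/4`. Alone this is not summable; the factor from `⟨e q + m⟩`
repairs it. The free parameters let one statement serve a fixed output and a fixed input. -/
lemma tsum_wave_kernel_le {α : ℝ} (hα : 0 < α) (β : ℝ) :
    ∃ C : ℝ≥0∞, C ≠ ⊤ ∧ ∀ a b c e m : ℝ, |a| = α → 1 ≤ |e| →
      ∑' q : ℤ, br (e * q + m) ^ (-1 : ℝ) * ∫⁻ σ : ℝ,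
        br (σ - (a * q ^ 2 + b * q + c)) ^ (-(3 / 4) : ℝ) *
          br (|σ| - β * |(q : ℝ)|) ^ (-(3 / 4) : ℝ) ≤ C := by
  obtain ⟨C₁, hC₁, h₁⟩ := lintegral_br_wave_conv β
  obtain ⟨C₂, hC₂, h₂⟩ := tsum_br_linear_rpow (r := 3 / 2) (by norm_num) one_pos
  obtain ⟨C₃, hC₃, h₃⟩ := tsum_br_quadratic_rpow hα
  refine ⟨C₁ * ((C₂ + C₃) + (C₂ + C₃)), by finiteness, fun a b c e m ha he => ?_⟩
  calc _ ≤ ∑' q : ℤ, C₁ * ((br (e * q + m) ^ (-(3 / 2) : ℝ) +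
          br (a * q ^ 2 + (b - β) * q + c) ^ (-(3 / 4) : ℝ)) +
          (br (e * q + m) ^ (-(3 / 2) : ℝ) +
          br (a * q ^ 2 + (b + β) * q + c) ^ (-(3 / 4) : ℝ))) := by
        refine ENNReal.tsum_le_tsum fun q => ?_
        calc _ ≤ br (e * q + m) ^ (-1 : ℝ) * (C₁ *
              (br ((a * q ^ 2 + b * q + c) - β * q) ^ (-(1 / 4) : ℝ) +
              br ((a * q ^ 2 + b * q + c) + β * q) ^ (-(1 / 4) : ℝ))) := by gcongr; exact h₁ _ _
          _ = C₁ * (br (e * q + m) ^ (-1 : ℝ) * br (a * q ^ 2 + (b - β) * q + c) ^ (-(1 / 4) : ℝ) +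
              br (e * q + m) ^ (-1 : ℝ) * br (a * q ^ 2 + (b + β) * q + c) ^ (-(1 / 4) : ℝ)) := by
              rw [show (a * (q : ℝ) ^ 2 + b * q + c) - β * q = a * q ^ 2 + (b - β) * q + c by ring,
                show (a * (q : ℝ) ^ 2 + b * q + c) + β * q = a * q ^ 2 + (b + β) * q + c by ring]
              ring
          _ ≤ _ := by gcongr <;> exact br_inv_mul_le _ _
    _ = C₁ * ((∑' q : ℤ, br (e * q + m) ^ (-(3 / 2) : ℝ) +
          ∑' q : ℤ, br (a * q ^ 2 + (b - β) * q + c) ^ (-(3 / 4) : ℝ)) +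
          (∑' q : ℤ, br (e * q + m) ^ (-(3 / 2) : ℝ) +
          ∑' q : ℤ, br (a * q ^ 2 + (b + β) * q + c) ^ (-(3 / 4) : ℝ))) := by
        rw [ENNReal.tsum_mul_left, ENNReal.tsum_add, ENNReal.tsum_add, ENNReal.tsum_add]
    _ ≤ _ := mul_le_mul_right (add_le_add (add_le_add (h₂ _ _ he) (h₃ _ _ _ ha))
        (add_le_add (h₂ _ _ he) (h₃ _ _ _ ha))) _

/-- Integration over the wave variable `z` for a fixed Schrödinger output `x = y + z`. -/
lemma lintegral_kernel_output_le {α : ℝ} (hα : 0 < α) (β : ℝ) :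
    ∃ C : ℝ≥0∞, C ≠ ⊤ ∧ ∀ x : ℤ × ℝ,
      ∫⁻ z, wP (x - z) z ^ (-1 : ℝ) * (wS α (x - z) ^ (-(3 / 4) : ℝ) * wW β z ^ (-(3 / 4) : ℝ))
        ∂stVol ≤ C := by
  obtain ⟨C, hC, h⟩ := tsum_wave_kernel_le hα β
  refine ⟨C, hC, fun x => ?_⟩
  rw [lintegral_stVol (by fun_prop)]
  -- For the output `x = (k, τ)` the quadratic is `τ - α (k - q)²`, and the weight `wP` is the
  -- bracket of `2 k - q`.
  refine le_of_eq_of_le ?_ (h (-α) (2 * α * x.1) (x.2 - α * x.1 ^ 2) (-1) (2 * x.1)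
    (by rw [abs_neg, abs_of_pos hα]) (by simp))
  refine tsum_congr fun q => ?_
  rw [← lintegral_const_mul _ (by
    have : Measurable (fun x : ℝ => |x|) := measurable_norm
    fun_prop)]
  refine lintegral_congr fun σ => ?_
  simp only [wP, wS, wW, modS, modW, Prod.fst_sub, Prod.snd_sub]
  push_cast
  congr 2
  · congr 1; ring
  · rw [← br_neg]; congr 2; ring

/-- Integration over the wave variable `z` for a fixed Schrödinger input `y`. -/
lemma lintegral_kernel_input_le {α : ℝ} (hα : 0 < α) (β : ℝ) :
    ∃ C : ℝ≥0∞, C ≠ ⊤ ∧ ∀ y : ℤ × ℝ,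
      ∫⁻ z, wP y z ^ (-1 : ℝ) * (wS α (y + z) ^ (-(3 / 4) : ℝ) * wW β z ^ (-(3 / 4) : ℝ))
        ∂stVol ≤ C := by
  obtain ⟨C, hC, h⟩ := tsum_wave_kernel_le hα β
  refine ⟨C, hC, fun y => ?_⟩
  rw [lintegral_stVol (by fun_prop)]
  -- For the input `y = (l, τ)` the quadratic is `α (l + q)² - τ`, and the weight `wP` is the
  -- bracket of `2 l + q`.
  refine le_of_eq_of_le ?_ (h α (2 * α * y.1) (α * y.1 ^ 2 - y.2) 1 (2 * y.1)
    (by rw [abs_of_pos hα]) (by simp))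
  refine tsum_congr fun q => ?_
  rw [← lintegral_const_mul _ (by
    have : Measurable (fun x : ℝ => |x|) := measurable_norm
    fun_prop)]
  refine lintegral_congr fun σ => ?_
  simp only [wP, wS, wW, modS, modW, Prod.fst_add, Prod.snd_add]
  push_cast
  congr 2
  · congr 1; ring
  · congr 2; ring

/-- Both Schrödinger modulations have the same curvature, so the quadratic terms in `n` cancel and
the separation of the two centres is linear in `n`. -/
lemma lintegral_schroedinger_conv (α : ℝ) :
    ∃ C : ℝ≥0∞, C ≠ ⊤ ∧ ∀ (n : ℤ) (z : ℤ × ℝ),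
      ∫⁻ σ : ℝ, wS α ((n, σ) + z) ^ (-(3 / 4) : ℝ) * wS α (n, σ) ^ (-(3 / 4) : ℝ) ≤
        C * br (z.2 - α * z.1 * (2 * n + z.1)) ^ (-(1 / 4) : ℝ) := by
  obtain ⟨C, hC, h⟩ := lintegral_br_conv
  refine ⟨C, hC, fun n z => ?_⟩
  convert h (α * (n + z.1) ^ 2 - z.2) (α * n ^ 2) using 2
  · ext σ
    simp only [wS, modS, Prod.fst_add, Prod.snd_add]
    push_cast
    congr 3
    ring
  · rw [← br_neg]
    congr 2
    ring

/-- Integration over the Schrödinger variable `y` for a fixed wave variable `z`. -/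
lemma lintegral_kernel_wave_le {α : ℝ} (hα : 0 < α) :
    ∃ C : ℝ≥0∞, C ≠ ⊤ ∧ ∀ z : ℤ × ℝ, z.1 ≠ 0 →
      ∫⁻ y, wP y z ^ (-1 : ℝ) * (wS α (y + z) ^ (-(3 / 4) : ℝ) * wS α y ^ (-(3 / 4) : ℝ))
        ∂stVol ≤ C := by
  obtain ⟨C₁, hC₁, h₁⟩ := lintegral_schroedinger_conv α
  -- The two linear forms in `n` have slopes 2 and `-2αq`. The second is bounded away from zero only
  -- because `q ≠ 0`.
  obtain ⟨C₂, hC₂, h₂⟩ := tsum_br_linear_rpow (r := 5 / 4) (by norm_num)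
    (show 0 < min 2 (2 * α) by positivity)
  refine ⟨C₁ * (C₂ + C₂), by finiteness, fun z hz => ?_⟩
  have hz1 : (1 : ℝ) ≤ |(z.1 : ℝ)| := by exact_mod_cast Int.one_le_abs hz
  rw [lintegral_stVol (by fun_prop)]
  calc _ ≤ ∑' n : ℤ, C₁ * (br (2 * n + z.1) ^ (-(5 / 4) : ℝ) +
          br (-(2 * α * z.1) * n + (z.2 - α * z.1 * z.1)) ^ (-(5 / 4) : ℝ)) := by
        refine ENNReal.tsum_le_tsum fun n => ?_
        simp only [wP]
        rw [lintegral_const_mul _ (by fun_prop)]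
        calc _ ≤ br (2 * n + z.1) ^ (-1 : ℝ) *
              (C₁ * br (z.2 - α * z.1 * (2 * n + z.1)) ^ (-(1 / 4) : ℝ)) := by
              gcongr; exact h₁ n z
          _ = C₁ * (br (2 * n + z.1) ^ (-1 : ℝ) *
              br (-(2 * α * z.1) * n + (z.2 - α * z.1 * z.1)) ^ (-(1 / 4) : ℝ)) := by
              rw [mul_left_comm]; congr 4; ring
          _ ≤ _ := by
              gcongr
              have := br_rpow_mul_le (2 * n + z.1) (-(2 * α * z.1) * n + (z.2 - α * z.1 * z.1))
                (a := -1) (b := -(1 / 4)) (by norm_num) (by norm_num)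
              norm_num at this ⊢
              exact this
    _ = C₁ * (∑' n : ℤ, br (2 * n + z.1) ^ (-(5 / 4) : ℝ) +
          ∑' n : ℤ, br (-(2 * α * z.1) * n + (z.2 - α * z.1 * z.1)) ^ (-(5 / 4) : ℝ)) := by
        rw [ENNReal.tsum_mul_left, ENNReal.tsum_add]
    _ ≤ _ := by
        gcongr
        · exact h₂ _ _ (by simp)
        · refine h₂ _ _ ((min_le_right _ _).trans ?_)
          rw [abs_neg, abs_mul, abs_mul, abs_of_pos hα, abs_of_pos (two_pos)]
          nlinarith

/-- The kernel bound for a Schrödinger output of maximal modulation, measured in `L¹_τ`. -/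
lemma lintegral_kernel_output_int_le {α : ℝ} (β : ℝ) :
    ∃ C : ℝ≥0∞, C ≠ ⊤ ∧ ∀ k : ℤ, ∫⁻ τ : ℝ, wS α (k, τ) ^ (-(7 / 8) : ℝ) *
      ∫⁻ z, wP ((k, τ) - z) z ^ (-(9 / 8) : ℝ) *
        (wS α ((k, τ) - z) ^ (-(3 / 4) : ℝ) * wW β z ^ (-(3 / 4) : ℝ)) ∂stVol ≤ C := by
  obtain ⟨C₁, hC₁, h₁⟩ := lintegral_br_wave_conv β
  -- Here `τ` is integrated before summing: `7/8 + 1/4 > 1` bounds the `τ` integral uniformly in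
  -- `q`, and the power 9/8 of `wP` sums on its own.
  obtain ⟨C₂, hC₂, h₂⟩ := tsum_br_linear_rpow (r := 9 / 8) (by norm_num) one_pos
  obtain ⟨C₃, hC₃, h₃⟩ := lintegral_br_mul_br_rpow (r := 7 / 8) (s := 1 / 4) (by norm_num)
    (by norm_num) (by norm_num)
  have hm : Measurable (fun x : ℝ => |x|) := measurable_norm
  refine ⟨C₁ * (C₃ + C₃) * C₂, by finiteness, fun k => ?_⟩
  calc _ ≤ ∫⁻ τ : ℝ, ∑' q : ℤ, br ((-1) * q + 2 * k) ^ (-(9 / 8) : ℝ) * (C₁ *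
          (br (τ - α * k ^ 2) ^ (-(7 / 8) : ℝ) *
            br (τ - (α * (k - q) ^ 2 + β * q)) ^ (-(1 / 4) : ℝ) +
          br (τ - α * k ^ 2) ^ (-(7 / 8) : ℝ) *
            br (τ - (α * (k - q) ^ 2 - β * q)) ^ (-(1 / 4) : ℝ))) := by
        refine lintegral_mono fun τ => ?_
        rw [lintegral_stVol (by fun_prop), ← ENNReal.tsum_mul_left]
        refine ENNReal.tsum_le_tsum fun q => ?_
        calc _ = wS α (k, τ) ^ (-(7 / 8) : ℝ) * (br ((-1) * q + 2 * k) ^ (-(9 / 8) : ℝ) *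
              ∫⁻ σ : ℝ, br (σ - (τ - α * (k - q) ^ 2)) ^ (-(3 / 4) : ℝ) *
                br (|σ| - β * |(q : ℝ)|) ^ (-(3 / 4) : ℝ)) := by
              congr 1
              rw [← lintegral_const_mul _ (by fun_prop)]
              refine lintegral_congr fun σ => ?_
              simp only [wP, wS, wW, modS, modW, Prod.fst_sub, Prod.snd_sub]
              push_cast
              congr 2
              · congr 1; ring
              · rw [← br_neg]; congr 2; ring
          _ ≤ wS α (k, τ) ^ (-(7 / 8) : ℝ) * (br ((-1) * q + 2 * k) ^ (-(9 / 8) : ℝ) *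
              (C₁ * (br (τ - α * (k - q) ^ 2 - β * q) ^ (-(1 / 4) : ℝ) +
                br (τ - α * (k - q) ^ 2 + β * q) ^ (-(1 / 4) : ℝ)))) := by gcongr; exact h₁ _ _
          _ = _ := by
              rw [show τ - α * ((k : ℝ) - q) ^ 2 - β * q = τ - (α * (k - q) ^ 2 + β * q) by ring,
                show τ - α * ((k : ℝ) - q) ^ 2 + β * q = τ - (α * (k - q) ^ 2 - β * q) by ring]
              simp only [wS, modS]
              ring
    _ = ∑' q : ℤ, br ((-1) * q + 2 * k) ^ (-(9 / 8) : ℝ) * (C₁ *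
          ((∫⁻ τ : ℝ, br (τ - α * k ^ 2) ^ (-(7 / 8) : ℝ) *
            br (τ - (α * (k - q) ^ 2 + β * q)) ^ (-(1 / 4) : ℝ)) +
          ∫⁻ τ : ℝ, br (τ - α * k ^ 2) ^ (-(7 / 8) : ℝ) *
            br (τ - (α * (k - q) ^ 2 - β * q)) ^ (-(1 / 4) : ℝ))) := by
        rw [lintegral_tsum (fun q => by fun_prop)]
        refine tsum_congr fun q => ?_
        rw [lintegral_const_mul _ (by fun_prop), lintegral_const_mul _ (by fun_prop),
          lintegral_add_left (by fun_prop)]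
    _ ≤ ∑' q : ℤ, br ((-1) * q + 2 * k) ^ (-(9 / 8) : ℝ) * (C₁ * (C₃ + C₃)) := by
        refine ENNReal.tsum_le_tsum fun q => ?_
        gcongr <;> exact h₃ _ _
    _ = C₁ * (C₃ + C₃) * ∑' q : ℤ, br ((-1) * q + 2 * k) ^ (-(9 / 8) : ℝ) := by
        rw [ENNReal.tsum_mul_right, mul_comm]
    _ ≤ _ := by gcongr; exact h₂ _ _ (by simp)

/-- The kernel bound for a wave output of maximal modulation, measured in `L¹_τ`. -/
lemma lintegral_kernel_wave_int_le {α : ℝ} (β : ℝ) :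
    ∃ C : ℝ≥0∞, C ≠ ⊤ ∧ ∀ k : ℤ, ∫⁻ τ : ℝ, wW β (k, τ) ^ (-(7 / 8) : ℝ) *
      ∫⁻ y, wP y (k, τ) ^ (-(9 / 8) : ℝ) *
        (wS α (y + (k, τ)) ^ (-(3 / 4) : ℝ) * wS α y ^ (-(3 / 4) : ℝ)) ∂stVol ≤ C := by
  obtain ⟨C₁, hC₁, h₁⟩ := lintegral_schroedinger_conv α
  -- Only `wP`, of slope 2 in `n`, is summed, since the other factor is consumed by the `τ`
  -- integral. Hence `k = 0` is allowed, unlike in `lintegral_kernel_wave_le`.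
  obtain ⟨C₂, hC₂, h₂⟩ := tsum_br_linear_rpow (r := 9 / 8) (by norm_num) two_pos
  obtain ⟨C₃, hC₃, h₃⟩ := lintegral_br_mul_br_rpow (r := 7 / 8) (s := 1 / 4) (by norm_num)
    (by norm_num) (by norm_num)
  refine ⟨C₁ * (C₃ + C₃) * C₂, by finiteness, fun k => ?_⟩
  calc _ ≤ ∫⁻ τ : ℝ, ∑' n : ℤ, br (2 * n + k) ^ (-(9 / 8) : ℝ) * (C₁ *
          (br (τ - β * k) ^ (-(7 / 8) : ℝ) *
            br (τ - (α * k * (2 * n + k))) ^ (-(1 / 4) : ℝ) +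
          br (τ - -(β * k)) ^ (-(7 / 8) : ℝ) *
            br (τ - (α * k * (2 * n + k))) ^ (-(1 / 4) : ℝ))) := by
        refine lintegral_mono fun τ => ?_
        rw [lintegral_stVol (by fun_prop), ← ENNReal.tsum_mul_left]
        refine ENNReal.tsum_le_tsum fun n => ?_
        simp only [wP]
        rw [lintegral_const_mul _ (by fun_prop)]
        calc _ ≤ (br (τ - β * k) ^ (-(7 / 8) : ℝ) + br (τ - -(β * k)) ^ (-(7 / 8) : ℝ)) *
              (br (2 * n + k) ^ (-(9 / 8) : ℝ) *
              (C₁ * br (τ - α * k * (2 * n + k)) ^ (-(1 / 4) : ℝ))) := by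
              gcongr
              · exact br_wave_rpow_le β τ k
              · exact h₁ n (k, τ)
          _ = _ := by ring
    _ = ∑' n : ℤ, br (2 * n + k) ^ (-(9 / 8) : ℝ) * (C₁ *
          ((∫⁻ τ : ℝ, br (τ - β * k) ^ (-(7 / 8) : ℝ) *
            br (τ - (α * k * (2 * n + k))) ^ (-(1 / 4) : ℝ)) +
          ∫⁻ τ : ℝ, br (τ - -(β * k)) ^ (-(7 / 8) : ℝ) *
            br (τ - (α * k * (2 * n + k))) ^ (-(1 / 4) : ℝ))) := by
        rw [lintegral_tsum (fun q => by fun_prop)]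
        refine tsum_congr fun q => ?_
        rw [lintegral_const_mul _ (by fun_prop), lintegral_const_mul _ (by fun_prop),
          lintegral_add_left (by fun_prop)]
    _ ≤ ∑' n : ℤ, br (2 * n + k) ^ (-(9 / 8) : ℝ) * (C₁ * (C₃ + C₃)) := by
        refine ENNReal.tsum_le_tsum fun q => ?_
        gcongr <;> exact h₃ _ _
    _ = C₁ * (C₃ + C₃) * ∑' n : ℤ, br (2 * n + k) ^ (-(9 / 8) : ℝ) := by
        rw [ENNReal.tsum_mul_right, mul_comm]
    _ ≤ _ := by gcongr; exact h₂ _ _ (by simp)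

/-! ### The resonance identity -/

/-- Near `θ` the bound is the positive distance to the nearest integer; far away `|n - θ|` grows
linearly. The constant interpolates between the two. -/
lemma exists_abs_add_int_ge {θ : ℝ} (hθ : ∀ m : ℤ, θ ≠ m) :
    ∃ c : ℝ, 0 < c ∧ ∀ n : ℤ, c * bracket n ≤ |n - θ| := by
  have h0 : 0 < |θ - round θ| := abs_pos.mpr (sub_ne_zero.mpr (hθ _))
  set d := |θ - round θ|
  refine ⟨d / (1 + d + |θ|), by positivity, fun n => ?_⟩
  have h1 : d ≤ |n - θ| := by rw [abs_sub_comm]; exact round_le θ n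
  have h2 : bracket n ≤ 1 + |(n : ℝ) - θ| + |θ| := by
    have := bracket_le_one_add_abs n
    have := abs_add_le ((n : ℝ) - θ) θ
    rw [sub_add_cancel] at this
    linarith
  rw [div_mul_eq_mul_div, div_le_iff₀ (by positivity)]
  calc d * bracket n ≤ d * (1 + |(n : ℝ) - θ| + |θ|) := by gcongr
    _ ≤ |(n : ℝ) - θ| * (1 + d + |θ|) := by nlinarith [abs_nonneg θ]

/-- The frequency weight `⟨k⟩^{1/2} 1_{k ≠ 0}`, squared. -/
noncomputable def wK (k : ℤ) : ℝ≥0∞ := if k = 0 then 0 else br k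

/-- On each line of the wave cone the time frequencies cancel in `m_S(y) - m_S(y + z) + (z.2 ∓ β
z.1)`, leaving `α q (2 l + q ∓ β/α)`. The last factor is the distance from an integer to a
non-integer, hence comparable from below to `⟨2 l + q⟩`. Both signs are needed, which explains the
two constants. -/
lemma nonresonance {α β : ℝ} (hα : 0 < α) (hαβ : ∀ m : ℤ, β / α ≠ (m : ℝ)) :
    ∃ C : ℝ≥0∞, C ≠ ⊤ ∧ ∀ y z : ℤ × ℝ,
      wK z.1 * wP y z ≤ C * (wS α (y + z) + wS α y + wW β z) := by
  obtain ⟨c₁, hc₁, h₁⟩ := exists_abs_add_int_ge hαβ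
  obtain ⟨c₂, hc₂, h₂⟩ := exists_abs_add_int_ge (θ := -(β / α)) (fun m hm => hαβ (-m) (by
    push_cast; linarith))
  have hc : 0 < α * min c₁ c₂ := by positivity
  refine ⟨ENNReal.ofReal (2 / (α * min c₁ c₂)), ENNReal.ofReal_ne_top, fun y z => ?_⟩
  unfold wK
  split_ifs with hz
  · simp
  have hz1 : (1 : ℝ) ≤ |(z.1 : ℝ)| := by exact_mod_cast Int.one_le_abs hz
  have hz2 : bracket z.1 ≤ 2 * |(z.1 : ℝ)| := by
    linarith [bracket_le_one_add_abs z.1]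
  have key : α * min c₁ c₂ * (|(z.1 : ℝ)| * bracket (2 * y.1 + z.1)) ≤
      bracket (modS α (y + z).1 (y + z).2) + bracket (modS α y.1 y.2) + bracket (modW β z.1 z.2) := by
    have e0 := abs_le_bracket (modS α (y + z).1 (y + z).2)
    have e1 := abs_le_bracket (modS α y.1 y.2)
    have e2 := abs_le_bracket (modW β z.1 z.2)
    simp only [modS, modW, Prod.fst_add, Prod.snd_add] at *
    push_cast at *
    rcases abs_sub_abs_eq_or β z.2 z.1 with h | h
    · have h5 := h₁ (2 * y.1 + z.1)
      push_cast at h5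
      calc _ = α * |(z.1 : ℝ)| * (min c₁ c₂ * bracket (2 * y.1 + z.1)) := by ring
        _ ≤ α * |(z.1 : ℝ)| * |2 * (y.1 : ℝ) + z.1 - β / α| := by
          gcongr
          exact (mul_le_mul_of_nonneg_right (min_le_left _ _) (bracket_pos _).le).trans h5
        _ = |α * z.1 * (2 * y.1 + z.1 - β / α)| := by
          rw [abs_mul, abs_mul, abs_of_pos hα]
        _ = |(y.2 - α * (y.1 : ℝ) ^ 2) - (y.2 + z.2 - α * (y.1 + z.1 : ℝ) ^ 2) +
            (z.2 - β * z.1)| := by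
          congr 1
          field_simp
          ring
        _ ≤ |y.2 - α * (y.1 : ℝ) ^ 2| + |y.2 + z.2 - α * (y.1 + z.1 : ℝ) ^ 2| +
            |z.2 - β * z.1| := (abs_add_le _ _).trans (by gcongr; exact abs_sub _ _)
        _ ≤ _ := by rw [← h]; linarith
    · have h5 := h₂ (2 * y.1 + z.1)
      push_cast at h5
      calc _ = α * |(z.1 : ℝ)| * (min c₁ c₂ * bracket (2 * y.1 + z.1)) := by ring
        _ ≤ α * |(z.1 : ℝ)| * |2 * (y.1 : ℝ) + z.1 - -(β / α)| := by
          gcongr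
          exact (mul_le_mul_of_nonneg_right (min_le_right _ _) (bracket_pos _).le).trans h5
        _ = |α * z.1 * (2 * y.1 + z.1 - -(β / α))| := by
          rw [abs_mul, abs_mul, abs_of_pos hα]
        _ = |(y.2 - α * (y.1 : ℝ) ^ 2) - (y.2 + z.2 - α * (y.1 + z.1 : ℝ) ^ 2) +
            (z.2 + β * z.1)| := by
          congr 1
          field_simp
          ring
        _ ≤ |y.2 - α * (y.1 : ℝ) ^ 2| + |y.2 + z.2 - α * (y.1 + z.1 : ℝ) ^ 2| +
            |z.2 + β * z.1| := (abs_add_le _ _).trans (by gcongr; exact abs_sub _ _)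
        _ ≤ _ := by rw [← h]; linarith
  unfold wP wS wW br
  rw [← ENNReal.ofReal_mul (bracket_pos _).le, ← ENNReal.ofReal_add (bracket_pos _).le
    (bracket_pos _).le, ← ENNReal.ofReal_add (add_pos (bracket_pos _) (bracket_pos _)).le
    (bracket_pos _).le, ← ENNReal.ofReal_mul (by positivity)]
  refine ENNReal.ofReal_le_ofReal ?_
  rw [div_mul_eq_mul_div, le_div_iff₀ hc]
  have := bracket_pos (2 * (y.1 : ℝ) + z.1)
  calc _ ≤ 2 * |(z.1 : ℝ)| * bracket (2 * y.1 + z.1) * (α * min c₁ c₂) := by gcongr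
    _ = 2 * (α * min c₁ c₂ * (|(z.1 : ℝ)| * bracket (2 * y.1 + z.1))) := by ring
    _ ≤ _ := by gcongr

/-! ### Cauchy-Schwarz and duality for extended nonnegative functions -/

lemma lintegral_mul_sq_le {X : Type*} [MeasurableSpace X] (μ : Measure X) {f g : X → ℝ≥0∞}
    (hf : AEMeasurable f μ) (hg : AEMeasurable g μ) :
    (∫⁻ x, f x * g x ∂μ) ^ 2 ≤ (∫⁻ x, f x ^ 2 ∂μ) * ∫⁻ x, g x ^ 2 ∂μ := by
  have h := ENNReal.lintegral_mul_le_Lp_mul_Lq μ Real.HolderConjugate.two_two hf hg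
  simp only [Pi.mul_apply, ENNReal.rpow_two] at h
  calc _ ≤ ((∫⁻ x, f x ^ 2 ∂μ) ^ (1 / 2 : ℝ) * (∫⁻ x, g x ^ 2 ∂μ) ^ (1 / 2 : ℝ)) ^ 2 := by
        gcongr
    _ = _ := by
        rw [mul_pow, ← ENNReal.rpow_natCast, ← ENNReal.rpow_natCast, ← ENNReal.rpow_mul,
          ← ENNReal.rpow_mul]
        norm_num

/-- Testing with `a = h` would give the claim if the norm of `h` were known to be finite. So the
test functions are truncations of `h` in height and to sets of finite measure, for which division is
allowed; monotone convergence finishes. -/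
lemma lintegral_sq_le_of_dual {X : Type*} [MeasurableSpace X] (μ : Measure X) [SigmaFinite μ]
    {h : X → ℝ≥0∞} (hh : Measurable h) {D : ℝ≥0∞}
    (H : ∀ a : X → ℝ≥0∞, Measurable a → (∫⁻ x, a x * h x ∂μ) ^ 2 ≤ D * ∫⁻ x, a x ^ 2 ∂μ) :
    ∫⁻ x, h x ^ 2 ∂μ ≤ D := by
  set t : ℕ → X → ℝ≥0∞ := fun n => (spanningSets μ n).indicator fun x => min (h x) n
  have ht : ∀ n, Measurable (t n) := fun n =>
    (hh.min measurable_const).indicator (measurableSet_spanningSets μ n)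
  have hle : ∀ n x, t n x ≤ h x := fun n x =>
    (Set.indicator_le_self _ _ _).trans (min_le_left _ _)
  have hbound : ∀ n, ∫⁻ x, t n x ^ 2 ∂μ ≤ D := by
    intro n
    have h1 : (∫⁻ x, t n x ^ 2 ∂μ) ^ 2 ≤ D * ∫⁻ x, t n x ^ 2 ∂μ := by
      refine le_trans ?_ (H _ (ht n))
      gcongr with x
      rw [sq]
      gcongr
      exact hle n x
    have h2 : ∫⁻ x, t n x ^ 2 ∂μ ≠ ⊤ := by
      have : ∫⁻ x, t n x ^ 2 ∂μ ≤ ∫⁻ x, (spanningSets μ n).indicator (fun _ => (n : ℝ≥0∞) ^ 2) x ∂μ := by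
        refine lintegral_mono fun x => ?_
        by_cases hx : x ∈ spanningSets μ n
        · simp only [t, Set.indicator_of_mem hx]
          gcongr
          exact min_le_right _ _
        · simp [t, Set.indicator_of_notMem hx]
      refine ne_top_of_le_ne_top ?_ this
      rw [lintegral_indicator (measurableSet_spanningSets μ n), lintegral_const,
        Measure.restrict_apply_univ]
      exact ENNReal.mul_ne_top (by finiteness) (measure_spanningSets_lt_top μ n).ne
    rcases eq_or_ne (∫⁻ x, t n x ^ 2 ∂μ) 0 with h0 | h0
    · rw [h0]; exact zero_le
    · rw [sq] at h1
      exact (ENNReal.mul_le_mul_iff_left h0 h2).mp h1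
  have hmono : Monotone fun n x => t n x ^ 2 := by
    intro n m hnm x
    simp only [t]
    gcongr ?_ ^ 2
    by_cases hx : x ∈ spanningSets μ n
    · rw [Set.indicator_of_mem hx, Set.indicator_of_mem (monotone_spanningSets μ hnm hx)]
      gcongr
    · rw [Set.indicator_of_notMem hx]
      exact zero_le
  have hsup : ∀ x, h x ^ 2 = ⨆ n, t n x ^ 2 := by
    intro x
    refine le_antisymm ?_ (iSup_le fun n => by gcongr; exact hle n x)
    have hs : h x ≤ ⨆ n, t n x := by
      have hx : x ∈ ⋃ n, spanningSets μ n := by rw [iUnion_spanningSets]; trivial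
      obtain ⟨n₀, hn₀⟩ := Set.mem_iUnion.mp hx
      refine le_of_forall_lt fun c hc => ?_
      obtain ⟨m, hm⟩ := ENNReal.exists_nat_gt (ne_top_of_lt hc)
      refine lt_of_lt_of_le ?_ (le_iSup _ (max n₀ m))
      simp only [t]
      rw [Set.indicator_of_mem (monotone_spanningSets μ (le_max_left _ _) hn₀)]
      refine lt_min hc (hm.trans_le ?_)
      exact_mod_cast le_max_right _ _
    calc h x ^ 2 ≤ (⨆ n, t n x) ^ 2 := by gcongr
      _ = ⨆ n, t n x ^ 2 := ENNReal.iSup_pow _ _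
  rw [lintegral_congr hsup, lintegral_iSup (fun n => (ht n).pow_const 2) hmono]
  exact iSup_le hbound

/-! ### Changes of variables on `(ℤ × ℝ)²` -/

@[fun_prop]
lemma measurable_add_stVol {X : Type*} [MeasurableSpace X] {f g : X → ℤ × ℝ} (hf : Measurable f)
    (hg : Measurable g) : Measurable fun x => f x + g x := hf.add hg

lemma lintegral_prod_add_mul_fst {F H : ℤ × ℝ → ℝ≥0∞} (hF : Measurable F) (hH : Measurable H) :
    ∫⁻ p, F (p.1 + p.2) * H p.1 ∂(stVol.prod stVol) = (∫⁻ x, F x ∂stVol) * ∫⁻ y, H y ∂stVol := by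
  rw [lintegral_prod _ (by fun_prop)]
  calc _ = ∫⁻ y, (∫⁻ x, F x ∂stVol) * H y ∂stVol := by
        refine lintegral_congr fun y => ?_
        dsimp only
        rw [lintegral_mul_const _ (by fun_prop), lintegral_add_left_eq_self F y]
    _ = _ := lintegral_const_mul _ hH

lemma lintegral_prod_add_mul_snd {F H : ℤ × ℝ → ℝ≥0∞} (hF : Measurable F) (hH : Measurable H) :
    ∫⁻ p, F (p.1 + p.2) * H p.2 ∂(stVol.prod stVol) = (∫⁻ x, F x ∂stVol) * ∫⁻ y, H y ∂stVol := by
  rw [lintegral_prod_symm _ (by fun_prop)]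
  calc _ = ∫⁻ y, (∫⁻ x, F x ∂stVol) * H y ∂stVol := by
        refine lintegral_congr fun z => ?_
        dsimp only
        rw [lintegral_mul_const _ (by fun_prop), lintegral_add_right_eq_self F z]
    _ = _ := lintegral_const_mul _ hH

lemma lintegral_prod_add_mul {F : ℤ × ℝ → ℝ≥0∞} {κ : (ℤ × ℝ) × (ℤ × ℝ) → ℝ≥0∞}
    (hF : Measurable F) (hκ : Measurable κ) :
    ∫⁻ p, F (p.1 + p.2) * κ p ∂(stVol.prod stVol) =
      ∫⁻ x, F x * ∫⁻ z, κ (x - z, z) ∂stVol ∂stVol := by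
  have hκ' : Measurable fun p : (ℤ × ℝ) × (ℤ × ℝ) => κ (p.2 - p.1, p.1) :=
    hκ.comp ((measurable_snd.sub measurable_fst).prodMk measurable_fst)
  have hκ'' : Measurable fun p : (ℤ × ℝ) × (ℤ × ℝ) => κ (p.1 - p.2, p.2) :=
    hκ.comp ((measurable_fst.sub measurable_snd).prodMk measurable_snd)
  rw [lintegral_prod_symm _ (by fun_prop)]
  calc _ = ∫⁻ z, ∫⁻ x, F x * κ (x - z, z) ∂stVol ∂stVol := by
        refine lintegral_congr fun z => ?_
        rw [← lintegral_add_right_eq_self (fun x => F x * κ (x - z, z)) z]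
        simp only [add_sub_cancel_right]
    _ = ∫⁻ x, ∫⁻ z, F x * κ (x - z, z) ∂stVol ∂stVol :=
        lintegral_lintegral_swap (by
          simp only [Function.uncurry_def]
          fun_prop)
    _ = _ := by
        refine lintegral_congr fun x => ?_
        exact lintegral_const_mul _ (hκ''.comp measurable_prodMk_left)

/-! ### The three regimes of the trilinear form -/

lemma rpow_half_sq (x : ℝ≥0∞) (a : ℝ) : (x ^ a) ^ 2 = x ^ (2 * a) := by
  rw [← ENNReal.rpow_natCast, ← ENNReal.rpow_mul]
  congr 1
  push_cast
  ring

lemma rpow_cancel {x : ℝ≥0∞} (h0 : x ≠ 0) (h1 : x ≠ ⊤) (a : ℝ) : x ^ (-a) * x ^ a = 1 := by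
  rw [← ENNReal.rpow_add _ _ h0 h1, neg_add_cancel, ENNReal.rpow_zero]

section Trilinear

variable {α β : ℝ}

/-- Regime of maximal output modulation: Cauchy-Schwarz puts `a` and the kernel on one side and `b ⊗
c` on the other. For fixed `x = y + z` the kernel integral is `lintegral_kernel_output_le`, so only
`a` pays a full weight. -/
lemma trilinear_output (hα : 0 < α) (β : ℝ) :
    ∃ C : ℝ≥0∞, C ≠ ⊤ ∧ ∀ a b c : ℤ × ℝ → ℝ≥0∞, Measurable a → Measurable b → Measurable c →
      (∫⁻ p, wP p.1 p.2 ^ (-(1 / 2) : ℝ) * wS α (p.1 + p.2) ^ (1 / 2 : ℝ) *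
        (a (p.1 + p.2) * b p.1 * c p.2) ∂(stVol.prod stVol)) ^ 2 ≤
      C * ((∫⁻ x, wS α x * a x ^ 2 ∂stVol) *
        (∫⁻ y, wS α y ^ (3 / 4 : ℝ) * b y ^ 2 ∂stVol) *
        ∫⁻ z, wW β z ^ (3 / 4 : ℝ) * c z ^ 2 ∂stVol) := by
  obtain ⟨C, hC, h⟩ := lintegral_kernel_output_le hα β
  refine ⟨C, hC, fun a b c ha hb hc => ?_⟩
  calc _ = (∫⁻ p, (wP p.1 p.2 ^ (-(1 / 2) : ℝ) * wS α p.1 ^ (-(3 / 8) : ℝ) *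
          wW β p.2 ^ (-(3 / 8) : ℝ) * (wS α (p.1 + p.2) ^ (1 / 2 : ℝ) * a (p.1 + p.2))) *
        ((wS α p.1 ^ (3 / 8 : ℝ) * b p.1) * (wW β p.2 ^ (3 / 8 : ℝ) * c p.2))
          ∂(stVol.prod stVol)) ^ 2 := by
        congr 1
        refine lintegral_congr fun p => ?_
        have h1 := rpow_cancel (wS_ne_zero α p.1) (wS_ne_top α p.1) (3 / 8)
        have h2 := rpow_cancel (wW_ne_zero β p.2) (wW_ne_top β p.2) (3 / 8)
        calc _ = wP p.1 p.2 ^ (-(1 / 2) : ℝ) * wS α (p.1 + p.2) ^ (1 / 2 : ℝ) *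
            (a (p.1 + p.2) * b p.1 * c p.2) * 
            ((wS α p.1 ^ (-(3 / 8) : ℝ) * wS α p.1 ^ (3 / 8 : ℝ)) *
            (wW β p.2 ^ (-(3 / 8) : ℝ) * wW β p.2 ^ (3 / 8 : ℝ))) := by rw [h1, h2, one_mul, mul_one]
          _ = _ := by ring
    _ ≤ _ := lintegral_mul_sq_le _ (by fun_prop) (by fun_prop)
    _ = (∫⁻ p, (wS α (p.1 + p.2) * a (p.1 + p.2) ^ 2) * (wP p.1 p.2 ^ (-1 : ℝ) *
          (wS α p.1 ^ (-(3 / 4) : ℝ) * wW β p.2 ^ (-(3 / 4) : ℝ))) ∂(stVol.prod stVol)) *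
        ∫⁻ p, (wS α p.1 ^ (3 / 4 : ℝ) * b p.1 ^ 2) * (wW β p.2 ^ (3 / 4 : ℝ) * c p.2 ^ 2)
          ∂(stVol.prod stVol) := by
        congr 1 <;> refine lintegral_congr fun p => ?_
        · simp only [mul_pow, rpow_half_sq]
          norm_num
          ring
        · simp only [mul_pow, rpow_half_sq]
          norm_num
    _ = (∫⁻ x, (wS α x * a x ^ 2) * ∫⁻ z, wP (x - z) z ^ (-1 : ℝ) *
          (wS α (x - z) ^ (-(3 / 4) : ℝ) * wW β z ^ (-(3 / 4) : ℝ)) ∂stVol ∂stVol) *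
        ((∫⁻ y, wS α y ^ (3 / 4 : ℝ) * b y ^ 2 ∂stVol) *
          ∫⁻ z, wW β z ^ (3 / 4 : ℝ) * c z ^ 2 ∂stVol) := by
        rw [lintegral_prod_add_mul (F := fun x => wS α x * a x ^ 2) (κ := fun p => wP p.1 p.2 ^ (-1 : ℝ) *
          (wS α p.1 ^ (-(3 / 4) : ℝ) * wW β p.2 ^ (-(3 / 4) : ℝ))) (by fun_prop) (by fun_prop),
          lintegral_prod_mul (f := fun y => wS α y ^ (3 / 4 : ℝ) * b y ^ 2)
            (g := fun z => wW β z ^ (3 / 4 : ℝ) * c z ^ 2) (by fun_prop) (by fun_prop)]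
    _ ≤ (∫⁻ x, (wS α x * a x ^ 2) * C ∂stVol) *
        ((∫⁻ y, wS α y ^ (3 / 4 : ℝ) * b y ^ 2 ∂stVol) *
          ∫⁻ z, wW β z ^ (3 / 4 : ℝ) * c z ^ 2 ∂stVol) := by
        gcongr with x
        exact h x
    _ = _ := by
        rw [lintegral_mul_const _ (by fun_prop)]
        ring

/-- The same argument with `b` on the side of the kernel; the product of the other two factorizes
because `(y, z) ↦ (y + z, z)` preserves the measure. -/
lemma trilinear_input (hα : 0 < α) (β : ℝ) :
    ∃ C : ℝ≥0∞, C ≠ ⊤ ∧ ∀ a b c : ℤ × ℝ → ℝ≥0∞, Measurable a → Measurable b → Measurable c →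
      (∫⁻ p, wP p.1 p.2 ^ (-(1 / 2) : ℝ) * wS α p.1 ^ (1 / 2 : ℝ) *
        (a (p.1 + p.2) * b p.1 * c p.2) ∂(stVol.prod stVol)) ^ 2 ≤
      C * ((∫⁻ x, wS α x ^ (3 / 4 : ℝ) * a x ^ 2 ∂stVol) *
        (∫⁻ y, wS α y * b y ^ 2 ∂stVol) *
        ∫⁻ z, wW β z ^ (3 / 4 : ℝ) * c z ^ 2 ∂stVol) := by
  obtain ⟨C, hC, h⟩ := lintegral_kernel_input_le hα β
  refine ⟨C, hC, fun a b c ha hb hc => ?_⟩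
  calc _ = (∫⁻ p, (wP p.1 p.2 ^ (-(1 / 2) : ℝ) * wS α (p.1 + p.2) ^ (-(3 / 8) : ℝ) *
          wW β p.2 ^ (-(3 / 8) : ℝ) * (wS α p.1 ^ (1 / 2 : ℝ) * b p.1)) *
        ((wS α (p.1 + p.2) ^ (3 / 8 : ℝ) * a (p.1 + p.2)) * (wW β p.2 ^ (3 / 8 : ℝ) * c p.2))
          ∂(stVol.prod stVol)) ^ 2 := by
        congr 1
        refine lintegral_congr fun p => ?_
        have h1 := rpow_cancel (wS_ne_zero α (p.1 + p.2)) (wS_ne_top α (p.1 + p.2)) (3 / 8)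
        have h2 := rpow_cancel (wW_ne_zero β p.2) (wW_ne_top β p.2) (3 / 8)
        calc _ = wP p.1 p.2 ^ (-(1 / 2) : ℝ) * wS α p.1 ^ (1 / 2 : ℝ) *
            (a (p.1 + p.2) * b p.1 * c p.2) * 
            ((wS α (p.1 + p.2) ^ (-(3 / 8) : ℝ) * wS α (p.1 + p.2) ^ (3 / 8 : ℝ)) *
            (wW β p.2 ^ (-(3 / 8) : ℝ) * wW β p.2 ^ (3 / 8 : ℝ))) := by rw [h1, h2, one_mul, mul_one]
          _ = _ := by ring
    _ ≤ _ := lintegral_mul_sq_le _ (by fun_prop) (by fun_prop)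
    _ = (∫⁻ p, (wS α p.1 * b p.1 ^ 2) * (wP p.1 p.2 ^ (-1 : ℝ) *
          (wS α (p.1 + p.2) ^ (-(3 / 4) : ℝ) * wW β p.2 ^ (-(3 / 4) : ℝ))) ∂(stVol.prod stVol)) *
        ∫⁻ p, (wS α (p.1 + p.2) ^ (3 / 4 : ℝ) * a (p.1 + p.2) ^ 2) *
          (wW β p.2 ^ (3 / 4 : ℝ) * c p.2 ^ 2) ∂(stVol.prod stVol) := by
        congr 1 <;> refine lintegral_congr fun p => ?_
        · simp only [mul_pow, rpow_half_sq]
          norm_num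
          ring
        · simp only [mul_pow, rpow_half_sq]
          norm_num
    _ = (∫⁻ y, (wS α y * b y ^ 2) * ∫⁻ z, wP y z ^ (-1 : ℝ) *
          (wS α (y + z) ^ (-(3 / 4) : ℝ) * wW β z ^ (-(3 / 4) : ℝ)) ∂stVol ∂stVol) *
        ((∫⁻ y, wS α y ^ (3 / 4 : ℝ) * a y ^ 2 ∂stVol) *
          ∫⁻ z, wW β z ^ (3 / 4 : ℝ) * c z ^ 2 ∂stVol) := by
        rw [lintegral_prod_add_mul_snd (F := fun x => wS α x ^ (3 / 4 : ℝ) * a x ^ 2)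
          (H := fun z => wW β z ^ (3 / 4 : ℝ) * c z ^ 2) (by fun_prop) (by fun_prop),
          lintegral_prod _ (by fun_prop)]
        congr 1
        refine lintegral_congr fun y => ?_
        dsimp only
        rw [lintegral_const_mul _ (by fun_prop)]
    _ ≤ (∫⁻ x, (wS α x * b x ^ 2) * C ∂stVol) *
        ((∫⁻ y, wS α y ^ (3 / 4 : ℝ) * a y ^ 2 ∂stVol) *
          ∫⁻ z, wW β z ^ (3 / 4 : ℝ) * c z ^ 2 ∂stVol) := by
        gcongr with x
        exact h x
    _ = _ := by
        rw [lintegral_mul_const _ (by fun_prop)]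
        ring

/-- The indicator of the nonzero frequencies. -/
noncomputable def nz (k : ℤ) : ℝ≥0∞ := if k = 0 then 0 else 1

lemma nz_sq (k : ℤ) : nz k ^ 2 = nz k := by
  unfold nz; split_ifs <;> simp

@[fun_prop]
lemma measurable_nz : Measurable nz := measurable_from_top

@[fun_prop]
lemma measurable_wK : Measurable wK := measurable_from_top

/-- Here `c` goes with the kernel. The factor `nz` is kept because the kernel bound is available
only for nonzero wave frequency. -/
lemma trilinear_wave (hα : 0 < α) (β : ℝ) :
    ∃ C : ℝ≥0∞, C ≠ ⊤ ∧ ∀ a b c : ℤ × ℝ → ℝ≥0∞, Measurable a → Measurable b → Measurable c →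
      (∫⁻ p, nz p.2.1 * wP p.1 p.2 ^ (-(1 / 2) : ℝ) * wW β p.2 ^ (1 / 2 : ℝ) *
        (a (p.1 + p.2) * b p.1 * c p.2) ∂(stVol.prod stVol)) ^ 2 ≤
      C * ((∫⁻ x, wS α x ^ (3 / 4 : ℝ) * a x ^ 2 ∂stVol) *
        (∫⁻ y, wS α y ^ (3 / 4 : ℝ) * b y ^ 2 ∂stVol) *
        ∫⁻ z, wW β z * c z ^ 2 ∂stVol) := by
  obtain ⟨C, hC, h⟩ := lintegral_kernel_wave_le hα
  refine ⟨C, hC, fun a b c ha hb hc => ?_⟩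
  calc _ = (∫⁻ p, (nz p.2.1 * wP p.1 p.2 ^ (-(1 / 2) : ℝ) * wS α (p.1 + p.2) ^ (-(3 / 8) : ℝ) *
          wS α p.1 ^ (-(3 / 8) : ℝ) * (wW β p.2 ^ (1 / 2 : ℝ) * c p.2)) *
        ((wS α (p.1 + p.2) ^ (3 / 8 : ℝ) * a (p.1 + p.2)) * (wS α p.1 ^ (3 / 8 : ℝ) * b p.1))
          ∂(stVol.prod stVol)) ^ 2 := by
        congr 1
        refine lintegral_congr fun p => ?_
        have h1 := rpow_cancel (wS_ne_zero α (p.1 + p.2)) (wS_ne_top α (p.1 + p.2)) (3 / 8)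
        have h2 := rpow_cancel (wS_ne_zero α p.1) (wS_ne_top α p.1) (3 / 8)
        calc _ = nz p.2.1 * wP p.1 p.2 ^ (-(1 / 2) : ℝ) * wW β p.2 ^ (1 / 2 : ℝ) *
            (a (p.1 + p.2) * b p.1 * c p.2) * 
            ((wS α (p.1 + p.2) ^ (-(3 / 8) : ℝ) * wS α (p.1 + p.2) ^ (3 / 8 : ℝ)) *
            (wS α p.1 ^ (-(3 / 8) : ℝ) * wS α p.1 ^ (3 / 8 : ℝ))) := by rw [h1, h2, one_mul, mul_one]
          _ = _ := by ring
    _ ≤ _ := lintegral_mul_sq_le _ (by fun_prop) (by fun_prop)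
    _ = (∫⁻ p, (nz p.2.1 * wW β p.2 * c p.2 ^ 2) * (wP p.1 p.2 ^ (-1 : ℝ) *
          (wS α (p.1 + p.2) ^ (-(3 / 4) : ℝ) * wS α p.1 ^ (-(3 / 4) : ℝ))) ∂(stVol.prod stVol)) *
        ∫⁻ p, (wS α (p.1 + p.2) ^ (3 / 4 : ℝ) * a (p.1 + p.2) ^ 2) *
          (wS α p.1 ^ (3 / 4 : ℝ) * b p.1 ^ 2) ∂(stVol.prod stVol) := by
        congr 1 <;> refine lintegral_congr fun p => ?_
        · simp only [mul_pow, rpow_half_sq, nz_sq]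
          norm_num
          ring
        · simp only [mul_pow, rpow_half_sq]
          norm_num
    _ = (∫⁻ z, (nz z.1 * wW β z * c z ^ 2) * ∫⁻ y, wP y z ^ (-1 : ℝ) *
          (wS α (y + z) ^ (-(3 / 4) : ℝ) * wS α y ^ (-(3 / 4) : ℝ)) ∂stVol ∂stVol) *
        ((∫⁻ y, wS α y ^ (3 / 4 : ℝ) * a y ^ 2 ∂stVol) *
          ∫⁻ y, wS α y ^ (3 / 4 : ℝ) * b y ^ 2 ∂stVol) := by
        rw [lintegral_prod_add_mul_fst (F := fun x => wS α x ^ (3 / 4 : ℝ) * a x ^ 2)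
          (H := fun y => wS α y ^ (3 / 4 : ℝ) * b y ^ 2) (by fun_prop) (by fun_prop),
          lintegral_prod_symm _ (by fun_prop)]
        congr 1
        refine lintegral_congr fun z => ?_
        dsimp only
        rw [lintegral_const_mul _ (by fun_prop)]
    _ ≤ (∫⁻ z, (wW β z * c z ^ 2) * C ∂stVol) *
        ((∫⁻ y, wS α y ^ (3 / 4 : ℝ) * a y ^ 2 ∂stVol) *
          ∫⁻ y, wS α y ^ (3 / 4 : ℝ) * b y ^ 2 ∂stVol) := by
        refine mul_le_mul_left (lintegral_mono fun z => ?_) _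
        unfold nz
        split_ifs with hz
        · simp
        · rw [one_mul]
          exact mul_le_mul_right (h z hz) _
    _ = _ := by
        rw [lintegral_mul_const _ (by fun_prop)]
        ring

/-- The dual function `⟨m⟩^{-1} a(k)` times `⟨m⟩^{9/16}` leaves `⟨m⟩^{-7/16}`, whose square is not
integrable in `τ` on its own. The missing decay comes from the kernel, so `τ` must be integrated
together with it and no supremum over `τ` is taken. -/
lemma trilinear_output_int (β : ℝ) :
    ∃ C : ℝ≥0∞, C ≠ ⊤ ∧ ∀ (a : ℤ → ℝ≥0∞) (b c : ℤ × ℝ → ℝ≥0∞), Measurable b → Measurable c →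
      (∫⁻ p, wP p.1 p.2 ^ (-(9 / 16) : ℝ) * wS α (p.1 + p.2) ^ (9 / 16 : ℝ) *
        (wS α (p.1 + p.2) ^ (-1 : ℝ) * a (p.1 + p.2).1 * b p.1 * c p.2) ∂(stVol.prod stVol)) ^ 2 ≤
      C * ((∑' k, a k ^ 2) *
        (∫⁻ y, wS α y ^ (3 / 4 : ℝ) * b y ^ 2 ∂stVol) *
        ∫⁻ z, wW β z ^ (3 / 4 : ℝ) * c z ^ 2 ∂stVol) := by
  obtain ⟨C, hC, h⟩ := lintegral_kernel_output_int_le (α := α) β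
  refine ⟨C, hC, fun a b c hb hc => ?_⟩
  have ha : Measurable a := measurable_from_top
  calc _ = (∫⁻ p, (wP p.1 p.2 ^ (-(9 / 16) : ℝ) * wS α p.1 ^ (-(3 / 8) : ℝ) *
          wW β p.2 ^ (-(3 / 8) : ℝ) * (wS α (p.1 + p.2) ^ (-(7 / 16) : ℝ) * a (p.1 + p.2).1)) *
        ((wS α p.1 ^ (3 / 8 : ℝ) * b p.1) * (wW β p.2 ^ (3 / 8 : ℝ) * c p.2))
          ∂(stVol.prod stVol)) ^ 2 := by
        congr 1
        refine lintegral_congr fun p => ?_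
        have h1 := rpow_cancel (wS_ne_zero α p.1) (wS_ne_top α p.1) (3 / 8)
        have h2 := rpow_cancel (wW_ne_zero β p.2) (wW_ne_top β p.2) (3 / 8)
        have h3 : wS α (p.1 + p.2) ^ (-(7 / 16) : ℝ) =
            wS α (p.1 + p.2) ^ (9 / 16 : ℝ) * wS α (p.1 + p.2) ^ (-1 : ℝ) := by
          rw [← ENNReal.rpow_add _ _ (wS_ne_zero _ _) (wS_ne_top _ _)]
          norm_num
        rw [h3]
        calc _ = wP p.1 p.2 ^ (-(9 / 16) : ℝ) * wS α (p.1 + p.2) ^ (9 / 16 : ℝ) *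
            (wS α (p.1 + p.2) ^ (-1 : ℝ) * a (p.1 + p.2).1 * b p.1 * c p.2) * 
            ((wS α p.1 ^ (-(3 / 8) : ℝ) * wS α p.1 ^ (3 / 8 : ℝ)) *
            (wW β p.2 ^ (-(3 / 8) : ℝ) * wW β p.2 ^ (3 / 8 : ℝ))) := by rw [h1, h2, one_mul, mul_one]
          _ = _ := by ring
    _ ≤ _ := lintegral_mul_sq_le _ (by fun_prop) (by fun_prop)
    _ = (∫⁻ p, (wS α (p.1 + p.2) ^ (-(7 / 8) : ℝ) * a (p.1 + p.2).1 ^ 2) *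
          (wP p.1 p.2 ^ (-(9 / 8) : ℝ) *
          (wS α p.1 ^ (-(3 / 4) : ℝ) * wW β p.2 ^ (-(3 / 4) : ℝ))) ∂(stVol.prod stVol)) *
        ∫⁻ p, (wS α p.1 ^ (3 / 4 : ℝ) * b p.1 ^ 2) * (wW β p.2 ^ (3 / 4 : ℝ) * c p.2 ^ 2)
          ∂(stVol.prod stVol) := by
        congr 1 <;> refine lintegral_congr fun p => ?_
        · simp only [mul_pow, rpow_half_sq]
          norm_num
          ring
        · simp only [mul_pow, rpow_half_sq]
          norm_num
    _ = (∫⁻ x, (wS α x ^ (-(7 / 8) : ℝ) * a x.1 ^ 2) * ∫⁻ z, wP (x - z) z ^ (-(9 / 8) : ℝ) *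
          (wS α (x - z) ^ (-(3 / 4) : ℝ) * wW β z ^ (-(3 / 4) : ℝ)) ∂stVol ∂stVol) *
        ((∫⁻ y, wS α y ^ (3 / 4 : ℝ) * b y ^ 2 ∂stVol) *
          ∫⁻ z, wW β z ^ (3 / 4 : ℝ) * c z ^ 2 ∂stVol) := by
        rw [lintegral_prod_add_mul (F := fun x => wS α x ^ (-(7 / 8) : ℝ) * a x.1 ^ 2)
          (κ := fun p => wP p.1 p.2 ^ (-(9 / 8) : ℝ) *
          (wS α p.1 ^ (-(3 / 4) : ℝ) * wW β p.2 ^ (-(3 / 4) : ℝ))) (by fun_prop) (by fun_prop),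
          lintegral_prod_mul (f := fun y => wS α y ^ (3 / 4 : ℝ) * b y ^ 2)
            (g := fun z => wW β z ^ (3 / 4 : ℝ) * c z ^ 2) (by fun_prop) (by fun_prop)]
    _ ≤ (∑' k, a k ^ 2 * C) *
        ((∫⁻ y, wS α y ^ (3 / 4 : ℝ) * b y ^ 2 ∂stVol) *
          ∫⁻ z, wW β z ^ (3 / 4 : ℝ) * c z ^ 2 ∂stVol) := by
        have hm : Measurable fun x : ℤ × ℝ => ∫⁻ z, wP (x - z) z ^ (-(9 / 8) : ℝ) *
          (wS α (x - z) ^ (-(3 / 4) : ℝ) * wW β z ^ (-(3 / 4) : ℝ)) ∂stVol :=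
          Measurable.lintegral_prod_right' (f := fun p : (ℤ × ℝ) × (ℤ × ℝ) =>
            wP (p.1 - p.2) p.2 ^ (-(9 / 8) : ℝ) *
            (wS α (p.1 - p.2) ^ (-(3 / 4) : ℝ) * wW β p.2 ^ (-(3 / 4) : ℝ))) (by fun_prop)
        rw [lintegral_stVol (by fun_prop)]
        gcongr with k
        calc _ = ∫⁻ τ : ℝ, a k ^ 2 * (wS α (k, τ) ^ (-(7 / 8) : ℝ) *
              ∫⁻ z, wP ((k, τ) - z) z ^ (-(9 / 8) : ℝ) *
              (wS α ((k, τ) - z) ^ (-(3 / 4) : ℝ) * wW β z ^ (-(3 / 4) : ℝ)) ∂stVol) := by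
              refine lintegral_congr fun τ => ?_
              ring
          _ ≤ _ := by
              rw [lintegral_const_mul _ (by fun_prop)]
              gcongr
              exact h k
    _ = _ := by
        rw [ENNReal.tsum_mul_right]
        ring

/-- The counterpart of `trilinear_output_int` when the output is the wave variable. -/
lemma trilinear_wave_int (β : ℝ) :
    ∃ C : ℝ≥0∞, C ≠ ⊤ ∧ ∀ (a b : ℤ × ℝ → ℝ≥0∞) (c : ℤ → ℝ≥0∞), Measurable a → Measurable b →
      (∫⁻ p, wP p.1 p.2 ^ (-(9 / 16) : ℝ) * wW β p.2 ^ (9 / 16 : ℝ) *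
        (a (p.1 + p.2) * b p.1 * (wW β p.2 ^ (-1 : ℝ) * c p.2.1)) ∂(stVol.prod stVol)) ^ 2 ≤
      C * ((∫⁻ x, wS α x ^ (3 / 4 : ℝ) * a x ^ 2 ∂stVol) *
        (∫⁻ y, wS α y ^ (3 / 4 : ℝ) * b y ^ 2 ∂stVol) * ∑' k, c k ^ 2) := by
  obtain ⟨C, hC, h⟩ := lintegral_kernel_wave_int_le (α := α) β
  refine ⟨C, hC, fun a b c ha hb => ?_⟩
  have hc : Measurable c := measurable_from_top
  calc _ = (∫⁻ p, (wP p.1 p.2 ^ (-(9 / 16) : ℝ) * wS α (p.1 + p.2) ^ (-(3 / 8) : ℝ) *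
          wS α p.1 ^ (-(3 / 8) : ℝ) * (wW β p.2 ^ (-(7 / 16) : ℝ) * c p.2.1)) *
        ((wS α (p.1 + p.2) ^ (3 / 8 : ℝ) * a (p.1 + p.2)) * (wS α p.1 ^ (3 / 8 : ℝ) * b p.1))
          ∂(stVol.prod stVol)) ^ 2 := by
        congr 1
        refine lintegral_congr fun p => ?_
        have h1 := rpow_cancel (wS_ne_zero α (p.1 + p.2)) (wS_ne_top α (p.1 + p.2)) (3 / 8)
        have h2 := rpow_cancel (wS_ne_zero α p.1) (wS_ne_top α p.1) (3 / 8)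
        have h3 : wW β p.2 ^ (-(7 / 16) : ℝ) =
            wW β p.2 ^ (9 / 16 : ℝ) * wW β p.2 ^ (-1 : ℝ) := by
          rw [← ENNReal.rpow_add _ _ (wW_ne_zero _ _) (wW_ne_top _ _)]
          norm_num
        rw [h3]
        calc _ = wP p.1 p.2 ^ (-(9 / 16) : ℝ) * wW β p.2 ^ (9 / 16 : ℝ) *
            (a (p.1 + p.2) * b p.1 * (wW β p.2 ^ (-1 : ℝ) * c p.2.1)) * 
            ((wS α (p.1 + p.2) ^ (-(3 / 8) : ℝ) * wS α (p.1 + p.2) ^ (3 / 8 : ℝ)) *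
            (wS α p.1 ^ (-(3 / 8) : ℝ) * wS α p.1 ^ (3 / 8 : ℝ))) := by rw [h1, h2, one_mul, mul_one]
          _ = _ := by ring
    _ ≤ _ := lintegral_mul_sq_le _ (by fun_prop) (by fun_prop)
    _ = (∫⁻ p, (wW β p.2 ^ (-(7 / 8) : ℝ) * c p.2.1 ^ 2) * (wP p.1 p.2 ^ (-(9 / 8) : ℝ) *
          (wS α (p.1 + p.2) ^ (-(3 / 4) : ℝ) * wS α p.1 ^ (-(3 / 4) : ℝ))) ∂(stVol.prod stVol)) *
        ∫⁻ p, (wS α (p.1 + p.2) ^ (3 / 4 : ℝ) * a (p.1 + p.2) ^ 2) *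
          (wS α p.1 ^ (3 / 4 : ℝ) * b p.1 ^ 2) ∂(stVol.prod stVol) := by
        congr 1 <;> refine lintegral_congr fun p => ?_
        · simp only [mul_pow, rpow_half_sq]
          norm_num
          ring
        · simp only [mul_pow, rpow_half_sq]
          norm_num
    _ = (∫⁻ z, (wW β z ^ (-(7 / 8) : ℝ) * c z.1 ^ 2) * ∫⁻ y, wP y z ^ (-(9 / 8) : ℝ) *
          (wS α (y + z) ^ (-(3 / 4) : ℝ) * wS α y ^ (-(3 / 4) : ℝ)) ∂stVol ∂stVol) *
        ((∫⁻ y, wS α y ^ (3 / 4 : ℝ) * a y ^ 2 ∂stVol) *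
          ∫⁻ y, wS α y ^ (3 / 4 : ℝ) * b y ^ 2 ∂stVol) := by
        rw [lintegral_prod_add_mul_fst (F := fun x => wS α x ^ (3 / 4 : ℝ) * a x ^ 2)
          (H := fun y => wS α y ^ (3 / 4 : ℝ) * b y ^ 2) (by fun_prop) (by fun_prop),
          lintegral_prod_symm _ (by fun_prop)]
        congr 1
        refine lintegral_congr fun z => ?_
        dsimp only
        rw [lintegral_const_mul _ (by fun_prop)]
    _ ≤ (∑' k, c k ^ 2 * C) *
        ((∫⁻ y, wS α y ^ (3 / 4 : ℝ) * a y ^ 2 ∂stVol) *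
          ∫⁻ y, wS α y ^ (3 / 4 : ℝ) * b y ^ 2 ∂stVol) := by
        have hm : Measurable fun z : ℤ × ℝ => ∫⁻ y, wP y z ^ (-(9 / 8) : ℝ) *
          (wS α (y + z) ^ (-(3 / 4) : ℝ) * wS α y ^ (-(3 / 4) : ℝ)) ∂stVol :=
          Measurable.lintegral_prod_right' (f := fun p : (ℤ × ℝ) × (ℤ × ℝ) =>
            wP p.2 p.1 ^ (-(9 / 8) : ℝ) *
            (wS α (p.2 + p.1) ^ (-(3 / 4) : ℝ) * wS α p.2 ^ (-(3 / 4) : ℝ))) (by fun_prop)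
        rw [lintegral_stVol (by fun_prop)]
        gcongr with k
        calc _ = ∫⁻ τ : ℝ, c k ^ 2 * (wW β (k, τ) ^ (-(7 / 8) : ℝ) *
              ∫⁻ y, wP y (k, τ) ^ (-(9 / 8) : ℝ) *
              (wS α (y + (k, τ)) ^ (-(3 / 4) : ℝ) * wS α y ^ (-(3 / 4) : ℝ)) ∂stVol) := by
              refine lintegral_congr fun τ => ?_
              ring
          _ ≤ _ := by
              rw [lintegral_const_mul _ (by fun_prop)]
              gcongr
              exact h k
    _ = _ := by
        rw [ENNReal.tsum_mul_right]
        ring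

end Trilinear

/-! ### Splitting by the largest modulation, and the bilinear estimates by duality -/

lemma add_sq_le_four (x y : ℝ≥0∞) : (x + y) ^ 2 ≤ 4 * (x ^ 2 + y ^ 2) := by
  rcases le_total x y with h | h
  · calc (x + y) ^ 2 ≤ (y + y) ^ 2 := by gcongr
      _ = 4 * y ^ 2 := by ring
      _ ≤ _ := by gcongr; exact le_add_self
  · calc (x + y) ^ 2 ≤ (x + x) ^ 2 := by gcongr
      _ = 4 * x ^ 2 := by ring
      _ ≤ _ := by gcongr; exact le_self_add

lemma add_three_sq_le (x y z : ℝ≥0∞) : (x + y + z) ^ 2 ≤ 16 * (x ^ 2 + y ^ 2 + z ^ 2) := by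
  calc (x + y + z) ^ 2 ≤ 4 * ((x + y) ^ 2 + z ^ 2) := add_sq_le_four _ _
    _ ≤ 4 * (4 * (x ^ 2 + y ^ 2) + 4 * z ^ 2) := by
      gcongr
      · exact add_sq_le_four _ _
      · exact le_mul_of_one_le_left zero_le (by norm_num)
    _ = _ := by ring

/-- Because `K ≥ 1`, the square root may be raised to any power `θ ≥ 1/2` before the product bound
is used. This freedom yields the exponent 9/16 where 1/2 is not enough. -/
lemma sqrt_le_of_mul_le {K P A E : ℝ≥0∞} (hK : 1 ≤ K) (hP : P ≠ 0) (hP' : P ≠ ⊤) (hE : 1 ≤ E)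
    (h : K * P ≤ E * A) {θ : ℝ} (hθ : 1 / 2 ≤ θ) (hθ' : θ ≤ 1) :
    K ^ (1 / 2 : ℝ) ≤ E * (P ^ (-θ) * A ^ θ) := by
  have hθ0 : 0 ≤ θ := by linarith
  calc K ^ (1 / 2 : ℝ) ≤ K ^ θ := ENNReal.rpow_le_rpow_of_exponent_le hK hθ
    _ = P ^ (-θ) * (K * P) ^ θ := by
      rw [ENNReal.mul_rpow_of_nonneg _ _ hθ0, mul_left_comm, rpow_cancel hP hP', mul_one]
    _ ≤ P ^ (-θ) * (E * A) ^ θ := by gcongr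
    _ = P ^ (-θ) * (E ^ θ * A ^ θ) := by rw [ENNReal.mul_rpow_of_nonneg _ _ hθ0]
    _ ≤ P ^ (-θ) * (E ^ (1 : ℝ) * A ^ θ) := by
      gcongr
    _ = _ := by rw [ENNReal.rpow_one, mul_left_comm]

lemma sqrt_wK_le {α β : ℝ} (hα : 0 < α) (hαβ : ∀ m : ℤ, β / α ≠ (m : ℝ)) :
    ∃ C : ℝ≥0∞, C ≠ ⊤ ∧ ∀ (y z : ℤ × ℝ) (θ₁ θ₂ θ₃ : ℝ), 1 / 2 ≤ θ₁ → θ₁ ≤ 1 → 1 / 2 ≤ θ₂ →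
      θ₂ ≤ 1 → 1 / 2 ≤ θ₃ → θ₃ ≤ 1 →
      wK z.1 ^ (1 / 2 : ℝ) ≤ C * (wP y z ^ (-θ₁) * wS α (y + z) ^ θ₁ +
        wP y z ^ (-θ₂) * wS α y ^ θ₂ + nz z.1 * wP y z ^ (-θ₃) * wW β z ^ θ₃) := by
  obtain ⟨C, hC, h⟩ := nonresonance hα hαβ
  -- The 3 bounds a sum of three modulations by the largest; the 1 makes the constant at least 1, as
  -- `sqrt_le_of_mul_le` requires.
  refine ⟨3 * C + 1, by finiteness, fun y z θ₁ θ₂ θ₃ h1 h1' h2 h2' h3 h3' => ?_⟩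
  have hyz := h y z
  unfold wK nz at *
  split_ifs at * with hz
  · simp
  set A := wS α (y + z)
  set B := wS α y
  set D := wW β z
  have hP : wP y z ≠ 0 := br_ne_zero _
  have hP' : wP y z ≠ ⊤ := br_ne_top _
  have hE : 1 ≤ 3 * C + 1 := le_add_self
  have hC3 : 3 * C ≤ 3 * C + 1 := le_self_add
  have big : ∀ M, A ≤ M → B ≤ M → D ≤ M → br z.1 * wP y z ≤ (3 * C + 1) * M := by
    intro M hA hB hD
    calc _ ≤ _ := hyz
      _ ≤ C * (M + M + M) := by gcongr
      _ = 3 * C * M := by ring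
      _ ≤ _ := by gcongr
  rcases le_total A B with hAB | hAB
  · rcases le_total B D with hBD | hBD
    · refine (sqrt_le_of_mul_le (one_le_br _) hP hP' hE
        (big D (hAB.trans hBD) hBD le_rfl) h3 h3').trans ?_
      gcongr
      rw [one_mul]
      exact le_add_self
    · refine (sqrt_le_of_mul_le (one_le_br _) hP hP' hE (big B hAB le_rfl hBD) h2 h2').trans ?_
      gcongr
      exact le_add_self.trans le_self_add
  · rcases le_total A D with hAD | hAD
    · refine (sqrt_le_of_mul_le (one_le_br _) hP hP' hE
        (big D hAD (hAB.trans hAD) le_rfl) h3 h3').trans ?_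
      gcongr
      rw [one_mul]
      exact le_add_self
    · refine (sqrt_le_of_mul_le (one_le_br _) hP hP' hE (big A le_rfl hAB hAD) h1 h1').trans ?_
      gcongr
      rw [add_assoc]
      exact le_self_add

lemma trilinear_sq_le {α β : ℝ} (hα : 0 < α) (hαβ : ∀ m : ℤ, β / α ≠ (m : ℝ)) :
    ∃ C : ℝ≥0∞, C ≠ ⊤ ∧ ∀ (a b c : ℤ × ℝ → ℝ≥0∞) (θ₁ θ₂ θ₃ : ℝ),
      Measurable a → Measurable b → Measurable c →
      1 / 2 ≤ θ₁ → θ₁ ≤ 1 → 1 / 2 ≤ θ₂ → θ₂ ≤ 1 → 1 / 2 ≤ θ₃ → θ₃ ≤ 1 →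
      (∫⁻ p, wK p.2.1 ^ (1 / 2 : ℝ) * (a (p.1 + p.2) * b p.1 * c p.2) ∂(stVol.prod stVol)) ^ 2 ≤
      C * ((∫⁻ p, wP p.1 p.2 ^ (-θ₁) * wS α (p.1 + p.2) ^ θ₁ *
            (a (p.1 + p.2) * b p.1 * c p.2) ∂(stVol.prod stVol)) ^ 2 +
          (∫⁻ p, wP p.1 p.2 ^ (-θ₂) * wS α p.1 ^ θ₂ *
            (a (p.1 + p.2) * b p.1 * c p.2) ∂(stVol.prod stVol)) ^ 2 +
          (∫⁻ p, nz p.2.1 * wP p.1 p.2 ^ (-θ₃) * wW β p.2 ^ θ₃ *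
            (a (p.1 + p.2) * b p.1 * c p.2) ∂(stVol.prod stVol)) ^ 2) := by
  obtain ⟨C, hC, h⟩ := sqrt_wK_le hα hαβ
  refine ⟨C ^ 2 * 16, by finiteness, fun a b c θ₁ θ₂ θ₃ ha hb hc h1 h1' h2 h2' h3 h3' => ?_⟩
  calc _ ≤ (∫⁻ p, C * (wP p.1 p.2 ^ (-θ₁) * wS α (p.1 + p.2) ^ θ₁ *
            (a (p.1 + p.2) * b p.1 * c p.2) + wP p.1 p.2 ^ (-θ₂) * wS α p.1 ^ θ₂ *
            (a (p.1 + p.2) * b p.1 * c p.2) + nz p.2.1 * wP p.1 p.2 ^ (-θ₃) * wW β p.2 ^ θ₃ *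
            (a (p.1 + p.2) * b p.1 * c p.2)) ∂(stVol.prod stVol)) ^ 2 := by
        refine pow_le_pow_left' (lintegral_mono fun p => ?_) 2
        rw [← add_mul, ← add_mul, ← mul_assoc C]
        exact mul_le_mul_left (h _ _ _ _ _ h1 h1' h2 h2' h3 h3') _
    _ ≤ _ := by
        rw [lintegral_const_mul _ (by fun_prop), lintegral_add_left (by fun_prop),
          lintegral_add_left (by fun_prop), mul_pow, mul_assoc]
        gcongr
        exact add_three_sq_le _ _ _

lemma lintegral_wS_rpow (α : ℝ) : ∃ C : ℝ≥0∞, C ≠ ⊤ ∧ ∀ k : ℤ,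
    ∫⁻ τ : ℝ, wS α (k, τ) ^ (-(5 / 4) : ℝ) ≤ C := by
  obtain ⟨C, hC, h⟩ := lintegral_br_rpow (r := 5 / 4) (by norm_num)
  exact ⟨C, hC, fun k => h (α * k ^ 2)⟩

lemma lintegral_wW_rpow (β : ℝ) : ∃ C : ℝ≥0∞, C ≠ ⊤ ∧ ∀ k : ℤ,
    ∫⁻ τ : ℝ, wW β (k, τ) ^ (-(5 / 4) : ℝ) ≤ C := by
  obtain ⟨C, hC, h⟩ := lintegral_br_rpow (r := 5 / 4) (by norm_num)
  refine ⟨C + C, by finiteness, fun k => ?_⟩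
  calc _ ≤ ∫⁻ τ : ℝ, br (τ - β * k) ^ (-(5 / 4) : ℝ) + br (τ - -(β * k)) ^ (-(5 / 4) : ℝ) :=
        lintegral_mono fun τ => br_wave_rpow_le β τ k
    _ = _ := lintegral_add_left (by fun_prop) _
    _ ≤ _ := add_le_add (h _) (h _)

/-- The exponent `3/4 - 2 = -5/4` is integrable in `τ`, whereas the full weight would give the
divergent `1 - 2 = -1`. So the `L¹` dual function is admissible whenever it does not carry the
maximal modulation. -/
lemma lintegral_weight_mul_sq {w : ℤ × ℝ → ℝ≥0∞} (hw : Measurable w) (h0 : ∀ x, w x ≠ 0)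
    (ht : ∀ x, w x ≠ ⊤) {C : ℝ≥0∞} (hC : ∀ k : ℤ, ∫⁻ τ : ℝ, w (k, τ) ^ (-(5 / 4) : ℝ) ≤ C)
    (a : ℤ → ℝ≥0∞) :
    ∫⁻ x, w x ^ (3 / 4 : ℝ) * (w x ^ (-1 : ℝ) * a x.1) ^ 2 ∂stVol ≤ C * ∑' k, a k ^ 2 := by
  have ha : Measurable a := measurable_from_top
  rw [lintegral_stVol (by fun_prop), ← ENNReal.tsum_mul_left]
  refine ENNReal.tsum_le_tsum fun k => ?_
  calc _ = ∫⁻ τ : ℝ, w (k, τ) ^ (-(5 / 4) : ℝ) * a k ^ 2 := by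
        refine lintegral_congr fun τ => ?_
        rw [mul_pow, ← mul_assoc, rpow_half_sq, ← ENNReal.rpow_add _ _ (h0 _) (ht _)]
        norm_num
    _ ≤ _ := by
        rw [lintegral_mul_const _ (by fun_prop)]
        gcongr
        exact hC k

lemma lintegral_rpow_mul_weight_sq_le {w : ℤ × ℝ → ℝ≥0∞} (h1 : ∀ x, 1 ≤ w x)
    (ht : ∀ x, w x ≠ ⊤) (a : ℤ × ℝ → ℝ≥0∞) :
    ∫⁻ x, w x ^ (3 / 4 : ℝ) * (w x ^ (-(1 / 2) : ℝ) * a x) ^ 2 ∂stVol ≤ ∫⁻ x, a x ^ 2 ∂stVol := by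
  refine lintegral_mono fun x => ?_
  rw [mul_pow, ← mul_assoc, rpow_half_sq,
    ← ENNReal.rpow_add _ _ (one_pos.trans_le (h1 x)).ne' (ht x)]
  exact (mul_le_mul_left (rpow_le_one_of_nonpos (h1 x) (by norm_num)) _).trans_eq (one_mul _)

lemma mul_weight_sq_eq {w : ℝ≥0∞} (h0 : w ≠ 0) (ht : w ≠ ⊤) (a : ℝ≥0∞) :
    w * (w ^ (-(1 / 2) : ℝ) * a) ^ 2 = a ^ 2 := by
  rw [mul_pow, ← mul_assoc, rpow_half_sq]
  nth_rewrite 1 [← ENNReal.rpow_one w]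
  rw [← ENNReal.rpow_add _ _ h0 ht]
  norm_num

lemma measurable_conv_kernel {b c : ℤ × ℝ → ℝ≥0∞} (hb : Measurable b) (hc : Measurable c) :
    Measurable fun x : ℤ × ℝ => ∫⁻ z, wK z.1 ^ (1 / 2 : ℝ) * (b (x - z) * c z) ∂stVol :=
  Measurable.lintegral_prod_right' (f := fun p : (ℤ × ℝ) × (ℤ × ℝ) =>
    wK p.2.1 ^ (1 / 2 : ℝ) * (b (p.1 - p.2) * c p.2)) (by
      have := hb.comp (measurable_fst.sub (measurable_snd (α := ℤ × ℝ) (β := ℤ × ℝ)))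
      simp only [Function.comp_def, Pi.sub_apply] at this
      fun_prop)

lemma measurable_corr_kernel {a b : ℤ × ℝ → ℝ≥0∞} (ha : Measurable a) (hb : Measurable b) :
    Measurable fun z : ℤ × ℝ => ∫⁻ y, wK z.1 ^ (1 / 2 : ℝ) * (a (y + z) * b y) ∂stVol :=
  Measurable.lintegral_prod_right' (f := fun p : (ℤ × ℝ) × (ℤ × ℝ) =>
    wK p.1.1 ^ (1 / 2 : ℝ) * (a (p.2 + p.1) * b p.2)) (by fun_prop)

/-- The bilinear estimate with a Schrödinger output. -/
theorem bilinear_schroedinger {α β : ℝ} (hα : 0 < α) (hαβ : ∀ m : ℤ, β / α ≠ (m : ℝ)) :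
    ∃ C : ℝ≥0∞, C ≠ ⊤ ∧ ∀ (b c : ℤ × ℝ → ℝ≥0∞) (X Y ε : ℝ≥0∞), Measurable b → Measurable c →
      ε ≤ 1 →
      ∫⁻ y, wS α y * b y ^ 2 ∂stVol ≤ X → ∫⁻ y, wS α y ^ (3 / 4 : ℝ) * b y ^ 2 ∂stVol ≤ ε * X →
      ∫⁻ z, wW β z * c z ^ 2 ∂stVol ≤ Y → ∫⁻ z, wW β z ^ (3 / 4 : ℝ) * c z ^ 2 ∂stVol ≤ ε * Y →
      ∫⁻ x, (wS α x ^ (-(1 / 2) : ℝ) *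
        ∫⁻ z, wK z.1 ^ (1 / 2 : ℝ) * (b (x - z) * c z) ∂stVol) ^ 2 ∂stVol ≤ C * (ε * (X * Y)) ∧
      ∑' k : ℤ, (∫⁻ τ : ℝ, wS α (k, τ) ^ (-1 : ℝ) *
        ∫⁻ z, wK z.1 ^ (1 / 2 : ℝ) * (b ((k, τ) - z) * c z) ∂stVol) ^ 2 ≤ C * (ε * (X * Y)) := by
  obtain ⟨C₀, hC₀, h₀⟩ := trilinear_sq_le hα hαβ
  obtain ⟨C₁, hC₁, h₁⟩ := trilinear_output hα β
  obtain ⟨C₂, hC₂, h₂⟩ := trilinear_input hα β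
  obtain ⟨C₃, hC₃, h₃⟩ := trilinear_wave hα β
  obtain ⟨C₄, hC₄, h₄⟩ := trilinear_output_int (α := α) β
  obtain ⟨C₅, hC₅, h₅⟩ := lintegral_wS_rpow α
  refine ⟨C₀ * (C₁ + C₂ + C₃) + C₀ * (C₄ + C₂ * C₅ + C₃ * C₅), by finiteness,
    fun b c X Y ε hb hc hε hX hεX hY hεY => ?_⟩
  have hh := measurable_conv_kernel hb hc
  have hT : ∀ a : ℤ × ℝ → ℝ≥0∞, Measurable a →
      ∫⁻ x, a x * ∫⁻ z, wK z.1 ^ (1 / 2 : ℝ) * (b (x - z) * c z) ∂stVol ∂stVol =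
      ∫⁻ p, wK p.2.1 ^ (1 / 2 : ℝ) * (a (p.1 + p.2) * b p.1 * c p.2) ∂(stVol.prod stVol) := by
    intro a ha
    rw [← lintegral_prod_add_mul (κ := fun p => wK p.2.1 ^ (1 / 2 : ℝ) * (b p.1 * c p.2)) ha
      (by fun_prop)]
    refine lintegral_congr fun p => ?_
    ring
  have hε2 : ε * ε ≤ ε := mul_le_of_le_one_right zero_le hε
  constructor
  · refine (lintegral_sq_le_of_dual stVol (by fun_prop) (fun a ha => ?_)).trans
      (mul_le_mul_left le_self_add _)
    have ha' : Measurable fun x => wS α x ^ (-(1 / 2) : ℝ) * a x := by fun_prop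
    have hM : ∫⁻ x, wS α x * (wS α x ^ (-(1 / 2) : ℝ) * a x) ^ 2 ∂stVol = ∫⁻ x, a x ^ 2 ∂stVol :=
      lintegral_congr fun x => mul_weight_sq_eq (wS_ne_zero _ _) (wS_ne_top _ _) _
    have hM' := lintegral_rpow_mul_weight_sq_le (one_le_wS α) (wS_ne_top α) a
    set A := ∫⁻ x, a x ^ 2 ∂stVol
    calc _ = (∫⁻ p, wK p.2.1 ^ (1 / 2 : ℝ) * ((fun x => wS α x ^ (-(1 / 2) : ℝ) * a x) (p.1 + p.2) *
          b p.1 * c p.2) ∂(stVol.prod stVol)) ^ 2 := by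
          rw [← hT _ ha']
          congr 1
          refine lintegral_congr fun x => ?_
          ring
      _ ≤ _ := h₀ _ b c (1 / 2) (1 / 2) (1 / 2) ha' hb hc (by norm_num) (by norm_num)
          (by norm_num) (by norm_num) (by norm_num) (by norm_num)
      -- An input spends its full weight only where its own modulation is maximal, so each regime
      -- keeps at least one `ε`; a second one is discarded by `ε ≤ 1`.
      _ ≤ C₀ * (C₁ * (A * (ε * X) * (ε * Y)) + C₂ * (A * X * (ε * Y)) +
          C₃ * (A * (ε * X) * Y)) := by
          gcongr
          · exact (h₁ _ b c ha' hb hc).trans (by gcongr; exact hM.le)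
          · exact (h₂ _ b c ha' hb hc).trans (by gcongr)
          · exact (h₃ _ b c ha' hb hc).trans (by gcongr)
      _ = C₀ * (C₁ * ((ε * ε) * (A * X * Y)) + C₂ * (ε * (A * X * Y)) +
          C₃ * (ε * (A * X * Y))) := by ring
      _ ≤ C₀ * (C₁ * (ε * (A * X * Y)) + C₂ * (ε * (A * X * Y)) +
          C₃ * (ε * (A * X * Y))) := by gcongr
      _ = _ := by ring
  · have hH : Measurable fun k : ℤ => ∫⁻ τ : ℝ, wS α (k, τ) ^ (-1 : ℝ) *
        ∫⁻ z, wK z.1 ^ (1 / 2 : ℝ) * (b ((k, τ) - z) * c z) ∂stVol := measurable_from_top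
    rw [← lintegral_count]
    refine (lintegral_sq_le_of_dual Measure.count hH (fun a ha => ?_)).trans
      (mul_le_mul_left le_add_self _)
    have ha' : Measurable fun x => wS α x ^ (-1 : ℝ) * a x.1 := by fun_prop
    have hM := lintegral_weight_mul_sq (measurable_wS α) (wS_ne_zero α) (wS_ne_top α) h₅ a
    rw [lintegral_count, lintegral_count]
    set A := ∑' k, a k ^ 2
    calc _ = (∫⁻ p, wK p.2.1 ^ (1 / 2 : ℝ) * ((fun x => wS α x ^ (-1 : ℝ) * a x.1) (p.1 + p.2) *
          b p.1 * c p.2) ∂(stVol.prod stVol)) ^ 2 := by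
          rw [← hT _ ha', lintegral_stVol (by fun_prop)]
          congr 1
          refine tsum_congr fun k => ?_
          rw [← lintegral_const_mul _ (by fun_prop)]
          refine lintegral_congr fun τ => ?_
          ring
      -- Only the output regime needs the raised exponent; elsewhere the dual function enters with
      -- weight 3/4 and `lintegral_weight_mul_sq` applies.
      _ ≤ _ := h₀ _ b c (9 / 16) (1 / 2) (1 / 2) ha' hb hc (by norm_num) (by norm_num)
          (by norm_num) (by norm_num) (by norm_num) (by norm_num)
      _ ≤ C₀ * (C₄ * (A * (ε * X) * (ε * Y)) + C₂ * ((C₅ * A) * X * (ε * Y)) +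
          C₃ * ((C₅ * A) * (ε * X) * Y)) := by
          gcongr
          · exact (h₄ a b c hb hc).trans (by gcongr)
          · exact (h₂ _ b c ha' hb hc).trans (by gcongr)
          · exact (h₃ _ b c ha' hb hc).trans (by gcongr)
      _ = C₀ * (C₄ * ((ε * ε) * (A * X * Y)) + C₂ * C₅ * (ε * (A * X * Y)) +
          C₃ * C₅ * (ε * (A * X * Y))) := by ring
      _ ≤ C₀ * (C₄ * (ε * (A * X * Y)) + C₂ * C₅ * (ε * (A * X * Y)) +
          C₃ * C₅ * (ε * (A * X * Y))) := by gcongr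
      _ = _ := by ring

/-- The bilinear estimate with a wave output. -/
theorem bilinear_wave {α β : ℝ} (hα : 0 < α) (hαβ : ∀ m : ℤ, β / α ≠ (m : ℝ)) :
    ∃ C : ℝ≥0∞, C ≠ ⊤ ∧ ∀ (a b : ℤ × ℝ → ℝ≥0∞) (X Y ε : ℝ≥0∞), Measurable a → Measurable b →
      ε ≤ 1 →
      ∫⁻ y, wS α y * a y ^ 2 ∂stVol ≤ X → ∫⁻ y, wS α y ^ (3 / 4 : ℝ) * a y ^ 2 ∂stVol ≤ ε * X →
      ∫⁻ z, wS α z * b z ^ 2 ∂stVol ≤ Y → ∫⁻ z, wS α z ^ (3 / 4 : ℝ) * b z ^ 2 ∂stVol ≤ ε * Y →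
      ∫⁻ z, (wW β z ^ (-(1 / 2) : ℝ) *
        ∫⁻ y, wK z.1 ^ (1 / 2 : ℝ) * (a (y + z) * b y) ∂stVol) ^ 2 ∂stVol ≤ C * (ε * (X * Y)) ∧
      ∑' k : ℤ, (∫⁻ τ : ℝ, wW β (k, τ) ^ (-1 : ℝ) *
        ∫⁻ y, wK k ^ (1 / 2 : ℝ) * (a (y + (k, τ)) * b y) ∂stVol) ^ 2 ≤ C * (ε * (X * Y)) := by
  obtain ⟨C₀, hC₀, h₀⟩ := trilinear_sq_le hα hαβ
  obtain ⟨C₁, hC₁, h₁⟩ := trilinear_output hα β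
  obtain ⟨C₂, hC₂, h₂⟩ := trilinear_input hα β
  obtain ⟨C₃, hC₃, h₃⟩ := trilinear_wave hα β
  obtain ⟨C₄, hC₄, h₄⟩ := trilinear_wave_int (α := α) β
  obtain ⟨C₅, hC₅, h₅⟩ := lintegral_wW_rpow β
  refine ⟨C₀ * (C₁ + C₂ + C₃) + C₀ * (C₁ * C₅ + C₂ * C₅ + C₄), by finiteness,
    fun a b X Y ε ha hb hε hX hεX hY hεY => ?_⟩
  have hh := measurable_corr_kernel ha hb
  have hT : ∀ c : ℤ × ℝ → ℝ≥0∞, Measurable c →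
      ∫⁻ z, c z * ∫⁻ y, wK z.1 ^ (1 / 2 : ℝ) * (a (y + z) * b y) ∂stVol ∂stVol =
      ∫⁻ p, wK p.2.1 ^ (1 / 2 : ℝ) * (a (p.1 + p.2) * b p.1 * c p.2) ∂(stVol.prod stVol) := by
    intro c hc
    refine Eq.trans (lintegral_congr fun z => ?_) (lintegral_prod_symm _ (by fun_prop)).symm
    rw [← lintegral_const_mul _ (by fun_prop)]
    refine lintegral_congr fun y => ?_
    ring
  have hε2 : ε * ε ≤ ε := mul_le_of_le_one_right zero_le hε
  constructor
  · refine (lintegral_sq_le_of_dual stVol (by fun_prop) (fun c hc => ?_)).trans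
      (mul_le_mul_left le_self_add _)
    have hc' : Measurable fun x => wW β x ^ (-(1 / 2) : ℝ) * c x := by fun_prop
    have hM : ∫⁻ x, wW β x * (wW β x ^ (-(1 / 2) : ℝ) * c x) ^ 2 ∂stVol = ∫⁻ x, c x ^ 2 ∂stVol :=
      lintegral_congr fun x => mul_weight_sq_eq (wW_ne_zero _ _) (wW_ne_top _ _) _
    have hM' := lintegral_rpow_mul_weight_sq_le (one_le_wW β) (wW_ne_top β) c
    set A := ∫⁻ x, c x ^ 2 ∂stVol
    calc _ = (∫⁻ p, wK p.2.1 ^ (1 / 2 : ℝ) * (a (p.1 + p.2) * b p.1 *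
          (fun x => wW β x ^ (-(1 / 2) : ℝ) * c x) p.2) ∂(stVol.prod stVol)) ^ 2 := by
          rw [← hT _ hc']
          congr 1
          refine lintegral_congr fun x => ?_
          ring
      _ ≤ _ := h₀ a b _ (1 / 2) (1 / 2) (1 / 2) ha hb hc' (by norm_num) (by norm_num)
          (by norm_num) (by norm_num) (by norm_num) (by norm_num)
      _ ≤ C₀ * (C₁ * (X * (ε * Y) * A) + C₂ * ((ε * X) * Y * A) +
          C₃ * ((ε * X) * (ε * Y) * A)) := by
          gcongr
          · exact (h₁ a b _ ha hb hc').trans (by gcongr)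
          · exact (h₂ a b _ ha hb hc').trans (by gcongr)
          · exact (h₃ a b _ ha hb hc').trans (by gcongr; exact hM.le)
      _ = C₀ * (C₁ * (ε * (A * X * Y)) + C₂ * (ε * (A * X * Y)) +
          C₃ * ((ε * ε) * (A * X * Y))) := by ring
      _ ≤ C₀ * (C₁ * (ε * (A * X * Y)) + C₂ * (ε * (A * X * Y)) +
          C₃ * (ε * (A * X * Y))) := by gcongr
      _ = _ := by ring
  · have hH : Measurable fun k : ℤ => ∫⁻ τ : ℝ, wW β (k, τ) ^ (-1 : ℝ) *
        ∫⁻ y, wK k ^ (1 / 2 : ℝ) * (a (y + (k, τ)) * b y) ∂stVol := measurable_from_top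
    rw [← lintegral_count]
    refine (lintegral_sq_le_of_dual Measure.count hH (fun c hc => ?_)).trans
      (mul_le_mul_left le_add_self _)
    have hc' : Measurable fun x => wW β x ^ (-1 : ℝ) * c x.1 := by fun_prop
    have hM := lintegral_weight_mul_sq (measurable_wW β) (wW_ne_zero β) (wW_ne_top β) h₅ c
    have hnz : ∀ p : (ℤ × ℝ) × (ℤ × ℝ), nz p.2.1 ≤ 1 := by
      intro p; unfold nz; split_ifs <;> simp
    rw [lintegral_count, lintegral_count]
    set A := ∑' k, c k ^ 2
    calc _ = (∫⁻ p, wK p.2.1 ^ (1 / 2 : ℝ) * (a (p.1 + p.2) * b p.1 *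
          (fun x => wW β x ^ (-1 : ℝ) * c x.1) p.2) ∂(stVol.prod stVol)) ^ 2 := by
          rw [← hT _ hc', lintegral_stVol (by fun_prop)]
          congr 1
          refine tsum_congr fun k => ?_
          have hhk : Measurable fun τ : ℝ => ∫⁻ y, wK k ^ (1 / 2 : ℝ) * (a (y + (k, τ)) * b y)
            ∂stVol := hh.comp (measurable_prodMk_left (x := k))
          rw [← lintegral_const_mul _ (by fun_prop)]
          refine lintegral_congr fun τ => ?_
          ring
      -- The output is now the wave variable, so the raised exponent sits in the third slot.
      _ ≤ _ := h₀ a b _ (1 / 2) (1 / 2) (9 / 16) ha hb hc' (by norm_num) (by norm_num)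
          (by norm_num) (by norm_num) (by norm_num) (by norm_num)
      _ ≤ C₀ * (C₁ * (X * (ε * Y) * (C₅ * A)) + C₂ * ((ε * X) * Y * (C₅ * A)) +
          C₄ * ((ε * X) * (ε * Y) * A)) := by
          gcongr
          · exact (h₁ a b _ ha hb hc').trans (by gcongr)
          · exact (h₂ a b _ ha hb hc').trans (by gcongr)
          · refine le_trans ?_ ((h₄ a b c ha hb).trans (by gcongr))
            gcongr with p
            exact mul_le_of_le_one_left zero_le (hnz p)
      _ = C₀ * (C₁ * C₅ * (ε * (A * X * Y)) + C₂ * C₅ * (ε * (A * X * Y)) +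
          C₄ * ((ε * ε) * (A * X * Y))) := by ring
      _ ≤ C₀ * (C₁ * C₅ * (ε * (A * X * Y)) + C₂ * C₅ * (ε * (A * X * Y)) +
          C₄ * (ε * (A * X * Y))) := by gcongr
      _ = _ := by ring

/-! ### Localization in time -/

lemma lintegral_comp_mul_left {F : ℝ → ℝ≥0∞} (hF : Measurable F) {T : ℝ} (hT : 0 < T) :
    ENNReal.ofReal T * ∫⁻ s : ℝ, F (T * s) = ∫⁻ s : ℝ, F s := by
  conv_rhs => rw [← Real.smul_map_volume_mul_left hT.ne']
  rw [lintegral_smul_measure, lintegral_map hF (measurable_const_mul T), abs_of_pos hT, smul_eq_mul]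

/-- Cauchy-Schwarz with respect to the measure `h dσ`, then Tonelli and translation invariance. -/
lemma young_sq_le {g h : ℝ → ℝ≥0∞} (hg : Measurable g) (hh : Measurable h) :
    ∫⁻ τ : ℝ, (∫⁻ σ : ℝ, g (τ - σ) * h σ) ^ 2 ≤ (∫⁻ σ : ℝ, h σ) ^ 2 * ∫⁻ σ : ℝ, g σ ^ 2 := by
  have key : ∀ τ : ℝ, (∫⁻ σ : ℝ, g (τ - σ) * h σ) ^ 2 ≤
      (∫⁻ σ : ℝ, h σ) * ∫⁻ σ : ℝ, g (τ - σ) ^ 2 * h σ := by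
    intro τ
    have e : ∀ x : ℝ≥0∞, x ^ (1 / 2 : ℝ) * x ^ (1 / 2 : ℝ) = x := by
      intro x
      rw [← sq, rpow_half_sq]
      norm_num
    calc _ = (∫⁻ σ : ℝ, h σ ^ (1 / 2 : ℝ) * (g (τ - σ) * h σ ^ (1 / 2 : ℝ))) ^ 2 := by
          congr 1
          refine lintegral_congr fun σ => ?_
          rw [mul_left_comm, e]
      _ ≤ _ := lintegral_mul_sq_le _ (by fun_prop) (by fun_prop)
      _ = _ := by
          simp only [mul_pow, rpow_half_sq]
          norm_num
  calc _ ≤ ∫⁻ τ : ℝ, (∫⁻ σ : ℝ, h σ) * ∫⁻ σ : ℝ, g (τ - σ) ^ 2 * h σ := lintegral_mono key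
    _ = (∫⁻ σ : ℝ, h σ) * ∫⁻ τ : ℝ, ∫⁻ σ : ℝ, g (τ - σ) ^ 2 * h σ :=
        lintegral_const_mul _ (Measurable.lintegral_prod_right'
          (f := fun p : ℝ × ℝ => g (p.1 - p.2) ^ 2 * h p.2) (by fun_prop))
    _ = (∫⁻ σ : ℝ, h σ) * ∫⁻ σ : ℝ, (∫⁻ τ : ℝ, g τ ^ 2) * h σ := by
        congr 1
        rw [lintegral_lintegral_swap (by simp only [Function.uncurry_def]; fun_prop)]
        refine lintegral_congr fun σ => ?_
        rw [lintegral_mul_const _ (by fun_prop), lintegral_sub_right_eq_self (fun τ => g τ ^ 2) σ]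
    _ = _ := by
        rw [lintegral_const_mul _ hh]
        ring

lemma young_sq_le' {g h : ℝ → ℝ≥0∞} (hg : Measurable g) (hh : Measurable h) :
    ∫⁻ τ : ℝ, (∫⁻ σ : ℝ, g (τ - σ) * h σ) ^ 2 ≤ (∫⁻ σ : ℝ, g σ) ^ 2 * ∫⁻ σ : ℝ, h σ ^ 2 := by
  refine le_of_eq_of_le ?_ (young_sq_le hh hg)
  refine lintegral_congr fun τ => ?_
  congr 1
  rw [← lintegral_sub_left_eq_self (fun σ => g (τ - σ) * h σ) τ]
  refine lintegral_congr fun σ => ?_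
  rw [sub_sub_cancel, mul_comm]

/-- The modulus of the Fourier transform of a time cutoff at scale `T`. -/
noncomputable def rescale (T : ℝ) (ρ : ℝ → ℝ≥0∞) (s : ℝ) : ℝ≥0∞ := ENNReal.ofReal T * ρ (T * s)

@[fun_prop]
lemma measurable_rescale {T : ℝ} {ρ : ℝ → ℝ≥0∞} (hρ : Measurable ρ) : Measurable (rescale T ρ) := by
  unfold rescale
  fun_prop

/-- The convolution in `τ` with a rescaled kernel. -/
noncomputable def smear (T : ℝ) (ρ : ℝ → ℝ≥0∞) (f : ℤ → ℝ → ℝ≥0∞) (x : ℤ × ℝ) : ℝ≥0∞ :=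
  ∫⁻ σ : ℝ, rescale T ρ (x.2 - σ) * f x.1 σ

lemma measurable_smear (T : ℝ) {ρ : ℝ → ℝ≥0∞} (hρ : Measurable ρ) {f : ℤ → ℝ → ℝ≥0∞}
    (hf : ∀ k, Measurable (f k)) : Measurable (smear T ρ f) := by
  refine measurable_from_prod_countable_right fun k => ?_
  have := hf k
  exact Measurable.lintegral_prod_right'
    (f := fun p : ℝ × ℝ => rescale T ρ (p.1 - p.2) * f k p.2) (by fun_prop)

lemma lintegral_rescale {T : ℝ} (hT : 0 < T) {ρ : ℝ → ℝ≥0∞} (hρ : Measurable ρ) :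
    ∫⁻ s : ℝ, rescale T ρ s = ∫⁻ s : ℝ, ρ s := by
  unfold rescale
  rw [lintegral_const_mul _ (by fun_prop), lintegral_comp_mul_left hρ hT]

lemma lintegral_rescale_sq {T : ℝ} (hT : 0 < T) {ρ : ℝ → ℝ≥0∞} (hρ : Measurable ρ) :
    ∫⁻ s : ℝ, rescale T ρ s ^ 2 = ENNReal.ofReal T * ∫⁻ s : ℝ, ρ s ^ 2 := by
  unfold rescale
  simp only [mul_pow]
  rw [lintegral_const_mul _ (by fun_prop),
    ← lintegral_comp_mul_left (F := fun s => ρ s ^ 2) (by fun_prop) hT]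
  ring

/-- The homogeneous half-derivative `L²` norm is invariant under scaling in one dimension, so this
quantity does not depend on `T`. -/
lemma lintegral_rescale_abs {T : ℝ} (hT : 0 < T) {ρ : ℝ → ℝ≥0∞} (hρ : Measurable ρ) :
    ∫⁻ s : ℝ, (ENNReal.ofReal |s| ^ (1 / 2 : ℝ) * rescale T ρ s) ^ 2 =
      ∫⁻ s : ℝ, ENNReal.ofReal |s| * ρ s ^ 2 := by
  have hm : Measurable (fun x : ℝ => |x|) := measurable_norm
  rw [← lintegral_comp_mul_left (F := fun s => ENNReal.ofReal |s| * ρ s ^ 2) (by fun_prop) hT,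
    ← lintegral_const_mul _ (by fun_prop)]
  refine lintegral_congr fun s => ?_
  simp only [rescale, mul_pow, rpow_half_sq]
  rw [abs_mul, abs_of_pos hT, ENNReal.ofReal_mul hT.le]
  norm_num
  ring

/-- The square root of the weight is subadditive: it falls either on `f`, where Young's inequality
uses the `L¹` norm of the kernel, or as `|τ - σ|^{1/2}` on the kernel, where it uses the
scale-invariant `L²` norm of the kernel and the `L¹` norm of `f`. The second case is why the `ℓ²L¹`
component of `Y` is needed. -/
lemma lintegral_weight_smear_le {T : ℝ} (hT : 0 < T) {ρ : ℝ → ℝ≥0∞} (hρ : Measurable ρ)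
    {m : ℝ → ℝ} (hm : Measurable m) (hm' : ∀ τ σ, |m τ - m σ| ≤ |τ - σ|)
    {f : ℝ → ℝ≥0∞} (hf : Measurable f) :
    ∫⁻ τ : ℝ, br (m τ) * (∫⁻ σ : ℝ, rescale T ρ (τ - σ) * f σ) ^ 2 ≤
      4 * ((∫⁻ s, ρ s) ^ 2 * ∫⁻ σ : ℝ, br (m σ) * f σ ^ 2) +
      4 * ((∫⁻ s, ENNReal.ofReal |s| * ρ s ^ 2) * (∫⁻ σ : ℝ, f σ) ^ 2) := by
  have habs : Measurable (fun x : ℝ => |x|) := measurable_norm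
  have hw : ∀ τ σ, br (m τ) ^ (1 / 2 : ℝ) ≤
      br (m σ) ^ (1 / 2 : ℝ) + ENNReal.ofReal |τ - σ| ^ (1 / 2 : ℝ) := by
    intro τ σ
    refine le_trans ?_ (ENNReal.rpow_add_le_add_rpow _ _ (by norm_num) (by norm_num))
    refine ENNReal.rpow_le_rpow ?_ (by norm_num)
    calc br (m τ) = br (m σ + (m τ - m σ)) := by rw [add_sub_cancel]
      _ ≤ br (m σ) + ENNReal.ofReal |m τ - m σ| := br_le_add_abs _ _
      _ ≤ _ := add_le_add_right (ENNReal.ofReal_le_ofReal (hm' _ _)) _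
  have hF : Measurable fun σ => br (m σ) ^ (1 / 2 : ℝ) * f σ := by fun_prop
  have hR : Measurable fun s => ENNReal.ofReal |s| ^ (1 / 2 : ℝ) * rescale T ρ s := by fun_prop
  have hmeas : Measurable fun τ : ℝ =>
      (∫⁻ σ : ℝ, rescale T ρ (τ - σ) * (br (m σ) ^ (1 / 2 : ℝ) * f σ)) ^ 2 :=
    (Measurable.lintegral_prod_right'
      (f := fun p : ℝ × ℝ => rescale T ρ (p.1 - p.2) * (br (m p.2) ^ (1 / 2 : ℝ) * f p.2))
      (by fun_prop)).pow_const 2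
  calc _ ≤ ∫⁻ τ : ℝ, 4 * (∫⁻ σ : ℝ, rescale T ρ (τ - σ) * (br (m σ) ^ (1 / 2 : ℝ) * f σ)) ^ 2 +
        4 * (∫⁻ σ : ℝ, ENNReal.ofReal |τ - σ| ^ (1 / 2 : ℝ) * rescale T ρ (τ - σ) * f σ) ^ 2 := by
        refine lintegral_mono fun τ => ?_
        rw [← mul_add]
        refine le_trans ?_ (add_sq_le_four _ _)
        calc _ = (br (m τ) ^ (1 / 2 : ℝ) * ∫⁻ σ : ℝ, rescale T ρ (τ - σ) * f σ) ^ 2 := by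
              rw [mul_pow, rpow_half_sq]
              norm_num
          _ ≤ _ := by
              rw [← lintegral_const_mul _ (by fun_prop), ← lintegral_add_left (by fun_prop)]
              gcongr with σ
              calc _ ≤ (br (m σ) ^ (1 / 2 : ℝ) + ENNReal.ofReal |τ - σ| ^ (1 / 2 : ℝ)) *
                    (rescale T ρ (τ - σ) * f σ) := by gcongr; exact hw τ σ
                _ = _ := by ring
    _ = 4 * (∫⁻ τ : ℝ, (∫⁻ σ : ℝ, rescale T ρ (τ - σ) * (br (m σ) ^ (1 / 2 : ℝ) * f σ)) ^ 2) +
        4 * ∫⁻ τ : ℝ, (∫⁻ σ : ℝ, ENNReal.ofReal |τ - σ| ^ (1 / 2 : ℝ) * rescale T ρ (τ - σ) *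
          f σ) ^ 2 := by
        rw [lintegral_add_left (by fun_prop), lintegral_const_mul _ hmeas,
          lintegral_const_mul' _ _ (by norm_num)]
    _ ≤ _ := by
        gcongr
        · refine (young_sq_le' (measurable_rescale hρ) hF).trans_eq ?_
          rw [lintegral_rescale hT hρ]
          congr 1
          refine lintegral_congr fun σ => ?_
          rw [mul_pow, rpow_half_sq]
          norm_num
        · refine (young_sq_le hR hf).trans_eq ?_
          rw [lintegral_rescale_abs hT hρ, mul_comm]

/-- Interpolation between the weights `w` and 1, with the threshold at `w = 1 / t`. -/
lemma rpow_three_quarters_le {t w : ℝ≥0∞} (hw : w ≠ 0) (hw' : w ≠ ⊤) :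
    w ^ (3 / 4 : ℝ) ≤ t ^ (1 / 4 : ℝ) * w + t ^ (-(3 / 4) : ℝ) := by
  rcases le_total w t⁻¹ with h | h
  · refine le_trans ?_ le_add_self
    rw [ENNReal.rpow_neg, ← ENNReal.inv_rpow]
    gcongr
  · refine le_trans ?_ le_self_add
    have h1 : w⁻¹ ≤ t := by rwa [ENNReal.inv_le_iff_inv_le]
    calc w ^ (3 / 4 : ℝ) = (w⁻¹) ^ (1 / 4 : ℝ) * w := by
          rw [ENNReal.inv_rpow, ← ENNReal.rpow_neg]
          nth_rewrite 3 [← ENNReal.rpow_one w]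
          rw [← ENNReal.rpow_add _ _ hw hw']
          norm_num
      _ ≤ _ := by gcongr

/-- Localization to a time interval of length `T` preserves the `Y` norm and gains a power of `T`
at the expense of modulation. -/
theorem localization {ρ : ℝ → ℝ≥0∞} (hρ : Measurable ρ) (h1 : ∫⁻ s, ρ s ≠ ⊤)
    (h2 : ∫⁻ s, ρ s ^ 2 ≠ ⊤) (h3 : ∫⁻ s, ENNReal.ofReal |s| * ρ s ^ 2 ≠ ⊤) :
    ∃ C : ℝ≥0∞, C ≠ ⊤ ∧ ∀ (T : ℝ) (m : ℤ → ℝ → ℝ) (g : ℤ → ℝ≥0∞) (f : ℤ → ℝ → ℝ≥0∞), 0 < T →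
      (∀ k, Measurable (m k)) → (∀ k τ σ, |m k τ - m k σ| ≤ |τ - σ|) → (∀ k, Measurable (f k)) →
      ∫⁻ x, br (m x.1 x.2) * (g x.1 * smear T ρ f x) ^ 2 ∂stVol ≤
        C * ((∑' k, ∫⁻ τ : ℝ, (g k * br (m k τ) ^ (1 / 2 : ℝ) * f k τ) ^ 2) +
          ∑' k, (∫⁻ τ : ℝ, g k * f k τ) ^ 2) ∧
      ∫⁻ x, br (m x.1 x.2) ^ (3 / 4 : ℝ) * (g x.1 * smear T ρ f x) ^ 2 ∂stVol ≤
        ENNReal.ofReal T ^ (1 / 4 : ℝ) *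
        (C * ((∑' k, ∫⁻ τ : ℝ, (g k * br (m k τ) ^ (1 / 2 : ℝ) * f k τ) ^ 2) +
          ∑' k, (∫⁻ τ : ℝ, g k * f k τ) ^ 2)) := by
  set A₁ := ∫⁻ s, ρ s
  set A₂ := ∫⁻ s, ρ s ^ 2
  set A₃ := ∫⁻ s, ENNReal.ofReal |s| * ρ s ^ 2
  refine ⟨4 * A₁ ^ 2 + 4 * A₃ + A₂, by finiteness, fun T m g f hT hm hm' hf => ?_⟩
  have hg : Measurable g := measurable_from_top
  have hmm : Measurable fun x : ℤ × ℝ => m x.1 x.2 :=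
    measurable_from_prod_countable_right fun k => hm k
  have hs := measurable_smear T hρ hf
  set N := ∑' k, ∫⁻ τ : ℝ, (g k * br (m k τ) ^ (1 / 2 : ℝ) * f k τ) ^ 2
  set L := ∑' k, (∫⁻ τ : ℝ, g k * f k τ) ^ 2
  set t := ENNReal.ofReal T
  have ht : t ≠ 0 := by simpa [t] using hT
  have ht' : t ≠ ⊤ := ENNReal.ofReal_ne_top
  have hfirst : ∫⁻ x, br (m x.1 x.2) * (g x.1 * smear T ρ f x) ^ 2 ∂stVol ≤
      4 * A₁ ^ 2 * N + 4 * A₃ * L := by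
    rw [lintegral_stVol (by fun_prop), ← ENNReal.tsum_mul_left, ← ENNReal.tsum_mul_left,
      ← ENNReal.tsum_add]
    refine ENNReal.tsum_le_tsum fun k => ?_
    have hgf : Measurable fun τ => g k * f k τ := (hf k).const_mul _
    have h := lintegral_weight_smear_le hT hρ (hm k) (hm' k) hgf
    calc _ = ∫⁻ τ : ℝ, br (m k τ) * (∫⁻ σ : ℝ, rescale T ρ (τ - σ) * (g k * f k σ)) ^ 2 := by
          refine lintegral_congr fun τ => ?_
          have := hf k
          simp only [smear]
          rw [← lintegral_const_mul _ (by fun_prop)]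
          congr 2
          refine lintegral_congr fun σ => ?_
          ring
      _ ≤ _ := h
      _ = _ := by
          rw [mul_assoc, mul_assoc]
          congr 3
          refine lintegral_congr fun τ => ?_
          rw [mul_pow, mul_pow, mul_pow, rpow_half_sq]
          norm_num
          ring
  have hzero : ∫⁻ x, (g x.1 * smear T ρ f x) ^ 2 ∂stVol ≤ t * A₂ * L := by
    rw [lintegral_stVol (by fun_prop), ← ENNReal.tsum_mul_left]
    refine ENNReal.tsum_le_tsum fun k => ?_
    have hgf : Measurable fun τ => g k * f k τ := (hf k).const_mul _
    calc _ = ∫⁻ τ : ℝ, (∫⁻ σ : ℝ, rescale T ρ (τ - σ) * (g k * f k σ)) ^ 2 := by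
          refine lintegral_congr fun τ => ?_
          have := hf k
          simp only [smear]
          rw [← lintegral_const_mul _ (by fun_prop)]
          congr 2
          ext σ
          ring
      _ ≤ _ := young_sq_le (measurable_rescale hρ) hgf
      _ = _ := by rw [lintegral_rescale_sq hT hρ, mul_comm]
  constructor
  · refine hfirst.trans ?_
    calc 4 * A₁ ^ 2 * N + 4 * A₃ * L ≤ 4 * A₁ ^ 2 * N + 4 * A₃ * L +
          (4 * A₃ * N + 4 * A₁ ^ 2 * L + A₂ * N + A₂ * L) := le_self_add
      _ = _ := by ring
  · calc _ ≤ ∫⁻ x, t ^ (1 / 4 : ℝ) * (br (m x.1 x.2) * (g x.1 * smear T ρ f x) ^ 2) +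
          t ^ (-(3 / 4) : ℝ) * (g x.1 * smear T ρ f x) ^ 2 ∂stVol := by
          refine lintegral_mono fun x => ?_
          rw [← mul_assoc, ← add_mul]
          gcongr
          exact rpow_three_quarters_le (br_ne_zero _) (br_ne_top _)
      _ = t ^ (1 / 4 : ℝ) * (∫⁻ x, br (m x.1 x.2) * (g x.1 * smear T ρ f x) ^ 2 ∂stVol) +
          t ^ (-(3 / 4) : ℝ) * ∫⁻ x, (g x.1 * smear T ρ f x) ^ 2 ∂stVol := by
          rw [lintegral_add_left (by fun_prop), lintegral_const_mul _ (by fun_prop),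
            lintegral_const_mul _ (by fun_prop)]
      -- The unweighted norm carries a factor `T` from the `L²` norm of the rescaled kernel, so
      -- `T^{-3/4} · T` matches the gain `T^{1/4}` of the first term.
      _ ≤ t ^ (1 / 4 : ℝ) * (4 * A₁ ^ 2 * N + 4 * A₃ * L) +
          t ^ (-(3 / 4) : ℝ) * (t * A₂ * L) := by gcongr
      _ = t ^ (1 / 4 : ℝ) * (4 * A₁ ^ 2 * N + 4 * A₃ * L + A₂ * L) := by
          have : t ^ (-(3 / 4) : ℝ) * t = t ^ (1 / 4 : ℝ) := by
            nth_rewrite 2 [← ENNReal.rpow_one t]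
            rw [← ENNReal.rpow_add _ _ ht ht']
            norm_num
          rw [mul_assoc t, ← mul_assoc _ t, this]
          ring
      _ ≤ _ := by
          gcongr
          calc 4 * A₁ ^ 2 * N + 4 * A₃ * L + A₂ * L ≤ 4 * A₁ ^ 2 * N + 4 * A₃ * L + A₂ * L +
                (4 * A₃ * N + 4 * A₁ ^ 2 * L + A₂ * N) := le_self_add
            _ = _ := by ring

open FourierTransform ContDiff Convolution

/-! ### The Fourier transform in time -/

/-- The inverse Fourier transform in time, without the factor `1 / 2π`. -/
noncomputable def tFourier (f : ℝ → ℂ) (t : ℝ) : ℂ :=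
  ∫ τ : ℝ, Complex.exp (Complex.I * τ * t) * f τ

lemma norm_cexp_I_mul (τ t : ℝ) : ‖Complex.exp (Complex.I * τ * t)‖ = 1 := by
  rw [show Complex.I * τ * t = ((τ * t : ℝ) : ℂ) * Complex.I by push_cast; ring,
    Complex.norm_exp_ofReal_mul_I]

lemma integrable_cexp_mul {f : ℝ → ℂ} (hf : Integrable f) (t : ℝ) :
    Integrable fun τ : ℝ => Complex.exp (Complex.I * τ * t) * f τ :=
  hf.bdd_mul (c := 1) (by fun_prop) (.of_forall fun τ => (norm_cexp_I_mul τ t).le)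

lemma norm_tFourier_le (f : ℝ → ℂ) (t : ℝ) : ‖tFourier f t‖ ≤ ∫ τ : ℝ, ‖f τ‖ := by
  refine (norm_integral_le_integral_norm _).trans_eq ?_
  simp only [norm_mul, norm_cexp_I_mul, one_mul]

lemma continuous_tFourier {f : ℝ → ℂ} (hf : Integrable f) : Continuous (tFourier f) := by
  refine continuous_of_dominated (bound := fun τ => ‖f τ‖)
    (fun t => (integrable_cexp_mul hf t).aestronglyMeasurable)
    (fun t => .of_forall fun τ => ?_) hf.norm (.of_forall fun τ => by fun_prop)
  simp [norm_cexp_I_mul]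

/-- The Fourier transform is onto on Schwartz functions; the dilation by `2π` converts between the
two normalizations of the exponential. -/
lemma exists_schwartz_fourier_eq (ψ : 𝓢(ℝ, ℂ)) :
    ∃ φ : 𝓢(ℝ, ℂ), ∀ τ : ℝ, ∫ t : ℝ, Complex.exp (Complex.I * τ * t) * φ t = ψ τ := by
  have h2π : (2 * Real.pi) ≠ 0 := by positivity
  set χ : 𝓢(ℝ, ℂ) := SchwartzMap.compCLMOfContinuousLinearEquiv ℂ
    (ContinuousLinearEquiv.smulLeft (Units.mk0 (2 * Real.pi) h2π) : ℝ ≃L[ℝ] ℝ) ψ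
  refine ⟨𝓕 χ, fun τ => ?_⟩
  have h1 : (𝓕⁻ (𝓕 χ)) (τ / (2 * Real.pi)) = χ (τ / (2 * Real.pi)) := by
    rw [FourierTransform.fourierInv_fourier_eq]
  have h2 : χ (τ / (2 * Real.pi)) = ψ τ := by
    simp only [χ, SchwartzMap.compCLMOfContinuousLinearEquiv_apply, Function.comp_apply]
    congr 1
    change (2 * Real.pi) * (τ / (2 * Real.pi)) = τ
    field_simp
  rw [← h2, ← h1, SchwartzMap.fourierInv_coe, Real.fourierInv_eq']
  refine integral_congr_ae (.of_forall fun t => ?_)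
  simp only [smul_eq_mul]
  congr 2
  simp only [RCLike.inner_apply, conj_trivial]
  push_cast
  field_simp

lemma exists_schwartz_eq_one (R : ℝ) : ∃ ψ : 𝓢(ℝ, ℂ), ∀ t : ℝ, |t| ≤ R → ψ t = 1 := by
  set r := max R 1
  set f : ContDiffBump (0 : ℝ) := ⟨r, r + 1, by positivity, by linarith⟩
  have hg₁ : HasCompactSupport (Complex.ofRealCLM ∘ f) := f.hasCompactSupport.comp_left rfl
  have hg₂ : ContDiff ℝ ∞ (Complex.ofRealCLM ∘ f) := Complex.ofRealCLM.contDiff.comp f.contDiff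
  refine ⟨hg₁.toSchwartzMap hg₂, fun t ht => ?_⟩
  have : f t = 1 := f.one_of_mem_closedBall (by
    rw [mem_closedBall_zero_iff, Real.norm_eq_abs]
    exact ht.trans (le_max_left _ _))
  simp [this]

lemma IsSTFourier.integrable_mul {u : STDist} {f : ℤ → ℝ → ℂ} (h : IsSTFourier u f) (k : ℤ)
    (ψ : 𝓢(ℝ, ℂ)) : Integrable fun τ => f k τ * ψ τ := by
  obtain ⟨φ, hφ⟩ := exists_schwartz_fourier_eq ψ
  have := (h k φ).1
  simpa only [hφ] using this

/-- On a compact set `f k` coincides with its product with a Schwartz function equal to 1 there. -/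
lemma IsSTFourier.locallyIntegrable {u : STDist} {f : ℤ → ℝ → ℂ} (h : IsSTFourier u f) (k : ℤ) :
    LocallyIntegrable (f k) := by
  rw [locallyIntegrable_iff]
  intro K hK
  obtain ⟨R, hR⟩ := hK.isBounded.exists_norm_le
  obtain ⟨ψ, hψ⟩ := exists_schwartz_eq_one R
  refine (h.integrable_mul k ψ).integrableOn.congr_fun (fun τ hτ => ?_) hK.measurableSet
  simp only [hψ τ (hR τ hτ), mul_one]

/-- Every test function is the transform of a Schwartz function, so the two agree as distributions.
This makes the choice hidden in `stFourier` irrelevant for the norms. -/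
lemma IsSTFourier.ae_eq {u : STDist} {f f' : ℤ → ℝ → ℂ} (h : IsSTFourier u f)
    (h' : IsSTFourier u f') (k : ℤ) : f k =ᵐ[volume] f' k := by
  refine ae_eq_of_integral_contDiff_smul_eq (h.locallyIntegrable k) (h'.locallyIntegrable k)
    fun g hg hgc => ?_
  have hg₁ : HasCompactSupport (Complex.ofRealCLM ∘ g) := hgc.comp_left rfl
  have hg₂ : ContDiff ℝ ∞ (Complex.ofRealCLM ∘ g) := Complex.ofRealCLM.contDiff.comp hg
  obtain ⟨φ, hφ⟩ := exists_schwartz_fourier_eq (hg₁.toSchwartzMap hg₂)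
  have e := (h k φ).2.symm.trans (h' k φ).2
  have hpi : (1 / (2 * Real.pi) : ℂ) ≠ 0 := by simp [Real.pi_ne_zero]
  have e' := mul_left_cancel₀ hpi e
  simp only [hφ, HasCompactSupport.toSchwartzMap_toFun] at e'
  simpa [mul_comm] using e'

lemma stFourier_spec {u : STDist} (h : HasSTFourier u) : IsSTFourier u (stFourier u) := by
  unfold stFourier
  rw [dif_pos h]
  exact h.choose_spec

lemma integral_mul_fourier_swap {G : ℝ → ℂ} (hG : Integrable G) (φ : 𝓢(ℝ, ℂ)) :
    Integrable (fun τ : ℝ => G τ * ∫ t : ℝ, Complex.exp (Complex.I * τ * t) * φ t) ∧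
    ∫ τ : ℝ, G τ * ∫ t : ℝ, Complex.exp (Complex.I * τ * t) * φ t =
      ∫ t : ℝ, φ t * tFourier G t := by
  have hI : Integrable (fun p : ℝ × ℝ => G p.1 * (Complex.exp (Complex.I * p.1 * p.2) * φ p.2))
      (volume.prod volume) := by
    have hc : Continuous fun p : ℝ × ℝ => Complex.exp (Complex.I * p.1 * p.2) := by fun_prop
    have := (hG.mul_prod (φ.integrable (μ := volume))).bdd_mul (c := 1)
      hc.aestronglyMeasurable (.of_forall fun p => (norm_cexp_I_mul p.1 p.2).le)
    refine this.congr (.of_forall fun p => ?_)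
    simp only
    ring
  constructor
  · simpa only [integral_const_mul] using hI.integral_prod_left
  · simp only [← integral_const_mul]
    rw [integral_integral_swap hI]
    refine integral_congr_ae (.of_forall fun t => ?_)
    simp only [tFourier, ← integral_const_mul]
    refine integral_congr_ae (.of_forall fun τ => ?_)
    simp only
    ring

/-- A sequence of integrable functions is the Fourier transform of a distribution. -/
lemma exists_isSTFourier {G : ℤ → ℝ → ℂ} (hG : ∀ k, Integrable (G k)) :
    ∃ F : STDist, IsSTFourier F G ∧
      ∀ (k : ℤ) (φ : 𝓢(ℝ, ℂ)), F k φ = ∫ t : ℝ, φ t * ((1 / (2 * Real.pi) : ℂ) * tFourier (G k) t) := by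
  have hL : ∀ k, MemLp (fun t => (1 / (2 * Real.pi) : ℂ) * tFourier (G k) t) ⊤ := by
    intro k
    refine (memLp_top_of_bound (continuous_tFourier (hG k)).aestronglyMeasurable _
      (.of_forall (norm_tFourier_le (G k)))).const_mul _
  have key : ∀ (k : ℤ) (φ : 𝓢(ℝ, ℂ)), Lp.toTemperedDistribution ((hL k).toLp _) φ =
      ∫ t : ℝ, φ t * ((1 / (2 * Real.pi) : ℂ) * tFourier (G k) t) := by
    intro k φ
    rw [Lp.toTemperedDistribution_apply]
    refine integral_congr_ae ?_
    filter_upwards [(hL k).coeFn_toLp] with t ht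
    rw [ht, smul_eq_mul]
  refine ⟨fun k => Lp.toTemperedDistribution ((hL k).toLp _), fun k φ => ?_, key⟩
  obtain ⟨h1, h2⟩ := integral_mul_fourier_swap (hG k) φ
  refine ⟨h1, ?_⟩
  rw [key, h2, ← integral_const_mul]
  refine integral_congr_ae (.of_forall fun t => ?_)
  simp only
  ring

/-! ### Convolutions -/

/-- The convolution of two complex functions on the line. -/
noncomputable def conv (f g : ℝ → ℂ) (τ : ℝ) : ℂ := ∫ σ : ℝ, f σ * g (τ - σ)

lemma conv_eq (f g : ℝ → ℂ) :
    conv f g = f ⋆[ContinuousLinearMap.mul ℂ ℂ, volume] g := rfl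

lemma integrable_conv {f g : ℝ → ℂ} (hf : Integrable f) (hg : Integrable g) :
    Integrable (conv f g) := by
  rw [conv_eq]
  exact hf.integrable_convolution _ hg

lemma tFourier_conv {f g : ℝ → ℂ} (hf : Integrable f) (hg : Integrable g) (t : ℝ) :
    tFourier (conv f g) t = tFourier f t * tFourier g t := by
  have h := integral_convolution (ContinuousLinearMap.mul ℂ ℂ) (μ := volume) (ν := volume)
    (integrable_cexp_mul hf t) (integrable_cexp_mul hg t)
  rw [ContinuousLinearMap.mul_apply'] at h
  unfold tFourier
  rw [← h]
  refine integral_congr_ae (.of_forall fun τ => ?_)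
  simp only [conv, convolution_def, ContinuousLinearMap.mul_apply', ← integral_const_mul]
  refine integral_congr_ae (.of_forall fun σ => ?_)
  simp only
  rw [show Complex.I * τ * t = Complex.I * σ * t + Complex.I * ((τ - σ : ℝ) : ℂ) * t by
    push_cast; ring, Complex.exp_add]
  ring

lemma enorm_conv_le (f g : ℝ → ℂ) (τ : ℝ) :
    ‖conv f g τ‖ₑ ≤ ∫⁻ σ : ℝ, ‖f σ‖ₑ * ‖g (τ - σ)‖ₑ := by
  refine (enorm_integral_le_lintegral_enorm _).trans_eq ?_
  simp only [enorm_mul]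

lemma tFourier_conj_neg (f : ℝ → ℂ) (t : ℝ) :
    tFourier (fun τ => (starRingEnd ℂ) (f (-τ))) t = (starRingEnd ℂ) (tFourier f t) := by
  unfold tFourier
  rw [← integral_conj, ← integral_neg_eq_self]
  refine integral_congr_ae (.of_forall fun τ => ?_)
  simp only [map_mul, neg_neg, ← Complex.exp_conj, Complex.conj_I, Complex.conj_ofReal]
  congr 2
  push_cast
  ring

lemma integrable_conj_neg {f : ℝ → ℂ} (hf : Integrable f) :
    Integrable fun τ => (starRingEnd ℂ) (f (-τ)) :=
  (Complex.conjLIE.toContinuousLinearEquiv.toContinuousLinearMap.integrable_comp hf.comp_neg)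

lemma tFourier_rescale {Ψ : ℝ → ℂ} {T : ℝ} (hT : 0 < T) (t : ℝ) :
    tFourier (fun τ => T * Ψ (T * τ)) t = tFourier Ψ (t / T) := by
  unfold tFourier
  have h := Measure.integral_comp_mul_left (fun σ : ℝ => Complex.exp (Complex.I * σ * (t / T : ℝ)) * Ψ σ) T
  rw [abs_of_pos (inv_pos.mpr hT)] at h
  calc _ = (T : ℂ) * ∫ τ : ℝ, Complex.exp (Complex.I * (T * τ : ℝ) * (t / T : ℝ)) * Ψ (T * τ) := by
        rw [← integral_const_mul]
        refine integral_congr_ae (.of_forall fun τ => ?_)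
        simp only
        rw [mul_left_comm]
        congr 3
        have : (T : ℂ) ≠ 0 := by exact_mod_cast hT.ne'
        push_cast
        field_simp
    _ = _ := by
        rw [h, Complex.real_smul, ← mul_assoc]
        push_cast
        rw [mul_inv_cancel₀ (by exact_mod_cast hT.ne'), one_mul]

/-! ### Spatial Fourier coefficients of trigonometric polynomials -/

lemma integral_cexp_int (n : ℤ) :
    ∫ x in (0 : ℝ)..(2 * Real.pi), Complex.exp (Complex.I * n * x) =
      if n = 0 then (2 * Real.pi : ℂ) else 0 := by
  split_ifs with h
  · simp [h]
  · have hc : Complex.I * (n : ℂ) ≠ 0 := by simp [h]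
    rw [integral_exp_mul_complex hc]
    have : Complex.exp (Complex.I * n * ((2 * Real.pi : ℝ) : ℂ)) = 1 := by
      rw [Complex.exp_eq_one_iff]
      exact ⟨n, by push_cast; ring⟩
    rw [this]
    simp

lemma spaceCoeff_sum {ι : Type*} (s : Finset ι) (n : ι → ℤ) (c : ι → ℝ → ℂ) (k : ℤ) (t : ℝ) :
    spaceCoeff (fun t x => ∑ i ∈ s, Complex.exp (Complex.I * n i * x) * c i t) k t =
      2 * Real.pi * ∑ i ∈ s, if n i = k then c i t else 0 := by
  unfold spaceCoeff
  calc _ = ∫ x in (0 : ℝ)..(2 * Real.pi), ∑ i ∈ s,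
        c i t * Complex.exp (Complex.I * ((n i - k : ℤ) : ℂ) * x) := by
        refine intervalIntegral.integral_congr fun x _ => ?_
        simp only [Finset.mul_sum]
        refine Finset.sum_congr rfl fun i _ => ?_
        rw [← mul_assoc, ← Complex.exp_add, mul_comm]
        congr 2
        push_cast
        ring
    _ = _ := by
        rw [intervalIntegral.integral_finsetSum fun i _ =>
          Continuous.intervalIntegrable (by fun_prop) _ _, Finset.mul_sum]
        refine Finset.sum_congr rfl fun i _ => ?_
        rw [intervalIntegral.integral_const_mul, integral_cexp_int]
        simp only [sub_eq_zero]
        split_ifs <;> ring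

lemma spaceCoeff_projFun (N : ℕ) (g : ℝ → ℝ → ℂ) (k : ℤ) (t : ℝ) :
    spaceCoeff (projFun N g) k t = if k ∈ shell N then spaceCoeff g k t else 0 := by
  have h : projFun N g = fun t (x : ℝ) => ∑ j ∈ shell N, Complex.exp (Complex.I * j * x) *
      ((1 / (2 * Real.pi) : ℂ) * spaceCoeff g j t) := by
    ext t x
    rw [projFun, Finset.mul_sum]
    refine Finset.sum_congr rfl fun j _ => ?_
    ring
  rw [h, spaceCoeff_sum (shell N) (fun j => j)]
  rw [Finset.sum_ite_eq']
  split_ifs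
  · have : (Real.pi : ℂ) ≠ 0 := by exact_mod_cast Real.pi_ne_zero
    field_simp
  · simp

/-! ### The norms in terms of Fourier transforms -/

/-- The frequency weight `⟨k⟩^s`. -/
noncomputable def wF (s : ℝ) (k : ℤ) : ℝ≥0∞ := br k ^ s

lemma wF_eq (s : ℝ) (k : ℤ) : wF s k = ENNReal.ofReal (bracket k ^ s) := br_rpow _ _

lemma wF_ne_zero (s : ℝ) (k : ℤ) : wF s k ≠ 0 := by
  simp [wF, ENNReal.rpow_eq_zero_iff, br_ne_zero, br_ne_top]

lemma rpow_half_pow_two (x : ℝ≥0∞) : (x ^ (1 / 2 : ℝ)) ^ 2 = x := by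
  rw [rpow_half_sq]
  norm_num

lemma hasSTFourier_of_normY_lt_top {m : ℤ → ℝ → ℝ} {s : ℝ} {u : STDist} (h : normY m s u < ⊤) :
    HasSTFourier u := by
  by_contra hc
  simp [normY, normX, hc] at h

/-- Passing to measurable representatives costs nothing in the norms. Integrability for each `k`
follows from the `ℓ²L¹` component, as the frequency weight does not vanish. -/
lemma normY_data {m : ℤ → ℝ → ℝ} {s : ℝ} {u : STDist} (h : normY m s u < ⊤) :
    ∃ f : ℤ → ℝ → ℂ, (∀ k, Measurable (f k)) ∧ (∀ k, Integrable (f k)) ∧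
      (∀ k, f k =ᵐ[volume] stFourier u k) ∧
      (∑' k, ∫⁻ τ : ℝ, (wF s k * br (m k τ) ^ (1 / 2 : ℝ) * ‖f k τ‖ₑ) ^ 2) +
        ∑' k, (∫⁻ τ : ℝ, wF s k * ‖f k τ‖ₑ) ^ 2 ≤ normY m s u ^ 2 := by
  have hF := hasSTFourier_of_normY_lt_top h
  have hspec := stFourier_spec hF
  have hm : ∀ k, AEStronglyMeasurable (stFourier u k) :=
    fun k => (hspec.locallyIntegrable k).aestronglyMeasurable
  have hae : ∀ k, (hm k).mk =ᵐ[volume] stFourier u k := fun k => (hm k).ae_eq_mk.symm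
  have e1 : ∑' k, ∫⁻ τ : ℝ, (wF s k * br (m k τ) ^ (1 / 2 : ℝ) * ‖(hm k).mk _ τ‖ₑ) ^ 2 =
      normX m s (1 / 2) u ^ 2 := by
    rw [normX, if_pos hF, l2L2, rpow_half_pow_two]
    refine tsum_congr fun k => lintegral_congr_ae ?_
    filter_upwards [hae k] with τ hτ
    rw [hτ, wF_eq, br_rpow, ← ENNReal.ofReal_mul (Real.rpow_nonneg (bracket_pos _).le _)]
  have e2 : ∑' k, (∫⁻ τ : ℝ, wF s k * ‖(hm k).mk _ τ‖ₑ) ^ 2 =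
      l2L1 (fun k _ => bracket k ^ s) (stFourier u) ^ 2 := by
    rw [l2L1, rpow_half_pow_two]
    refine tsum_congr fun k => ?_
    congr 1
    refine lintegral_congr_ae ?_
    filter_upwards [hae k] with τ hτ
    rw [hτ, wF_eq]
  have hY : normY m s u = normX m s (1 / 2) u + l2L1 (fun k _ => bracket k ^ s) (stFourier u) := by
    rw [normY, if_pos hF]
  have hle : (∑' k, ∫⁻ τ : ℝ, (wF s k * br (m k τ) ^ (1 / 2 : ℝ) * ‖(hm k).mk _ τ‖ₑ) ^ 2) +
        ∑' k, (∫⁻ τ : ℝ, wF s k * ‖(hm k).mk _ τ‖ₑ) ^ 2 ≤ normY m s u ^ 2 := by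
    rw [e1, e2, hY, add_sq]
    calc _ ≤ normX m s (1 / 2) u ^ 2 + l2L1 (fun k _ => bracket k ^ s) (stFourier u) ^ 2 +
          2 * normX m s (1 / 2) u * l2L1 (fun k _ => bracket k ^ s) (stFourier u) := le_self_add
      _ = _ := by ring
  refine ⟨fun k => (hm k).mk, fun k => (hm k).stronglyMeasurable_mk.measurable, fun k => ?_, hae, hle⟩
  refine ⟨(hm k).stronglyMeasurable_mk.aestronglyMeasurable, ?_⟩
  have hk : (∫⁻ τ : ℝ, wF s k * ‖(hm k).mk _ τ‖ₑ) ^ 2 ≠ ⊤ :=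
    ne_top_of_le_ne_top (ENNReal.pow_ne_top h.ne)
      (((ENNReal.le_tsum k).trans le_add_self).trans hle)
  have hk' : wF s k * ∫⁻ τ : ℝ, ‖(hm k).mk _ τ‖ₑ ≠ ⊤ := by
    rw [← lintegral_const_mul _ (hm k).stronglyMeasurable_mk.measurable.enorm]
    intro hc
    rw [hc] at hk
    exact hk (by simp)
  refine lt_top_iff_ne_top.mpr fun hc => hk' ?_
  rw [hc, ENNReal.mul_top (wF_ne_zero s k)]

/-- By uniqueness of the transform up to null sets, any explicit one may be used to compute the
norm. -/
lemma normZ_le {m : ℤ → ℝ → ℝ} {s : ℝ} {F : STDist} {G : ℤ → ℝ → ℂ} (hFG : IsSTFourier F G)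
    {D : ℝ≥0∞}
    (h1 : ∑' k, ∫⁻ τ : ℝ, (wF s k * br (m k τ) ^ (-(1 / 2) : ℝ) * ‖G k τ‖ₑ) ^ 2 ≤ D)
    (h2 : ∑' k, (∫⁻ τ : ℝ, wF s k * br (m k τ) ^ (-1 : ℝ) * ‖G k τ‖ₑ) ^ 2 ≤ D) :
    normZ m s F ≤ 2 * D ^ (1 / 2 : ℝ) := by
  have hF : HasSTFourier F := ⟨G, hFG⟩
  have hae := fun k => (stFourier_spec hF).ae_eq hFG k
  rw [normZ, normX, if_pos hF, if_pos hF, two_mul]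
  unfold l2L2 l2L1
  refine add_le_add (ENNReal.rpow_le_rpow (le_of_eq_of_le ?_ h1) (by norm_num))
    (ENNReal.rpow_le_rpow (le_of_eq_of_le ?_ h2) (by norm_num))
  · refine tsum_congr fun k => lintegral_congr_ae ?_
    filter_upwards [hae k] with τ hτ
    rw [hτ, wF_eq, br_rpow, ← ENNReal.ofReal_mul (Real.rpow_nonneg (bracket_pos _).le _), neg_div]
  · refine tsum_congr fun k => ?_
    congr 1
    refine lintegral_congr_ae ?_
    filter_upwards [hae k] with τ hτ
    rw [hτ, wF_eq, br_rpow, ← ENNReal.ofReal_mul (Real.rpow_nonneg (bracket_pos _).le _),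
      Real.rpow_neg_one, div_eq_mul_inv]

/-- An element of a `Y` space coincides on `(0, T)` with one whose Fourier transform is small in
weaker modulation norms. -/
theorem exists_localized : ∃ C : ℝ≥0∞, C ≠ ⊤ ∧ ∀ (T : ℝ) (m : ℤ → ℝ → ℝ) (s : ℝ) (u : STDist),
    0 < T → (∀ k, Measurable (m k)) → (∀ k τ σ, |m k τ - m k σ| ≤ |τ - σ|) → normY m s u < ⊤ →
    ∃ (a : ℤ → ℝ → ℂ) (U : ℤ × ℝ → ℝ≥0∞), (∀ k, Integrable (a k)) ∧ Measurable U ∧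
      (∀ k τ, ‖a k τ‖ₑ ≤ U (k, τ)) ∧
      (∀ k, ∀ t ∈ Set.Ioo 0 T, tFourier (a k) t = tFourier (stFourier u k) t) ∧
      ∫⁻ x, br (m x.1 x.2) * (wF s x.1 * U x) ^ 2 ∂stVol ≤ C * normY m s u ^ 2 ∧
      ∫⁻ x, br (m x.1 x.2) ^ (3 / 4 : ℝ) * (wF s x.1 * U x) ^ 2 ∂stVol ≤
        ENNReal.ofReal T ^ (1 / 4 : ℝ) * (C * normY m s u ^ 2) := by
  -- The time cutoff is `χ(t / T)`. It equals 1 for `|t| ≤ T`, and in frequency it acts by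
  -- convolution with `T Ψ(T τ)`.
  obtain ⟨χ, hχ⟩ := exists_schwartz_eq_one 1
  obtain ⟨Ψ, hΨ⟩ := exists_schwartz_fourier_eq χ
  have hΨm : Measurable fun s => ‖Ψ s‖ₑ := Ψ.continuous.measurable.enorm
  have hΨ2 : ∫⁻ s, ‖Ψ s‖ₑ ^ 2 ≠ ⊤ := by
    have := (Ψ.memLp 2 (μ := volume)).eLpNorm_lt_top
    rw [eLpNorm_lt_top_iff_lintegral_rpow_enorm_lt_top (by norm_num) (by norm_num)] at this
    simpa using this.ne
  have hΨ3 : ∫⁻ s, ENNReal.ofReal |s| * ‖Ψ s‖ₑ ^ 2 ≠ ⊤ := by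
    obtain ⟨B, hB⟩ : ∃ B : ℝ≥0∞, B ≠ ⊤ ∧ ∀ s, ‖Ψ s‖ₑ ≤ B := by
      refine ⟨ENNReal.ofReal (SchwartzMap.seminorm ℝ 0 0 Ψ), ENNReal.ofReal_ne_top, fun s => ?_⟩
      rw [← ofReal_norm]
      exact ENNReal.ofReal_le_ofReal (SchwartzMap.norm_le_seminorm ℝ Ψ s)
    have hI := (Ψ.integrable_pow_mul volume 1).2
    refine ne_top_of_le_ne_top (ENNReal.mul_ne_top hB.1 hI.ne) ?_
    rw [← lintegral_const_mul' _ _ hB.1]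
    refine lintegral_mono fun s => ?_
    simp only [pow_one, enorm_mul, Real.enorm_eq_ofReal_abs]
    calc _ = ‖Ψ s‖ₑ * (ENNReal.ofReal |s| * ‖Ψ s‖ₑ) := by ring
      _ ≤ _ := by
        rw [Real.norm_eq_abs, abs_abs, abs_of_nonneg (norm_nonneg (Ψ s)), ofReal_norm]
        gcongr
        exact hB.2 s
  obtain ⟨C, hC, h⟩ := localization hΨm Ψ.integrable.2.ne hΨ2 hΨ3
  refine ⟨C, hC, fun T m s u hT hm hm' hu => ?_⟩
  obtain ⟨f, hfm, hfi, hfe, hf⟩ := normY_data hu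
  obtain ⟨H1, H2⟩ := h T m (wF s) (fun k τ => ‖f k τ‖ₑ) hT hm hm' (fun k => (hfm k).enorm)
  have hcut : Integrable fun τ : ℝ => (T : ℂ) * Ψ (T * τ) :=
    (Ψ.integrable.comp_mul_left' hT.ne').const_mul _
  refine ⟨fun k => conv (f k) (fun τ => T * Ψ (T * τ)),
    smear T (fun s => ‖Ψ s‖ₑ) (fun k τ => ‖f k τ‖ₑ), fun k => integrable_conv (hfi k) hcut,
    measurable_smear T hΨm (fun k => (hfm k).enorm), fun k τ => ?_, fun k t ht => ?_,
    H1.trans (by gcongr), H2.trans (by gcongr)⟩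
  · refine (enorm_conv_le _ _ _).trans_eq ?_
    unfold smear rescale
    refine lintegral_congr fun σ => ?_
    rw [enorm_mul, mul_comm]
    congr 2
    rw [← ofReal_norm, Complex.norm_real, Real.norm_of_nonneg hT.le]
  · rw [tFourier_conv (hfi k) hcut, tFourier_rescale hT]
    have h1 : tFourier Ψ (t / T) = 1 := by
      rw [← hχ (t / T)]
      · rw [← hΨ (t / T)]
        unfold tFourier
        refine integral_congr_ae (.of_forall fun τ => ?_)
        simp only
        congr 2
        ring
      · rw [abs_of_nonneg (div_nonneg ht.1.le hT.le)]
        exact (div_le_one hT).mpr ht.2.le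
    rw [h1, mul_one]
    refine integral_congr_ae ?_
    filter_upwards [hfe k] with τ hτ
    rw [hτ]

/-! ### Products of Littlewood-Paley pieces -/

lemma proj_eq (N : ℕ) (u : STDist) (t x : ℝ) :
    proj N u t x = (1 / (2 * Real.pi) : ℂ) ^ 2 * ∑ k ∈ shell N, Complex.exp (Complex.I * k * x) *
      tFourier (stFourier u k) t := by
  unfold proj tFourier
  rw [Finset.mul_sum, Finset.mul_sum]
  refine Finset.sum_congr rfl fun k _ => ?_
  ring

lemma proj_mul_proj (N₁ N₂ : ℕ) (u v : STDist) :
    (fun t x => proj N₁ u t x * proj N₂ v t x) = fun t (x : ℝ) =>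
      ∑ p ∈ shell N₁ ×ˢ shell N₂, Complex.exp (Complex.I * ((p.1 + p.2 : ℤ) : ℂ) * x) *
        ((1 / (2 * Real.pi) : ℂ) ^ 4 *
          (tFourier (stFourier u p.1) t * tFourier (stFourier v p.2) t)) := by
  ext t x
  rw [proj_eq, proj_eq, mul_mul_mul_comm, Finset.sum_mul_sum, ← Finset.sum_product', Finset.mul_sum]
  refine Finset.sum_congr rfl fun p _ => ?_
  push_cast
  rw [mul_add, add_mul, Complex.exp_add]
  ring

lemma dx_proj_mul_conj_proj (N₁ N₂ : ℕ) (u v : STDist) :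
    dx (fun t x => proj N₁ u t x * (starRingEnd ℂ) (proj N₂ v t x)) = fun t (x : ℝ) =>
      ∑ p ∈ shell N₁ ×ˢ shell N₂, Complex.exp (Complex.I * ((p.1 - p.2 : ℤ) : ℂ) * x) *
        ((1 / (2 * Real.pi) : ℂ) ^ 4 * (Complex.I * ((p.1 - p.2 : ℤ) : ℂ)) *
          (tFourier (stFourier u p.1) t * (starRingEnd ℂ) (tFourier (stFourier v p.2) t))) := by
  have h : ∀ t, (fun x : ℝ => proj N₁ u t x * (starRingEnd ℂ) (proj N₂ v t x)) = fun (x : ℝ) =>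
      ∑ p ∈ shell N₁ ×ˢ shell N₂, Complex.exp (Complex.I * ((p.1 - p.2 : ℤ) : ℂ) * x) *
        ((1 / (2 * Real.pi) : ℂ) ^ 4 *
          (tFourier (stFourier u p.1) t * (starRingEnd ℂ) (tFourier (stFourier v p.2) t))) := by
    intro t
    ext x
    rw [proj_eq, proj_eq]
    simp only [map_mul, map_sum, map_pow, map_div₀, map_one, Complex.conj_ofReal, map_ofNat,
      ← Complex.exp_conj, Complex.conj_I, map_intCast]
    rw [mul_mul_mul_comm, Finset.sum_mul_sum, ← Finset.sum_product', Finset.mul_sum]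
    refine Finset.sum_congr rfl fun p _ => ?_
    push_cast
    rw [mul_sub, sub_mul, sub_eq_add_neg, Complex.exp_add,
      show -Complex.I * (p.2 : ℂ) * x = -(Complex.I * p.2 * x) by ring]
    ring
  ext t x
  unfold dx
  rw [h]
  refine HasDerivAt.deriv (HasDerivAt.fun_sum fun p _ => ?_)
  have h1 : HasDerivAt (fun x : ℝ => Complex.I * ((p.1 - p.2 : ℤ) : ℂ) * (x : ℂ))
      (Complex.I * ((p.1 - p.2 : ℤ) : ℂ)) x := by
    simpa using (Complex.ofRealCLM.hasDerivAt (x := x)).const_mul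
      (Complex.I * ((p.1 - p.2 : ℤ) : ℂ))
  refine (h1.cexp.mul_const _).congr_deriv ?_
  ring

lemma tFourier_const_mul_sum {ι : Type*} (s : Finset ι) (c : ℂ) {h : ι → ℝ → ℂ}
    (hh : ∀ i, Integrable (h i)) (t : ℝ) :
    tFourier (fun τ => c * ∑ i ∈ s, h i τ) t = c * ∑ i ∈ s, tFourier (h i) t := by
  unfold tFourier
  rw [← integral_finsetSum _ fun i _ => integrable_cexp_mul (hh i) t, ← integral_const_mul]
  refine integral_congr_ae (.of_forall fun τ => ?_)
  simp only [Finset.mul_sum]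
  refine Finset.sum_congr rfl fun i _ => ?_
  ring

lemma one_div_two_pi_enorm_le : ‖(1 / (2 * Real.pi) : ℂ) ^ 2‖ₑ ≤ 1 := by
  rw [← ofReal_norm, ← ENNReal.ofReal_one]
  refine ENNReal.ofReal_le_ofReal ?_
  rw [norm_pow]
  refine pow_le_one₀ (norm_nonneg _) ?_
  have := Real.pi_gt_three
  rw [norm_div, norm_one, norm_mul, Complex.norm_real, Real.norm_of_nonneg Real.pi_pos.le,
    Complex.norm_ofNat, div_le_one (by positivity)]
  linarith

/-- The extension of a projected bilinear expression whose Fourier coefficients on `(0, T)` are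
`μ k` times a sum of convolutions. -/
lemma exists_extension {T : ℝ} (N₀ : ℕ) (g : ℝ → ℝ → ℂ) (s : Finset (ℤ × ℤ)) (n : ℤ × ℤ → ℤ)
    (μ : ℤ → ℂ) (h : ℤ × ℤ → ℝ → ℂ) (hh : ∀ p, Integrable (h p))
    (hg : ∀ k, ∀ t ∈ Set.Ioo 0 T, spaceCoeff g k t = (1 / (2 * Real.pi) : ℂ) *
      ((1 / (2 * Real.pi) : ℂ) ^ 2 * μ k * ∑ p ∈ s with n p = k, tFourier (h p) t)) :
    ∃ (F : STDist) (G : ℤ → ℝ → ℂ), AgreesOn T F (projFun N₀ g) ∧ IsSTFourier F G ∧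
      ∀ k τ, ‖G k τ‖ₑ ≤ (if k ∈ shell N₀ then 1 else 0) *
        (‖μ k‖ₑ * ∑ p ∈ s with n p = k, ‖h p τ‖ₑ) := by
  -- Of the three factors `1 / 2π` in the coefficient, one belongs to Fourier inversion in time; the
  -- other two stay in `G`.
  set G : ℤ → ℝ → ℂ := fun k τ => (if k ∈ shell N₀ then (1 / (2 * Real.pi) : ℂ) ^ 2 * μ k else 0) *
    ∑ p ∈ s with n p = k, h p τ
  have hG : ∀ k, Integrable (G k) := fun k =>
    (integrable_finsetSum _ fun p _ => hh p).const_mul _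
  obtain ⟨F, hFG, hF⟩ := exists_isSTFourier hG
  refine ⟨F, G, fun k φ hφ => ?_, hFG, fun k τ => ?_⟩
  · rw [hF]
    refine integral_congr_ae (.of_forall fun t => ?_)
    simp only
    by_cases ht : t ∈ tsupport φ
    · rw [mul_comm]
      congr 1
      rw [spaceCoeff_projFun, tFourier_const_mul_sum _ _ hh]
      split_ifs
      · rw [hg k t (hφ ht)]
      · simp
    · rw [image_eq_zero_of_notMem_tsupport ht]
      simp
  · simp only [G]
    rw [enorm_mul]
    split_ifs
    · rw [enorm_mul, one_mul]
      calc _ ≤ 1 * ‖μ k‖ₑ * ∑ p ∈ s with n p = k, ‖h p τ‖ₑ := by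
            gcongr
            · exact one_div_two_pi_enorm_le
            · exact enorm_sum_le _ _
        _ = _ := by rw [one_mul]
    · simp

/-! ### Dyadic shells, modulation functions and frequency weights -/

lemma mem_shell {N : ℕ} {k : ℤ} : k ∈ shell N ↔ (N : ℤ) ≤ |k| ∧ |k| < 2 * N := by
  simp only [shell, Finset.mem_filter, Finset.mem_Ioo, abs_lt]
  tauto

lemma ne_zero_of_mem_shell {N : ℕ} (hN : 0 < N) {k : ℤ} (h : k ∈ shell N) : k ≠ 0 := by
  rintro rfl
  have := (mem_shell.mp h).1
  simp at this
  omega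

lemma measurable_modS (α : ℝ) (k : ℤ) : Measurable (modS α k) := by
  unfold modS
  fun_prop

lemma measurable_modW (β : ℝ) (k : ℤ) : Measurable (modW β k) := by
  unfold modW
  have : Measurable (fun x : ℝ => |x|) := measurable_norm
  fun_prop

lemma abs_modS_sub_le (α : ℝ) (k : ℤ) (τ σ : ℝ) : |modS α k τ - modS α k σ| ≤ |τ - σ| := by
  simp [modS]

lemma abs_modW_sub_le (β : ℝ) (k : ℤ) (τ σ : ℝ) : |modW β k τ - modW β k σ| ≤ |τ - σ| := by
  simp only [modW, sub_sub_sub_cancel_right]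
  exact abs_abs_sub_abs_le τ σ

lemma wF_zero (k : ℤ) : wF 0 k = 1 := by simp [wF]

lemma wK_mul_wF {k : ℤ} (hk : k ≠ 0) : wK k ^ (1 / 2 : ℝ) * wF (-1 / 2) k = 1 := by
  rw [wK, if_neg hk, wF, ← ENNReal.rpow_add _ _ (br_ne_zero _) (br_ne_top _)]
  norm_num

/-- The derivative against the output weight `⟨k⟩^{-1/2}` leaves half a derivative, and it
annihilates `k = 0`, matching the vanishing of `wK` there. -/
lemma wF_mul_abs_le (k : ℤ) :
    wF (-1 / 2) k * ‖Complex.I * (k : ℂ)‖ₑ ≤ wK k ^ (1 / 2 : ℝ) := by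
  rcases eq_or_ne k 0 with rfl | hk
  · simp
  · have h1 : ‖Complex.I * (k : ℂ)‖ₑ ≤ br k := by
      rw [← ofReal_norm, norm_mul, Complex.norm_I, one_mul, Complex.norm_intCast]
      exact ENNReal.ofReal_le_ofReal (abs_le_bracket _)
    rw [wK, if_neg hk, wF]
    calc _ ≤ br k ^ (-1 / 2 : ℝ) * br k ^ (1 : ℝ) := by rw [ENNReal.rpow_one]; gcongr
      _ = _ := by
        rw [← ENNReal.rpow_add _ _ (br_ne_zero _) (br_ne_top _)]
        norm_num

/-- For a fixed output frequency a pair is determined by its second entry, so the finite sums extend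
to all of `ℤ` and the bounds do not depend on the dyadic numbers. -/
lemma sum_le_tsum_of_injOn {ι : Type*} (s : Finset ι) (e : ι → ℤ) (he : Set.InjOn e s)
    (A : ℤ → ℝ≥0∞) : ∑ i ∈ s, A (e i) ≤ ∑' q, A q := by
  rw [← Finset.sum_image (f := A) he]
  exact ENNReal.sum_le_tsum _

lemma sqrt_bound (C t X Y : ℝ≥0∞) :
    2 * (C * (t ^ (1 / 4 : ℝ) * (X ^ 2 * Y ^ 2))) ^ (1 / 2 : ℝ) =
      2 * C ^ (1 / 2 : ℝ) * t ^ (1 / 8 : ℝ) * X * Y := by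
  have e : ∀ x : ℝ≥0∞, (x ^ 2) ^ (1 / 2 : ℝ) = x := by
    intro x
    rw [← ENNReal.rpow_natCast, ← ENNReal.rpow_mul]
    norm_num
  rw [ENNReal.mul_rpow_of_nonneg _ _ (by norm_num), ENNReal.mul_rpow_of_nonneg _ _ (by norm_num),
    ENNReal.mul_rpow_of_nonneg _ _ (by norm_num), e, e, ← ENNReal.rpow_mul]
  norm_num
  ring

/-! ### The two nonlinear estimates and the conclusion -/

/-- The estimate of the nonlinearity of the Schrödinger equation. -/
theorem schroedinger_nonlinearity {α β : ℝ} (hα : 0 < α) (hαβ : ∀ m : ℤ, β / α ≠ (m : ℝ)) :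
    ∃ K : ℝ≥0∞, K ≠ ⊤ ∧ ∀ (T : ℝ) (N₀ N₁ N₂ : ℕ) (u v : STDist), 0 < T → T < 1 → 0 < N₂ →
      normYS α 0 u < ⊤ → normYW β (-1 / 2) v < ⊤ →
      normZSOn α 0 T (projFun N₀ (fun t x => proj N₁ u t x * proj N₂ v t x)) ≤
        K * ENNReal.ofReal T ^ (1 / 8 : ℝ) * normYS α 0 u * normYW β (-1 / 2) v := by
  obtain ⟨C₁, hC₁, h₁⟩ := exists_localized
  obtain ⟨C₂, hC₂, h₂⟩ := bilinear_schroedinger hα hαβ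
  refine ⟨2 * (C₂ * (C₁ * C₁)) ^ (1 / 2 : ℝ), by finiteness,
    fun T N₀ N₁ N₂ u v hT hT1 hN₂ hu hv => ?_⟩
  obtain ⟨a, U, hai, hUm, haU, hat, hU1, hU2⟩ := h₁ T (modS α) 0 u hT (measurable_modS α)
    (abs_modS_sub_le α) hu
  obtain ⟨b, V, hbi, hVm, hbV, hbt, hV1, hV2⟩ := h₁ T (modW β) (-1 / 2) v hT (measurable_modW β)
    (abs_modW_sub_le β) hv
  simp only [wF_zero, one_mul] at hU1 hU2
  have hwF : Measurable (wF (-1 / 2)) := measurable_from_top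
  set c : ℤ × ℝ → ℝ≥0∞ := fun z => wF (-1 / 2) z.1 * V z
  have hcm : Measurable c := by fun_prop
  have hε : ENNReal.ofReal T ^ (1 / 4 : ℝ) ≤ 1 :=
    ENNReal.rpow_le_one (ENNReal.ofReal_le_one.mpr hT1.le) (by norm_num)
  obtain ⟨B1, B2⟩ := h₂ U c _ _ _ hUm hcm hε hU1 hU2 hV1 hV2
  obtain ⟨F, G, hF, hFG, hG⟩ := exists_extension (T := T) N₀
    (fun t x => proj N₁ u t x * proj N₂ v t x) (shell N₁ ×ˢ shell N₂) (fun p => p.1 + p.2)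
    (fun _ => 1) (fun p => conv (b p.2) (a p.1)) (fun p => integrable_conv (hbi _) (hai _)) (by
      intro k t ht
      rw [proj_mul_proj, spaceCoeff_sum _ (fun p : ℤ × ℤ => p.1 + p.2), ← Finset.sum_filter,
        ← Finset.mul_sum]
      have : ∀ p : ℤ × ℤ, tFourier (conv (b p.2) (a p.1)) t =
          tFourier (stFourier u p.1) t * tFourier (stFourier v p.2) t := by
        intro p
        rw [tFourier_conv (hbi _) (hai _), hat _ t ht, hbt _ t ht, mul_comm]
      simp only [this]
      have hpi : (Real.pi : ℂ) ≠ 0 := by exact_mod_cast Real.pi_ne_zero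
      field_simp)
  have key : ∀ k τ, ‖G k τ‖ₑ ≤
      ∫⁻ z, wK z.1 ^ (1 / 2 : ℝ) * (U ((k, τ) - z) * c z) ∂stVol := by
    intro k τ
    have hUs : Measurable fun z : ℤ × ℝ => U ((k, τ) - z) := hUm.comp (measurable_const.sub measurable_id)
    rw [lintegral_stVol (by fun_prop)]
    refine (hG k τ).trans ((mul_le_of_le_one_left zero_le (by split_ifs <;> simp)).trans ?_)
    rw [enorm_one, one_mul]
    refine le_trans (Finset.sum_le_sum fun p hp => ?_) (sum_le_tsum_of_injOn _ Prod.snd ?_ _)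
    · simp only [Finset.mem_filter, Finset.mem_product] at hp
      -- The zero wave frequency must be excluded, since `wK` vanishes there and could not dominate
      -- the product.
      have hp0 := ne_zero_of_mem_shell hN₂ hp.1.2
      refine (enorm_conv_le _ _ _).trans (lintegral_mono fun σ => ?_)
      have e : ((k, τ) - (p.2, σ) : ℤ × ℝ) = (p.1, τ - σ) := by
        rw [Prod.mk_sub_mk, ← hp.2, add_sub_cancel_right]
      rw [e]
      simp only [c]
      calc _ ≤ V (p.2, σ) * U (p.1, τ - σ) := mul_le_mul' (hbV _ _) (haU _ _)
        _ = (wK p.2 ^ (1 / 2 : ℝ) * wF (-1 / 2) p.2) * (V (p.2, σ) * U (p.1, τ - σ)) := by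
          rw [wK_mul_wF hp0, one_mul]
        _ = _ := by ring
    · intro p hp q hq hpq
      simp only [Finset.coe_filter, Finset.mem_product, Set.mem_ofPred_eq] at hp hq
      refine Prod.ext ?_ hpq
      have := hp.2.trans hq.2.symm
      simp only [hpq] at this
      exact add_right_cancel this
  refine (iInf₂_le F hF).trans ((normZ_le hFG (D := C₂ * (C₁ * C₁) * (ENNReal.ofReal T ^ (1 / 4 : ℝ) *
    (normYS α 0 u ^ 2 * normYW β (-1 / 2) v ^ 2))) ?_ ?_).trans_eq (sqrt_bound _ _ _ _))
  · refine le_trans ?_ (B1.trans_eq (by unfold normYS normYW; ring))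
    have hk := measurable_conv_kernel hUm hcm
    rw [lintegral_stVol (by fun_prop)]
    refine ENNReal.tsum_le_tsum fun k => lintegral_mono fun τ => pow_le_pow_left' ?_ 2
    rw [wF_zero, one_mul]
    exact mul_le_mul_right (key k τ) _
  · refine le_trans ?_ (B2.trans_eq (by unfold normYS normYW; ring))
    refine ENNReal.tsum_le_tsum fun k => pow_le_pow_left' (lintegral_mono fun τ => ?_) 2
    rw [wF_zero, one_mul]
    exact mul_le_mul_right (key k τ) _

/-- The estimate of the nonlinearity of the wave equation. -/
theorem wave_nonlinearity {α β : ℝ} (hα : 0 < α) (hαβ : ∀ m : ℤ, β / α ≠ (m : ℝ)) :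
    ∃ K : ℝ≥0∞, K ≠ ⊤ ∧ ∀ (T : ℝ) (N₀ N₁ N₂ : ℕ) (u v : STDist), 0 < T → T < 1 →
      normYS α 0 u < ⊤ → normYS α 0 v < ⊤ →
      normZWOn β (-1 / 2) T
          (projFun N₀ (dx (fun t x => proj N₁ u t x * (starRingEnd ℂ) (proj N₂ v t x)))) ≤
        K * ENNReal.ofReal T ^ (1 / 8 : ℝ) * normYS α 0 u * normYS α 0 v := by
  obtain ⟨C₁, hC₁, h₁⟩ := exists_localized
  obtain ⟨C₂, hC₂, h₂⟩ := bilinear_wave hα hαβ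
  refine ⟨2 * (C₂ * (C₁ * C₁)) ^ (1 / 2 : ℝ), by finiteness,
    fun T N₀ N₁ N₂ u v hT hT1 hu hv => ?_⟩
  obtain ⟨a, U, hai, hUm, haU, hat, hU1, hU2⟩ := h₁ T (modS α) 0 u hT (measurable_modS α)
    (abs_modS_sub_le α) hu
  obtain ⟨b, V, hbi, hVm, hbV, hbt, hV1, hV2⟩ := h₁ T (modS α) 0 v hT (measurable_modS α)
    (abs_modS_sub_le α) hv
  simp only [wF_zero, one_mul] at hU1 hU2 hV1 hV2
  have hε : ENNReal.ofReal T ^ (1 / 4 : ℝ) ≤ 1 :=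
    ENNReal.rpow_le_one (ENNReal.ofReal_le_one.mpr hT1.le) (by norm_num)
  obtain ⟨B1, B2⟩ := h₂ U V _ _ _ hUm hVm hε hU1 hU2 hV1 hV2
  obtain ⟨F, G, hF, hFG, hG⟩ := exists_extension (T := T) N₀
    (dx (fun t x => proj N₁ u t x * (starRingEnd ℂ) (proj N₂ v t x)))
    (shell N₁ ×ˢ shell N₂) (fun p => p.1 - p.2) (fun k => Complex.I * (k : ℂ))
    (fun p => conv (fun τ => (starRingEnd ℂ) (b p.2 (-τ))) (a p.1))
    (fun p => integrable_conv (integrable_conj_neg (hbi _)) (hai _)) (by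
      intro k t ht
      rw [dx_proj_mul_conj_proj, spaceCoeff_sum _ (fun p : ℤ × ℤ => p.1 - p.2),
        ← Finset.sum_filter]
      have : ∀ p : ℤ × ℤ, tFourier (conv (fun τ => (starRingEnd ℂ) (b p.2 (-τ))) (a p.1)) t =
          tFourier (stFourier u p.1) t * (starRingEnd ℂ) (tFourier (stFourier v p.2) t) := by
        intro p
        rw [tFourier_conv (integrable_conj_neg (hbi _)) (hai _), tFourier_conj_neg, hat _ t ht,
          hbt _ t ht, mul_comm]
      simp only [this, Finset.mul_sum]
      refine Finset.sum_congr rfl fun p hp => ?_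
      rw [(Finset.mem_filter.mp hp).2]
      have hpi : (Real.pi : ℂ) ≠ 0 := by exact_mod_cast Real.pi_ne_zero
      field_simp)
  have key : ∀ k τ, wF (-1 / 2) k * ‖G k τ‖ₑ ≤
      ∫⁻ y, wK k ^ (1 / 2 : ℝ) * (U (y + (k, τ)) * V y) ∂stVol := by
    intro k τ
    rw [lintegral_const_mul _ (by fun_prop), lintegral_stVol (by fun_prop)]
    calc _ ≤ wF (-1 / 2) k * (1 * (‖Complex.I * (k : ℂ)‖ₑ *
          ∑ p ∈ shell N₁ ×ˢ shell N₂ with p.1 - p.2 = k,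
            ‖conv (fun τ => (starRingEnd ℂ) (b p.2 (-τ))) (a p.1) τ‖ₑ)) := by
          refine mul_le_mul_right ((hG k τ).trans (mul_le_mul_left ?_ _)) _
          split_ifs <;> simp
      _ = (wF (-1 / 2) k * ‖Complex.I * (k : ℂ)‖ₑ) *
          ∑ p ∈ shell N₁ ×ˢ shell N₂ with p.1 - p.2 = k,
            ‖conv (fun τ => (starRingEnd ℂ) (b p.2 (-τ))) (a p.1) τ‖ₑ := by ring
      _ ≤ _ := by
        refine mul_le_mul' (wF_mul_abs_le k) ?_
        refine le_trans (Finset.sum_le_sum fun p hp => ?_) (sum_le_tsum_of_injOn _ Prod.snd ?_ _)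
        · simp only [Finset.mem_filter, Finset.mem_product] at hp
          refine (enorm_conv_le _ _ _).trans ?_
          -- Conjugation reflects the time frequency of `v`; undoing the reflection turns the
          -- convolution into the correlation of `U(y + z)` with `V(y)`.
          rw [← lintegral_neg_eq_self]
          refine lintegral_mono fun σ => ?_
          have e : ((p.2, σ) + (k, τ) : ℤ × ℝ) = (p.1, τ - -σ) := by
            rw [Prod.mk_add_mk, ← hp.2, add_sub_cancel, sub_neg_eq_add, add_comm σ]
          rw [e, neg_neg, RCLike.enorm_conj, mul_comm]
          exact mul_le_mul' (haU _ _) (hbV _ _)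
        · intro p hp q hq hpq
          simp only [Finset.coe_filter, Finset.mem_product, Set.mem_ofPred_eq] at hp hq
          refine Prod.ext ?_ hpq
          have := hp.2.trans hq.2.symm
          simp only [hpq] at this
          exact sub_left_injective this
  refine (iInf₂_le F hF).trans ((normZ_le hFG (D := C₂ * (C₁ * C₁) * (ENNReal.ofReal T ^ (1 / 4 : ℝ) *
    (normYS α 0 u ^ 2 * normYS α 0 v ^ 2))) ?_ ?_).trans_eq (sqrt_bound _ _ _ _))
  · refine le_trans ?_ (B1.trans_eq (by unfold normYS; ring))
    have hk := measurable_corr_kernel hUm hVm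
    rw [lintegral_stVol (by fun_prop)]
    refine ENNReal.tsum_le_tsum fun k => lintegral_mono fun τ => pow_le_pow_left' ?_ 2
    rw [mul_comm (wF _ _), mul_assoc]
    exact mul_le_mul_right (key k τ) _
  · refine le_trans ?_ (B2.trans_eq (by unfold normYS; ring))
    refine ENNReal.tsum_le_tsum fun k => pow_le_pow_left' (lintegral_mono fun τ => ?_) 2
    rw [mul_comm (wF _ _), mul_assoc]
    exact mul_le_mul_right (key k τ) _

lemma const_mul_rpow_le {K : ℝ≥0∞} {C : ℝ} (hC : K ≤ ENNReal.ofReal C) {T γ : ℝ}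
    (hT : 0 < T) (hT1 : T < 1) (hγ : γ ≤ 1 / 8) :
    K * ENNReal.ofReal T ^ (1 / 8 : ℝ) ≤ ENNReal.ofReal (C * T ^ γ) := by
  rw [ENNReal.ofReal_mul' (Real.rpow_nonneg hT.le _), ENNReal.ofReal_rpow_of_pos hT]
  exact mul_le_mul' hC
    (ENNReal.ofReal_le_ofReal (Real.rpow_le_rpow_of_exponent_ge hT hT1.le hγ))

end Zakharov

open Zakharov in
theorem proposition4p1 (α β : ℝ) (hα : 0 < α) (hβ : 0 < β)
    (hαβ : ∀ m : ℤ, β / α ≠ (m : ℝ)) :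
    ∃ γ₀ : ℝ, 0 < γ₀ ∧ ∀ γ : ℝ, 0 < γ → γ < γ₀ →
      ∃ C : ℝ, 0 < C ∧
        ∀ T : ℝ, 0 < T → T < 1 →
        ∀ N₀ N₁ N₂ : ℕ, (∃ j : ℕ, N₀ = 2 ^ j) → (∃ j : ℕ, N₁ = 2 ^ j) → (∃ j : ℕ, N₂ = 2 ^ j) →
          (∀ u v : STDist, normYS α 0 u < ⊤ → normYW β (-1 / 2) v < ⊤ →
            normZSOn α 0 T (projFun N₀ (fun t x => proj N₁ u t x * proj N₂ v t x)) ≤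
              ENNReal.ofReal (C * T ^ γ) * normYS α 0 u * normYW β (-1 / 2) v) ∧
          (∀ u v : STDist, normYS α 0 u < ⊤ → normYS α 0 v < ⊤ →
            normZWOn β (-1 / 2) T
                (projFun N₀ (dx (fun t x => proj N₁ u t x * (starRingEnd ℂ) (proj N₂ v t x)))) ≤
              ENNReal.ofReal (C * T ^ γ) * normYS α 0 u * normYS α 0 v) := by
  obtain ⟨K₁, hK₁, h₁⟩ := schroedinger_nonlinearity hα hαβ
  obtain ⟨K₂, hK₂, h₂⟩ := wave_nonlinearity hα hαβ
  -- Both estimates gain exactly `T^{1/8}`, which for `T < 1` is at most `T^γ`; the summand 1 makes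
  -- the constant positive.
  refine ⟨1 / 8, by norm_num, fun γ _ hγ => ⟨K₁.toReal + K₂.toReal + 1, by positivity,
    fun T hT hT1 N₀ N₁ N₂ _ _ hN₂ => ⟨fun u v hu hv => ?_, fun u v hu hv => ?_⟩⟩⟩
  · have hN : 0 < N₂ := by
      obtain ⟨j, rfl⟩ := hN₂
      positivity
    refine (h₁ T N₀ N₁ N₂ u v hT hT1 hN hu hv).trans ?_
    gcongr
    refine const_mul_rpow_le ?_ hT hT1 hγ.le
    rw [ENNReal.le_ofReal_iff_toReal_le hK₁ (by positivity)]
    linarith [K₂.toReal_nonneg]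
  · refine (h₂ T N₀ N₁ N₂ u v hT hT1 hu hv).trans ?_
    gcongr
    refine const_mul_rpow_le ?_ hT hT1 hγ.le
    rw [ENNReal.le_ofReal_iff_toReal_le hK₂ (by positivity)]
    linarith [K₁.toReal_nonneg]
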